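/- For $n \ge 1$ and sequences $A, B \in ([1,\infty) \cup \{\infty\})^n$, indexed by $0,\dots,n-1$, the Min-Plus Convolution of $A$ and $B$ is the sequence $C$ with $C[k] = \min_{i+j=k} (A[i]+B[j])$ for $0 \le k < n$. $(1+\varepsilon)$-Approximate Min-Plus Convolution is the problem of computing, given $A$, $B$ and $\varepsilon$, a sequence $\tilde C$ with $C[k] \le \tilde C[k] \le (1+\varepsilon)\, C[k]$ for all $0 \le k < n$. Theorem 7.4. $(1+\varepsilon)$-Approximate Min-Plus Convolution can be solved in strongly polynomial time $\tilde O(n^{3/2}/\sqrt{\varepsilon})$. That is, there are one deterministic program and constants $K$, $d$, $c$ such that for all $n \ge 1$, all real $0 < \varepsilon \le 1$ and all $A, B \in ([1,\infty)\cup\{\infty\})^n$, the program halts with a correct output after at most $K\, T\, (1+\log T)^d$ operations, where $T = n^{3/2}/\sqrt{\varepsilon}$. In particular the bound does not depend on the largest input weight $W$. The machine is a unit-cost random access machine. Its integer words are the natural numbers below $(n+2)^c$, that is, they have $O(\log n)$ bits; they admit addition, truncated subtraction, multiplication, division with remainder and comparison, and are used for addressing. Weights are exact numbers in $[0,\infty]$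 in separate memory cells; they can only be added, compared, and multiplied or divided by a positive word, and the constants $1$ and $\infty$ are available. The input is $n$ (a word) and $A$, $B$, $\varepsilon$ (weights). Every operation, test and memory access costs one unit of time. -/

import Mathlib

open scoped ENNReal

/-! A random access machine with two kinds of memory cells.

* *Word cells* hold natural numbers below a bound `B` (the largest word plus one). They are used for
  counting, for addressing, and for all other integer work.
* *Weight cells* hold exact numbers in `[0, ∞]`. Weights can be added, compared, and multiplied or
  divided by a positive word. There is no rounding, no conversion from a weight to a word, and no
  product of two weights.

Memory is organised in arrays that are named by numerals of the program text (a program mentions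
finitely many of them); the index into an array is computed at run time. Every operation, memory
access and test costs one unit of time. -/
namespace RAM

/-- The contents of the memory: `word a i` and `weight a i` are the cells with index `i` of the word
array `a` and of the weight array `a`. -/
structure State where
  word : ℕ → ℕ → ℕ
  weight : ℕ → ℕ → ℝ≥0∞

/-- Binary operations on words (subtraction truncates at `0`). -/
inductive WordOp
  | add
  | sub
  | mul
  | div
  | mod

/-- The value of an operation on words. -/
def WordOp.apply : WordOp → ℕ → ℕ → ℕ
  | .add, x, y => x + y
  | .sub, x, y => x - y
  | .mul, x, y => x * y
  | .div, x, y => x / y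
  | .mod, x, y => x % y

/-- Operations on words that require a nonzero second argument. -/
def WordOp.needsNonzero : WordOp → Prop
  | .div => True
  | .mod => True
  | _ => False

/-- Word expressions: numerals of the program text, memory accesses (with indirect addressing), and
binary operations. -/
inductive WordExpr
  | lit (v : ℕ)
  | get (a : ℕ) (i : WordExpr)
  | op (o : WordOp) (e₁ e₂ : WordExpr)

/-- The value of a word expression. -/
def WordExpr.val (s : State) : WordExpr → ℕ
  | .lit v => v
  | .get a i => s.word a (i.val s)
  | .op o e₁ e₂ => o.apply (e₁.val s) (e₂.val s)

/-- A word expression can be evaluated with words below `B`: it does not divide by `0`, and no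
intermediate result (in particular no address) exceeds the range of a word. -/
def WordExpr.ok (B : ℕ) (s : State) : WordExpr → Prop
  | .lit v => v < B
  | .get a i => i.ok B s ∧ s.word a (i.val s) < B
  | .op o e₁ e₂ => e₁.ok B s ∧ e₂.ok B s ∧ (o.needsNonzero → e₂.val s ≠ 0) ∧
      o.apply (e₁.val s) (e₂.val s) < B

/-- The time to evaluate a word expression: one unit for each node. -/
def WordExpr.cost : WordExpr → ℕ
  | .lit _ => 1
  | .get _ i => i.cost + 1
  | .op _ e₁ e₂ => e₁.cost + e₂.cost + 1

/-- Weight expressions: the constants `1` and `∞`, memory accesses, sums, and products and quotients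
of a weight by a word. -/
inductive WeightExpr
  | one
  | infty
  | get (a : ℕ) (i : WordExpr)
  | add (x y : WeightExpr)
  | mulWord (x : WeightExpr) (e : WordExpr)
  | divWord (x : WeightExpr) (e : WordExpr)

/-- The value of a weight expression. -/
noncomputable def WeightExpr.val (s : State) : WeightExpr → ℝ≥0∞
  | .one => 1
  | .infty => ∞
  | .get a i => s.weight a (i.val s)
  | .add x y => x.val s + y.val s
  | .mulWord x e => x.val s * (e.val s : ℝ≥0∞)
  | .divWord x e => x.val s / (e.val s : ℝ≥0∞)

/-- A weight expression can be evaluated with words below `B`: its addresses and its word arguments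
can be evaluated, and weights are multiplied and divided by nonzero words only. -/
def WeightExpr.ok (B : ℕ) (s : State) : WeightExpr → Prop
  | .one => True
  | .infty => True
  | .get _ i => i.ok B s
  | .add x y => x.ok B s ∧ y.ok B s
  | .mulWord x e => x.ok B s ∧ e.ok B s ∧ e.val s ≠ 0
  | .divWord x e => x.ok B s ∧ e.ok B s ∧ e.val s ≠ 0

/-- The time to evaluate a weight expression: one unit for each node. -/
def WeightExpr.cost : WeightExpr → ℕ
  | .one => 1
  | .infty => 1
  | .get _ i => i.cost + 1
  | .add x y => x.cost + y.cost + 1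
  | .mulWord x e => x.cost + e.cost + 1
  | .divWord x e => x.cost + e.cost + 1

/-- Tests: comparisons of words, comparisons of weights, and their Boolean combinations. -/
inductive Test
  | wordLT (e₁ e₂ : WordExpr)
  | weightLE (x y : WeightExpr)
  | not (b : Test)
  | and (b₁ b₂ : Test)

/-- The truth value of a test. -/
def Test.holds (s : State) : Test → Prop
  | .wordLT e₁ e₂ => e₁.val s < e₂.val s
  | .weightLE x y => x.val s ≤ y.val s
  | .not b => ¬ b.holds s
  | .and b₁ b₂ => b₁.holds s ∧ b₂.holds s

/-- A test can be evaluated with words below `B`. -/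
def Test.ok (B : ℕ) (s : State) : Test → Prop
  | .wordLT e₁ e₂ => e₁.ok B s ∧ e₂.ok B s
  | .weightLE x y => x.ok B s ∧ y.ok B s
  | .not b => b.ok B s
  | .and b₁ b₂ => b₁.ok B s ∧ b₂.ok B s

/-- The time to evaluate a test: one unit for each node. -/
def Test.cost : Test → ℕ
  | .wordLT e₁ e₂ => e₁.cost + e₂.cost + 1
  | .weightLE x y => x.cost + y.cost + 1
  | .not b => b.cost + 1
  | .and b₁ b₂ => b₁.cost + b₂.cost + 1

/-- Programs: assignments to word cells and to weight cells, composition, branching, loops. -/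
inductive Program
  | skip
  | setWord (a : ℕ) (i : WordExpr) (e : WordExpr)
  | setWeight (a : ℕ) (i : WordExpr) (x : WeightExpr)
  | seq (p q : Program)
  | ite (b : Test) (p q : Program)
  | while (b : Test) (p : Program)

/-- The memory after writing `v` to cell `i` of the word array `a`. -/
def State.setWord (s : State) (a i v : ℕ) : State :=
  { s with word := Function.update s.word a (Function.update (s.word a) i v) }

/-- The memory after writing `x` to cell `i` of the weight array `a`. -/
def State.setWeight (s : State) (a i : ℕ) (x : ℝ≥0∞) : State :=
  { s with weight := Function.update s.weight a (Function.update (s.weight a) i x) }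

/-- `Exec B p s t s'`: on a machine whose words are the natural numbers below `B`, the program `p`,
started with memory `s`, halts after `t` units of time with memory `s'`. No rule applies to a program
that leaves the range of words, so such a program has no halting run. -/
inductive Exec (B : ℕ) : Program → State → ℕ → State → Prop
  | skip (s : State) : Exec B .skip s 1 s
  | setWord (s : State) (a : ℕ) (i e : WordExpr) (hi : i.ok B s) (he : e.ok B s) :
      Exec B (.setWord a i e) s (i.cost + e.cost + 1) (s.setWord a (i.val s) (e.val s))
  | setWeight (s : State) (a : ℕ) (i : WordExpr) (x : WeightExpr) (hi : i.ok B s)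
      (hx : x.ok B s) :
      Exec B (.setWeight a i x) s (i.cost + x.cost + 1) (s.setWeight a (i.val s) (x.val s))
  | seq {p q : Program} {s s' s'' : State} {t t' : ℕ} (hp : Exec B p s t s')
      (hq : Exec B q s' t' s'') : Exec B (.seq p q) s (t + t') s''
  | iteTrue {b : Test} {p q : Program} {s s' : State} {t : ℕ} (hb : b.ok B s) (h : b.holds s)
      (hp : Exec B p s t s') : Exec B (.ite b p q) s (b.cost + t + 1) s'
  | iteFalse {b : Test} {p q : Program} {s s' : State} {t : ℕ} (hb : b.ok B s) (h : ¬ b.holds s)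
      (hq : Exec B q s t s') : Exec B (.ite b p q) s (b.cost + t + 1) s'
  | whileTrue {b : Test} {p : Program} {s s' s'' : State} {t t' : ℕ} (hb : b.ok B s)
      (h : b.holds s) (hp : Exec B p s t s') (hw : Exec B (.while b p) s' t' s'') :
      Exec B (.while b p) s (b.cost + t + t' + 1) s''
  | whileFalse {b : Test} {p : Program} {s : State} (hb : b.ok B s) (h : ¬ b.holds s) :
      Exec B (.while b p) s (b.cost + 1) s

end RAM

/-- Min-Plus Convolution: `C[k] = min_{i + j = k} (A[i] + B[j])` for `0 ≤ k < n`. The infimum is over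
a nonempty finite set, hence a minimum. -/
noncomputable def minPlusConv {n : ℕ} (A B : Fin n → ℝ≥0∞) (k : Fin n) : ℝ≥0∞ :=
  ⨅ (i : Fin n) (j : Fin n) (_ : (i : ℕ) + (j : ℕ) = (k : ℕ)), A i + B j

/-- `D` is a correct output of `(1+ε)`-Approximate Min-Plus Convolution on input `A`, `B`. -/
def IsApproxMinPlusConv {n : ℕ} (ε : ℝ) (A B D : Fin n → ℝ≥0∞) : Prop :=
  ∀ k : Fin n, minPlusConv A B k ≤ D k ∧ D k ≤ ENNReal.ofReal (1 + ε) * minPlusConv A B k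

/-- A sequence of length `n` as the contents of an array, with zeros from index `n` on. -/
noncomputable def arrayOf {n : ℕ} (A : Fin n → ℝ≥0∞) (i : ℕ) : ℝ≥0∞ :=
  if h : i < n then A ⟨i, h⟩ else 0

/-- The initial memory: `n` is in cell `0` of the word array `0`, the sequences `A` and `B` are in the
weight arrays `0` and `1`, and `ε` is in cell `0` of the weight array `2`. All else is zero. -/
noncomputable def convInput {n : ℕ} (ε : ℝ) (A B : Fin n → ℝ≥0∞) : RAM.State where
  word a i := if a = 0 ∧ i = 0 then n else 0
  weight
    | 0, i => arrayOf A i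
    | 1, i => arrayOf B i
    | 2, 0 => ENNReal.ofReal ε
    | _, _ => 0

/-- The output: the first `n` cells of the weight array `3`. -/
def convOutput (n : ℕ) (s : RAM.State) (k : Fin n) : ℝ≥0∞ :=
  s.weight 3 k

/-- The function `T ↦ K · T · (1 + log T) ^ d`; for `T ≥ 1`, a quantity is `Õ(T) = O(T polylog T)`
if it is bounded by this function for some constants `K` and `d`. -/
noncomputable def softO (K : ℝ) (d : ℕ) (T : ℝ) : ℝ :=
  K * T * (1 + Real.log T) ^ d

/-!
The algorithm combines rounding with grouping, so that its time does not depend on the weights.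

Fix a resolution `E` of about `2 / ε` (but at most `2 n`) and a group size `τ` of about `√(n E)`. It
suffices to treat the outputs `k` whose best sum `A i + B j` has `B j ≤ A i`; a second pass with `A` and
`B` exchanged treats the others. Sort the finite entries of `A` and cut the sorted order into groups: a
group takes `τ` entries and then all further entries below twice its smallest entry `lo`. So the smallest
entry at least doubles from one group to the next, there are at most `n / τ + 1` groups, and a group with
more than `τ` entries has all of its entries in `[lo, 2 lo)`.

For each group, let `hi` be its largest entry. All of its entries and all entries `B j ≤ hi` are rounded
down to multiples of `lo / E`, with the quotient capped at `2 E`. An entry `y` with quotient `a` is marked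
in the cell `y + 2 n a` of a `0`-`1`-sequence; the product of the two sequences, whose length is
`O(n E)`, shows for each `k` and each sum of quotients whether some pair in the group attains them.
A group with more than `τ` entries thereby yields upper bounds with an error of `2 lo / E ≤ ε lo`
(`processed`). A group with at most `τ` entries serves another purpose: if `g` is the first group that
contributes any pair to `k` (a *hit*), then the best sum is at most `2 hi` of that group, so that its
larger term lies in the group `g` or in the next one, and it is found by trying the `2 τ` members
that come first in these two groups (`Groups.bound`).

The time is `O(n τ)` for sorting and for the exhaustive search, and `O(n / τ + 1)` products of length
`O(n E) = O(τ ^ 2)`, which is `O(n τ)` up to logarithms; and `n τ = O(n √(n / ε))`.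

The products must be computed in quasilinear time without roots of unity in the machine. They are
computed modulo `x ^ N + 1` and modulo an odd number `M > N` by the transform of Schönhage and Strassen,
in the form of Nussbaumer: with `N = m r`, a polynomial in `x` is a polynomial of degree below `m` in `x`
over the ring of polynomials in `y = x ^ m` with `y ^ r = -1`, and `y` is a root of unity there of
sufficient order for a transform of length `2 m`. The factors of `2` that the inverse transform leaves
behind are not divided out: they are units modulo `M`, and only the positions of the nonzero coefficients
matter. The correctness of the transform (`BlockProd.level`) is expressed by identities that hold in all
commutative rings of characteristic dividing `M` with elements that satisfy the relations.

Programs are verified in a small program logic with time bounds, `Runs`. Its time bounds are generous: an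
expression is charged as if its cost were `1000`.
-/
namespace RAM

/-! ### Safe expressions -/

instance (v : ℕ) : OfNat WordExpr v := ⟨.lit v⟩
instance : Add WordExpr := ⟨.op .add⟩
instance : Sub WordExpr := ⟨.op .sub⟩
instance : Mul WordExpr := ⟨.op .mul⟩
instance : Div WordExpr := ⟨.op .div⟩
instance : Mod WordExpr := ⟨.op .mod⟩

/-- A scalar variable: cell `0` of a word array of its own. -/
def WordExpr.var (a : ℕ) : WordExpr := .get a 0

/-- Assignment to a scalar variable. -/
def Program.setVar (a : ℕ) (e : WordExpr) : Program := .setWord a 0 e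

/-- The expression has no division by `0` and no literal above `4`. On a machine with large enough words
nothing else can make its evaluation fail. -/
def WordExpr.safe (s : State) : WordExpr → Prop
  | .lit v => v ≤ 4
  | .get _ i => i.safe s
  | .op o e₁ e₂ => e₁.safe s ∧ e₂.safe s ∧ (o.needsNonzero → e₂.val s ≠ 0)

/-- The analogue of `WordExpr.safe` for weight expressions. -/
def WeightExpr.safe (s : State) : WeightExpr → Prop
  | .one => True
  | .infty => True
  | .get _ i => i.safe s
  | .add x y => x.safe s ∧ y.safe s
  | .mulWord x e => x.safe s ∧ e.safe s ∧ e.val s ≠ 0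
  | .divWord x e => x.safe s ∧ e.safe s ∧ e.val s ≠ 0

/-- The analogue of `WordExpr.safe` for tests. -/
def Test.safe (s : State) : Test → Prop
  | .wordLT e₁ e₂ => e₁.safe s ∧ e₂.safe s
  | .weightLE x y => x.safe s ∧ y.safe s
  | .not b => b.safe s
  | .and b₁ b₂ => b₁.safe s ∧ b₂.safe s

/-- All words in memory are below `X` (and `X` exceeds all literals of safe expressions). -/
def State.Small (X : ℕ) (s : State) : Prop := 4 < X ∧ ∀ a i, s.word a i < X

/-- The value of an expression is polynomial in the words in memory, of a degree bounded by its cost. -/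
theorem WordExpr.val_lt {X : ℕ} {s : State} (hs : s.Small X) {e : WordExpr} (h : e.safe s) :
    e.val s < X ^ e.cost := by
  have hX : 0 < X := by have := hs.1; omega
  induction e with
  | lit v => simp only [safe, val, cost, pow_one] at *; have := hs.1; omega
  | get a i ih =>
    exact lt_of_lt_of_le (hs.2 _ _) (Nat.le_self_pow (by simp [cost]) X)
  | op o e₁ e₂ h₁ h₂ =>
    obtain ⟨s1, s2, -⟩ := h
    have h₁ := h₁ s1
    have h₂ := h₂ s2
    have k1 : X ^ e₁.cost ≤ X ^ (e₁.cost + e₂.cost) := Nat.pow_le_pow_right hX (by omega)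
    have k2 : X ^ e₂.cost ≤ X ^ (e₁.cost + e₂.cost) := Nat.pow_le_pow_right hX (by omega)
    have k3 : 2 * X ^ (e₁.cost + e₂.cost) ≤ X ^ (e₁.cost + e₂.cost + 1) := by
      rw [pow_succ, mul_comm]; exact Nat.mul_le_mul_left _ (by have := hs.1; omega)
    simp only [val, cost]
    cases o <;> simp only [WordOp.apply]
    · omega
    · omega
    · have : e₁.val s * e₂.val s < X ^ e₁.cost * X ^ e₂.cost := Nat.mul_lt_mul'' h₁ h₂
      rw [← pow_add] at this
      omega
    · have := Nat.div_le_self (e₁.val s) (e₂.val s); omega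
    · have := Nat.mod_le (e₁.val s) (e₂.val s); omega

theorem WordExpr.ok_of_safe {X c : ℕ} {s : State} (hs : s.Small X) {e : WordExpr} (h : e.safe s)
    (hc : e.cost ≤ c) : e.ok (X ^ c) s := by
  have hX : 0 < X := by have := hs.1; omega
  have key : ∀ e : WordExpr, e.safe s → e.cost ≤ c → e.val s < X ^ c := fun e h h' =>
    lt_of_lt_of_le (val_lt hs h) (Nat.pow_le_pow_right hX h')
  induction e with
  | lit v => exact key _ h hc
  | get a i ih => exact ⟨ih h (by simp [cost] at hc; omega), key (.get a i) h hc⟩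
  | op o e₁ e₂ h₁ h₂ =>
    have hc' := hc
    simp only [cost] at hc'
    exact ⟨h₁ h.1 (by omega), h₂ h.2.1 (by omega), h.2.2, key (.op o e₁ e₂) h hc⟩

theorem WeightExpr.ok_of_safe {X c : ℕ} {s : State} (hs : s.Small X) {e : WeightExpr}
    (h : e.safe s) (hc : e.cost ≤ c) : e.ok (X ^ c) s := by
  induction e with
  | one => trivial
  | infty => trivial
  | get a i => exact WordExpr.ok_of_safe hs h (by simp [cost] at hc; omega)
  | add x y h₁ h₂ =>
    simp only [cost] at hc
    exact ⟨h₁ h.1 (by omega), h₂ h.2 (by omega)⟩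
  | mulWord x e ih =>
    simp only [cost] at hc
    exact ⟨ih h.1 (by omega), WordExpr.ok_of_safe hs h.2.1 (by omega), h.2.2⟩
  | divWord x e ih =>
    simp only [cost] at hc
    exact ⟨ih h.1 (by omega), WordExpr.ok_of_safe hs h.2.1 (by omega), h.2.2⟩

theorem Test.ok_of_safe {X c : ℕ} {s : State} (hs : s.Small X) {b : Test}
    (h : b.safe s) (hc : b.cost ≤ c) : b.ok (X ^ c) s := by
  induction b with
  | wordLT x y =>
    simp only [cost] at hc
    exact ⟨WordExpr.ok_of_safe hs h.1 (by omega), WordExpr.ok_of_safe hs h.2 (by omega)⟩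
  | weightLE x y =>
    simp only [cost] at hc
    exact ⟨WeightExpr.ok_of_safe hs h.1 (by omega), WeightExpr.ok_of_safe hs h.2 (by omega)⟩
  | not b ih => simp only [cost] at hc; exact ih h (by omega)
  | and x y h₁ h₂ =>
    simp only [cost] at hc
    exact ⟨h₁ h.1 (by omega), h₂ h.2 (by omega)⟩

section simps
variable (s : State) (e₁ e₂ : WordExpr) (a i v b j : ℕ) (x : ℝ≥0∞)

@[simp] theorem WordExpr.val_ofNat : (no_index (OfNat.ofNat v : WordExpr)).val s = OfNat.ofNat v := rfl
@[simp] theorem WordExpr.val_var : (var a).val s = s.word a 0 := rfl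
@[simp] theorem WordExpr.val_get : (get a e₁).val s = s.word a (e₁.val s) := rfl
@[simp] theorem WordExpr.val_add : (e₁ + e₂).val s = e₁.val s + e₂.val s := rfl
@[simp] theorem WordExpr.val_sub : (e₁ - e₂).val s = e₁.val s - e₂.val s := rfl
@[simp] theorem WordExpr.val_mul : (e₁ * e₂).val s = e₁.val s * e₂.val s := rfl
@[simp] theorem WordExpr.val_div : (e₁ / e₂).val s = e₁.val s / e₂.val s := rfl
@[simp] theorem WordExpr.val_mod : (e₁ % e₂).val s = e₁.val s % e₂.val s := rfl
@[simp] theorem WordExpr.safe_ofNat : (no_index (OfNat.ofNat v : WordExpr)).safe s ↔ (OfNat.ofNat v : ℕ) ≤ 4 :=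
  Iff.rfl
@[simp] theorem WordExpr.safe_var : (var a).safe s := Nat.zero_le _
@[simp] theorem WordExpr.safe_get : (get a e₁).safe s ↔ e₁.safe s := Iff.rfl
@[simp] theorem WordExpr.safe_add : (e₁ + e₂).safe s ↔ e₁.safe s ∧ e₂.safe s := by
  change (_ ∧ _ ∧ (False → _)) ↔ _; simp
@[simp] theorem WordExpr.safe_sub : (e₁ - e₂).safe s ↔ e₁.safe s ∧ e₂.safe s := by
  change (_ ∧ _ ∧ (False → _)) ↔ _; simp
@[simp] theorem WordExpr.safe_mul : (e₁ * e₂).safe s ↔ e₁.safe s ∧ e₂.safe s := by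
  change (_ ∧ _ ∧ (False → _)) ↔ _; simp
@[simp] theorem WordExpr.safe_div :
    (e₁ / e₂).safe s ↔ e₁.safe s ∧ e₂.safe s ∧ e₂.val s ≠ 0 := by
  change (_ ∧ _ ∧ (True → _)) ↔ _; simp
@[simp] theorem WordExpr.safe_mod :
    (e₁ % e₂).safe s ↔ e₁.safe s ∧ e₂.safe s ∧ e₂.val s ≠ 0 := by
  change (_ ∧ _ ∧ (True → _)) ↔ _; simp

@[simp] theorem State.word_setWord :
    (s.setWord a i v).word b j = if b = a ∧ j = i then v else s.word b j := by
  by_cases h : b = a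
  · subst h; simp [State.setWord, Function.update_apply]
  · simp [State.setWord, h]
@[simp] theorem State.weight_setWord : (s.setWord a i v).weight = s.weight := rfl
@[simp] theorem State.word_setWeight : (s.setWeight a i x).word = s.word := rfl
@[simp] theorem State.weight_setWeight :
    (s.setWeight a i x).weight b j = if b = a ∧ j = i then x else s.weight b j := by
  by_cases h : b = a
  · subst h; simp [State.setWeight, Function.update_apply]
  · simp [State.setWeight, h]

theorem State.word_setWord_of_ne {s : State} {a b : ℕ} (h : b ≠ a) (i v : ℕ) :
    (s.setWord a i v).word b = s.word b := by
  funext j; simp [h]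

theorem State.weight_setWeight_of_ne {s : State} {a b : ℕ} (h : b ≠ a) (i : ℕ) (x : ℝ≥0∞) :
    (s.setWeight a i x).weight b = s.weight b := by
  funext j; simp [h]

end simps

theorem State.Small.setWord {X : ℕ} {s : State} (hs : s.Small X) {a i v : ℕ} (hv : v < X) :
    (s.setWord a i v).Small X := by
  refine ⟨hs.1, fun b j => ?_⟩
  rw [State.word_setWord]
  split_ifs
  exacts [hv, hs.2 _ _]

theorem State.Small.setWeight {X : ℕ} {s : State} (hs : s.Small X) {a i : ℕ} {x : ℝ≥0∞} :
    (s.setWeight a i x).Small X := hs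

/-! ### Written arrays -/

/-- The word arrays that a program writes. -/
def Program.wordWrites : Program → List ℕ
  | .skip => []
  | .setWord a _ _ => [a]
  | .setWeight _ _ _ => []
  | .seq p q => p.wordWrites ++ q.wordWrites
  | .ite _ p q => p.wordWrites ++ q.wordWrites
  | .while _ p => p.wordWrites

/-- The weight arrays that a program writes. -/
def Program.weightWrites : Program → List ℕ
  | .skip => []
  | .setWord _ _ _ => []
  | .setWeight a _ _ => [a]
  | .seq p q => p.weightWrites ++ q.weightWrites
  | .ite _ p q => p.weightWrites ++ q.weightWrites
  | .while _ p => p.weightWrites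

/-- The memory `s'` differs from `s` only in arrays that `p` writes. -/
def Program.Frame (p : Program) (s s' : State) : Prop :=
  (∀ a, a ∉ p.wordWrites → ∀ i, s'.word a i = s.word a i) ∧
    ∀ a, a ∉ p.weightWrites → ∀ i, s'.weight a i = s.weight a i

/-- A run changes only the arrays that its program writes. -/
theorem Exec.frame {B : ℕ} {p : Program} {s s' : State} {t : ℕ} (h : Exec B p s t s') :
    p.Frame s s' := by
  induction h with
  | skip s => exact ⟨fun _ _ _ => rfl, fun _ _ _ => rfl⟩
  | setWord s a i e hi he =>
    refine ⟨fun b hb j => ?_, fun _ _ _ => rfl⟩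
    rw [Program.wordWrites, List.mem_singleton] at hb
    simp [hb]
  | setWeight s a i e hi he =>
    refine ⟨fun _ _ _ => rfl, fun b hb j => ?_⟩
    rw [Program.weightWrites, List.mem_singleton] at hb
    simp [hb]
  | seq hp hq h₁ h₂ =>
    refine ⟨fun a ha i => ?_, fun a ha i => ?_⟩
    · rw [Program.wordWrites, List.mem_append, not_or] at ha
      rw [h₂.1 a ha.2, h₁.1 a ha.1]
    · rw [Program.weightWrites, List.mem_append, not_or] at ha
      rw [h₂.2 a ha.2, h₁.2 a ha.1]
  | iteTrue hb h hp ih =>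
    refine ⟨fun a ha i => ?_, fun a ha i => ?_⟩
    · rw [Program.wordWrites, List.mem_append, not_or] at ha
      rw [ih.1 a ha.1]
    · rw [Program.weightWrites, List.mem_append, not_or] at ha
      rw [ih.2 a ha.1]
  | iteFalse hb h hp ih =>
    refine ⟨fun a ha i => ?_, fun a ha i => ?_⟩
    · rw [Program.wordWrites, List.mem_append, not_or] at ha
      rw [ih.1 a ha.2]
    · rw [Program.weightWrites, List.mem_append, not_or] at ha
      rw [ih.2 a ha.2]
  | whileTrue hb h hp hw h₁ h₂ =>
    exact ⟨fun a ha i => (h₂.1 a ha i).trans (h₁.1 a ha i),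
      fun a ha i => (h₂.2 a ha i).trans (h₁.2 a ha i)⟩
  | whileFalse hb h => exact ⟨fun _ _ _ => rfl, fun _ _ _ => rfl⟩

/-! ### A program logic with time bounds -/

/-- If all words of the memory `s` are below `X`, then on a machine with words below `X ^ 1000` the
program `p` halts after at most `t` units of time with a memory that has the property `Q` and again
holds words below `X` only. The gap between `X` and `X ^ 1000` leaves room for intermediate results. -/
def Runs (X : ℕ) (p : Program) (s : State) (t : ℕ) (Q : State → Prop) : Prop :=
  s.Small X → ∃ t' s', Exec (X ^ 1000) p s t' s' ∧ t' ≤ t ∧ s'.Small X ∧ Q s'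

variable {X : ℕ} {p q : Program} {s : State} {t t₁ t₂ : ℕ} {Q R : State → Prop}

theorem Runs.mono (h : Runs X p s t₁ Q) (ht : t₁ ≤ t₂)
    (hQ : ∀ s', s'.Small X → p.Frame s s' → Q s' → R s') : Runs X p s t₂ R := fun hs => by
  obtain ⟨t', s', h₁, h₂, h₃, h₄⟩ := h hs
  exact ⟨t', s', h₁, h₂.trans ht, h₃, hQ s' h₃ h₁.frame h₄⟩

/-- One may assume that the memory is small, as `Runs` promises nothing otherwise. -/
theorem Runs.of_small (h : s.Small X → Runs X p s t Q) : Runs X p s t Q := fun hs => h hs hs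

theorem runs_skip (hQ : Q s) : Runs X .skip s 1 Q :=
  fun hs => ⟨1, s, Exec.skip s, le_rfl, hs, hQ⟩

theorem runs_setWord {a : ℕ} {i e : WordExpr} (hc : i.cost ≤ 1000 ∧ e.cost ≤ 1000)
    (hi : i.safe s) (he : e.safe s) (hv : s.Small X → e.val s < X)
    (hQ : Q (s.setWord a (i.val s) (e.val s))) :
    Runs X (.setWord a i e) s 2001 Q := fun hs =>
  ⟨_, _, Exec.setWord s a i e (WordExpr.ok_of_safe hs hi hc.1) (WordExpr.ok_of_safe hs he hc.2),
    by omega, hs.setWord (hv hs), hQ⟩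

theorem runs_setVar {a : ℕ} {e : WordExpr} (hc : e.cost ≤ 1000)
    (he : e.safe s) (hv : s.Small X → e.val s < X)
    (hQ : Q (s.setWord a 0 (e.val s))) :
    Runs X (.setVar a e) s 1002 Q := fun hs =>
  ⟨_, _, Exec.setWord s a 0 e (WordExpr.ok_of_safe (e := 0) hs (Nat.zero_le _) (by decide))
    (WordExpr.ok_of_safe hs he hc),
    by change 1 + e.cost + 1 ≤ _; omega, hs.setWord (hv hs), hQ⟩

theorem runs_setWeight {a : ℕ} {i : WordExpr} {x : WeightExpr} (hc : i.cost ≤ 1000 ∧ x.cost ≤ 1000)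
    (hi : i.safe s) (hx : x.safe s) (hQ : Q (s.setWeight a (i.val s) (x.val s))) :
    Runs X (.setWeight a i x) s 2001 Q := fun hs =>
  ⟨_, _, Exec.setWeight s a i x (WordExpr.ok_of_safe hs hi hc.1)
    (WeightExpr.ok_of_safe hs hx hc.2), by omega, hs.setWeight, hQ⟩

theorem Runs.seq (hp : Runs X p s t₁ R)
    (hq : ∀ s', s'.Small X → p.Frame s s' → R s' → Runs X q s' t₂ Q) :
    Runs X (.seq p q) s (t₁ + t₂) Q := fun hs => by
  obtain ⟨u, s', h₁, h₂, h₃, h₄⟩ := hp hs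
  obtain ⟨u', s'', k₁, k₂, k₃, k₄⟩ := hq s' h₃ h₁.frame h₄ h₃
  exact ⟨u + u', s'', h₁.seq k₁, by omega, k₃, k₄⟩

theorem runs_ite {b : Test} (hc : b.cost ≤ 1000) (hb : b.safe s)
    (hp : b.holds s → Runs X p s t Q) (hq : ¬ b.holds s → Runs X q s t Q) :
    Runs X (.ite b p q) s (t + 1001) Q := fun hs => by
  by_cases h : b.holds s
  · obtain ⟨u, s', h₁, h₂, h₃, h₄⟩ := hp h hs
    exact ⟨_, s', Exec.iteTrue (Test.ok_of_safe hs hb hc) h h₁, by omega, h₃, h₄⟩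
  · obtain ⟨u, s', h₁, h₂, h₃, h₄⟩ := hq h hs
    exact ⟨_, s', Exec.iteFalse (Test.ok_of_safe hs hb hc) h h₁, by omega, h₃, h₄⟩

/-- Loops with an invariant `I` and a measure `μ` that bounds the number of iterations. -/
theorem runs_while {b : Test} (hc : b.cost ≤ 1000) (I : State → Prop) (μ : State → ℕ)
    (hb : ∀ s', I s' → b.safe s')
    (hp : ∀ s', s'.Small X → (Program.while b p).Frame s s' → I s' → b.holds s' →
      Runs X p s' t (fun s'' => I s'' ∧ μ s'' < μ s'))
    (h0 : I s) :
    Runs X (.while b p) s ((μ s + 1) * (t + 1001))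
      (fun s' => I s' ∧ ¬ b.holds s') := by
  suffices H : ∀ k, ∀ s', μ s' = k → (Program.while b p).Frame s s' → I s' →
      Runs X (.while b p) s' (k * (b.cost + t + 1) + b.cost + 1)
        (fun s' => I s' ∧ ¬ b.holds s') from
    (H _ s rfl ⟨fun _ _ _ => rfl, fun _ _ _ => rfl⟩ h0).mono (by
      have : μ s * (b.cost + t + 1) ≤ μ s * (t + 1001) := Nat.mul_le_mul_left _ (by omega)
      rw [Nat.succ_mul]; omega) fun _ _ _ h => h
  intro k
  induction k using Nat.strong_induction_on with
  | _ k ih =>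
    intro s' hk hF hI hs
    by_cases h : b.holds s'
    · obtain ⟨u, s₂, h₁, h₂, h₃, h₄, h₅⟩ := hp s' hs hF hI h hs
      have hF₂ : (Program.while b p).Frame s s₂ :=
        ⟨fun a ha i => (h₁.frame.1 a ha i).trans (hF.1 a ha i),
          fun a ha i => (h₁.frame.2 a ha i).trans (hF.2 a ha i)⟩
      obtain ⟨u', s₃, k₁, k₂, k₃, k₄⟩ := ih (μ s₂) (hk ▸ h₅) s₂ rfl hF₂ h₄ h₃
      refine ⟨_, s₃, Exec.whileTrue (Test.ok_of_safe hs (hb s' hI) hc) h h₁ k₁, ?_, k₃, k₄⟩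
      have : (μ s₂ + 1) * (b.cost + t + 1) ≤ k * (b.cost + t + 1) :=
        Nat.mul_le_mul_right _ (by omega)
      rw [Nat.succ_mul] at this
      omega
    · refine ⟨_, s', Exec.whileFalse (Test.ok_of_safe hs (hb s' hI) hc) h, ?_, hs, hI, h⟩
      have := Nat.zero_le (k * (b.cost + t + 1))
      omega

/-- `for v < lim do p`, with a scalar variable `v`. -/
def Program.forLoop (v : ℕ) (lim : WordExpr) (p : Program) : Program :=
  .seq (.setVar v 0) (.while (.wordLT (.var v) lim) (.seq p (.setVar v (.var v + 1))))

/-- Counting loops with an invariant `I k` that holds before the iteration `k`. The body has to establish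
`I (k + 1)` for the memory as it is after the update of the loop variable `v`. -/
theorem runs_for {v n : ℕ} {lim : WordExpr} (I : ℕ → State → Prop) (hc : lim.cost ≤ 900)
    (hv : v ∉ p.wordWrites)
    (hlim : ∀ k s', (Program.forLoop v lim p).Frame s s' → I k s' →
      lim.safe s' ∧ lim.val s' = n)
    (hp : ∀ k s', k < n → s'.Small X → (Program.forLoop v lim p).Frame s s' → I k s' →
      s'.word v 0 = k → Runs X p s' t (fun s'' => I (k + 1) (s''.setWord v 0 (k + 1))))
    (h0 : I 0 (s.setWord v 0 0)) (hn : s.Small X → n < X) :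
    Runs X (.forLoop v lim p) s ((n + 2) * (t + 2003)) (I n) := by
  refine Runs.of_small fun h_small => ?_
  refine ((runs_setVar (Q := fun s' => s' = s.setWord v 0 0) (by decide) (Nat.zero_le _)
    (fun hs => by have := hs.1; simp; omega) rfl).seq (t₂ := (n + 1) * (t + 2003))
    (fun s₀ hs₀ hF₀ h => ?_)).mono ?_ (fun _ _ _ h => h)
  swap
  · rw [Nat.succ_mul (n + 1)]; omega
  subst h
  have hF0 : (Program.forLoop v lim p).Frame s (s.setWord v 0 0) := by
    refine ⟨fun a ha i => hF₀.1 a (fun h => ha ?_) i, fun a ha i => rfl⟩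
    exact List.mem_append_left _ h
  have := runs_while (X := X) (p := .seq p (.setVar v (.var v + 1)))
    (b := .wordLT (.var v) lim) (s := s.setWord v 0 0) (t := t + 1002)
    (by change 2 + lim.cost + 1 ≤ _; omega)
    (fun s' => (Program.forLoop v lim p).Frame s s' ∧ I (s'.word v 0) s' ∧ s'.word v 0 ≤ n)
    (fun s' => n - s'.word v 0)
    (fun s' h => ⟨WordExpr.safe_var _ _, (hlim _ _ h.1 h.2.1).1⟩) ?_
    ⟨hF0, by simpa using h0, by simp⟩
  · refine this.mono (by simp [add_assoc]) ?_
    rintro s' - - ⟨⟨h1, h2, h3⟩, h4⟩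
    have h5 : ¬ s'.word v 0 < n := by
      have := (hlim _ _ h1 h2).2
      intro h; apply h4; change s'.word v 0 < _; omega
    have : s'.word v 0 = n := by omega
    rwa [this] at h2
  · rintro s' hs' hF ⟨h1, h2, h3⟩ h4
    have h4 : s'.word v 0 < n := by
      have := (hlim _ _ h1 h2).2
      change s'.word v 0 < _ at h4; omega
    have H := hp _ s' h4 hs' h1 h2 rfl
    refine (H.seq (t₂ := 1002) (Q := fun s'' => ((Program.forLoop v lim p).Frame s s'' ∧
      I (s''.word v 0) s'' ∧ s''.word v 0 ≤ n) ∧ n - s''.word v 0 < n - s'.word v 0)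
      fun s₂ hs₂ hF₂ hI₂ => ?_)
    have e : s₂.word v 0 = s'.word v 0 := hF₂.1 v hv 0
    refine runs_setVar (X := X) (s := s₂) (a := v) (e := .var v + 1)
      (by change 2 + 1 + 1 ≤ 1000; omega) (by simp) (fun hs => by
      simp only [WordExpr.val_add, WordExpr.val_var, WordExpr.val_ofNat]
      have := hn h_small; omega) ?_
    simp only [WordExpr.val_add, WordExpr.val_var, WordExpr.val_ofNat, State.word_setWord,
      and_self, if_true, e]
    refine ⟨⟨⟨fun a ha i => ?_, fun a ha i => ?_⟩, hI₂, by omega⟩, by omega⟩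
    · have ha' : a ≠ v ∧ a ∉ p.wordWrites := by
        simp only [Program.forLoop, Program.wordWrites, Program.setVar, List.mem_append,
          List.mem_singleton, not_or] at ha
        exact ⟨ha.1, ha.2.1⟩
      rw [State.word_setWord, if_neg (by tauto), hF₂.1 a ha'.2, h1.1 a ha]
    · have ha' : a ∉ p.weightWrites := by
        simp only [Program.forLoop, Program.weightWrites, Program.setVar, List.mem_append,
          not_or] at ha
        exact ha.2.1
      rw [State.weight_setWord, hF₂.2 a ha', h1.2 a ha]

infixr:60 " ;; " => Program.seq

theorem runs_setVar_seq {a : ℕ} {e : WordExpr} (hc : e.cost ≤ 1000) (he : e.safe s)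
    (hv : s.Small X → e.val s < X) (hq : Runs X q (s.setWord a 0 (e.val s)) t Q) :
    Runs X (.setVar a e ;; q) s (1002 + t) Q :=
  (runs_setVar (Q := fun s' => s' = s.setWord a 0 (e.val s)) hc he hv rfl).seq
    fun _ _ _ h => h ▸ hq

theorem runs_setWord_seq {a : ℕ} {i e : WordExpr} (hc : i.cost ≤ 1000 ∧ e.cost ≤ 1000)
    (hi : i.safe s) (he : e.safe s) (hv : s.Small X → e.val s < X)
    (hq : Runs X q (s.setWord a (i.val s) (e.val s)) t Q) :
    Runs X (.setWord a i e ;; q) s (2001 + t) Q :=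
  (runs_setWord (Q := fun s' => s' = s.setWord a (i.val s) (e.val s)) hc hi he hv rfl).seq
    fun _ _ _ h => h ▸ hq

theorem runs_setWeight_seq {a : ℕ} {i : WordExpr} {x : WeightExpr}
    (hc : i.cost ≤ 1000 ∧ x.cost ≤ 1000) (hi : i.safe s) (hx : x.safe s)
    (hq : Runs X q (s.setWeight a (i.val s) (x.val s)) t Q) :
    Runs X (.setWeight a i x ;; q) s (2001 + t) Q :=
  (runs_setWeight (Q := fun s' => s' = s.setWeight a (i.val s) (x.val s)) hc hi hx rfl).seq
    fun _ _ _ h => h ▸ hq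

/-- Replaces the first cells of the word array `dst` by the values of the expression `e`, which
depends on the number `v` of the cell and on the old contents. The new contents are built up in the
array `tmp`. -/
def Program.mapStage (v : ℕ) (lim : WordExpr) (tmp dst : ℕ) (e : WordExpr) : Program :=
  .forLoop v lim (.setWord tmp (.var v) e) ;;
    .forLoop v lim (.setWord dst (.var v) (.get tmp (.var v)))

/-- A loop that writes the values `F 0, …, F (n - 1)` to the array `dst`. -/
theorem runs_fill {v n dst : ℕ} {lim e : WordExpr} {F : ℕ → ℕ} (hc : lim.cost ≤ 900)
    (hc' : e.cost ≤ 1000) (hne : v ≠ dst)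
    (hlim : ∀ s', (∀ a, a ≠ v → a ≠ dst → ∀ i, s'.word a i = s.word a i) →
      lim.safe s' ∧ lim.val s' = n)
    (he : ∀ t < n, ∀ s', (∀ a, a ≠ v → a ≠ dst → ∀ i, s'.word a i = s.word a i) →
      s'.word v 0 = t → e.safe s' ∧ e.val s' = F t)
    (hF : s.Small X → ∀ t < n, F t < X) (hn : s.Small X → n < X) :
    Runs X (.forLoop v lim (.setWord dst (.var v) e)) s ((n + 2) * 5000)
      (fun s' => ∀ t, s'.word dst t = if t < n then F t else s.word dst t) := by
  refine Runs.of_small fun hs => ?_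
  have hfr : ∀ s', (Program.forLoop v lim (.setWord dst (.var v) e)).Frame s s' →
      ∀ a, a ≠ v → a ≠ dst → ∀ i, s'.word a i = s.word a i := fun s' h a h1 h2 =>
    h.1 a (by simp [Program.forLoop, Program.setVar, Program.wordWrites, h1, h2])
  refine (runs_for (t := 2001) (I := fun k s' => ∀ t, s'.word dst t =
    if t < k then F t else s.word dst t) hc (by simpa [Program.wordWrites] using hne)
    (fun k s' h _ => hlim s' (hfr s' h)) (fun k s' hk hs' h hI hv => ?_) ?_ hn).mono
    (Nat.mul_le_mul_left _ (by norm_num)) fun _ _ _ h => h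
  · obtain ⟨h1, h2⟩ := he k hk s' (hfr s' h) hv
    refine runs_setWord ⟨by change 2 ≤ 1000; norm_num, hc'⟩ (by simp) h1
      (fun _ => h2 ▸ hF hs k hk) fun t => ?_
    simp only [State.word_setWord, WordExpr.val_var, hv, h2, hne.symm, false_and, if_false,
      true_and, hI]
    rcases lt_trichotomy t k with h | h | h
    · simp [h.ne, h, Nat.lt_succ_of_lt h]
    · simp [h]
    · simp [h.ne', h.not_gt, show ¬ t < k + 1 by omega]
  · simp [hne.symm]

theorem runs_mapStage {v n tmp dst : ℕ} {lim e : WordExpr} {F : ℕ → ℕ} (hc : lim.cost ≤ 900)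
    (hc' : e.cost ≤ 1000) (hne : v ≠ dst ∧ v ≠ tmp ∧ tmp ≠ dst)
    (hlim : ∀ s', (∀ a, a ≠ v → a ≠ tmp → a ≠ dst → ∀ i, s'.word a i = s.word a i) →
      lim.safe s' ∧ lim.val s' = n)
    (he : ∀ t < n, ∀ s', (∀ a, a ≠ v → a ≠ tmp → ∀ i, s'.word a i = s.word a i) →
      s'.word v 0 = t → e.safe s' ∧ e.val s' = F t)
    (hF : s.Small X → ∀ t < n, F t < X) (hn : s.Small X → n < X) :
    Runs X (.mapStage v lim tmp dst e) s ((n + 2) * 10000)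
      (fun s' => ∀ t, s'.word dst t = if t < n then F t else s.word dst t) := by
  refine Runs.of_small fun hs => ?_
  refine ((runs_fill hc hc' hne.2.1 (fun s' h => hlim s' fun a h1 h2 _ => h a h1 h2) he
    (fun _ => hF hs) hn).seq (t₂ := (n + 2) * 5000) fun s₁ hs₁ hF₁ h₁ => ?_).mono (by omega)
    fun _ _ _ h => h
  have hfr : ∀ a, a ≠ v → a ≠ tmp → ∀ i, s₁.word a i = s.word a i := fun a h1 h2 =>
    hF₁.1 a (by simp [Program.forLoop, Program.setVar, Program.wordWrites, h1, h2])
  refine (runs_fill (F := F) hc (by change 3 ≤ 1000; norm_num) hne.1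
    (fun s' h => hlim s' fun a h1 h2 h3 i => (h a h1 h3 i).trans (hfr a h1 h2 i))
    (fun t ht s' h hv => ?_) (fun _ => hF hs) (fun _ => hn hs)).mono le_rfl ?_
  · refine ⟨by simp, ?_⟩
    simp only [WordExpr.val_get, WordExpr.val_var]
    rw [hv, h _ hne.2.1.symm hne.2.2, h₁, if_pos ht]
  · intro s' _ _ h t
    rw [h t, hfr dst hne.1.symm hne.2.2.symm]

end RAM

/-! ### Convolution over rings with roots of unity -/

namespace FastConv

variable {T : Type} [CommRing T]

/-- The block of length `r` with number `β` of the sequence `f`, read as a polynomial and evaluated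
at `y`. -/
def blk (r : ℕ) (f : ℕ → ℕ) (y : T) (β : ℕ) : T :=
  ∑ q ∈ Finset.range r, (f (β * r + q) : T) * y ^ q

/-- The coefficient of `y ^ w` in the block `β`, continued to all `w` with `y ^ r = -1` (modulo
`M`). -/
def ext (M r : ℕ) (f : ℕ → ℕ) (β w : ℕ) : ℕ :=
  f (β * r + w % r) * (1 + w / r % 2 * (M - 2))

theorem cast_mod {M : ℕ} (hM : (M : T) = 0) (x : ℕ) : ((x % M : ℕ) : T) = x := by
  conv_rhs => rw [← Nat.mod_add_div x M]
  push_cast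
  rw [hM]; ring

theorem cast_pred {M : ℕ} (hM : (M : T) = 0) (h : 2 ≤ M) : ((1 + 1 * (M - 2) : ℕ) : T) = -1 := by
  have : 1 + 1 * (M - 2) + 1 = M := by omega
  have h2 : ((1 + 1 * (M - 2) + 1 : ℕ) : T) = 0 := by rw [this, hM]
  rw [Nat.cast_add, Nat.cast_one] at h2
  exact eq_neg_of_add_eq_zero_left h2

theorem ext_of_lt (M r : ℕ) (f : ℕ → ℕ) (β : ℕ) {w : ℕ} (h : w < r) :
    ext M r f β w = f (β * r + w) := by
  simp [ext, Nat.div_eq_of_lt h, Nat.mod_eq_of_lt h]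

theorem ext_add {M r : ℕ} (hM : (M : T) = 0) (h2 : 2 ≤ M) (hr : 0 < r) (f : ℕ → ℕ) (β w : ℕ) :
    (ext M r f β (w + r) : T) = -ext M r f β w := by
  have h := cast_pred hM h2
  rw [ext, ext, Nat.add_mod_right, Nat.add_div_right _ hr]
  rcases Nat.mod_two_eq_zero_or_one (w / r) with h0 | h0
  · have : (w / r).succ % 2 = 1 := by omega
    rw [h0, this, Nat.cast_mul, h]; push_cast; ring
  · have : (w / r).succ % 2 = 0 := by omega
    rw [h0, this, Nat.cast_mul, Nat.cast_mul, h]; push_cast; ring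

/-- Reading a block from position `j` on amounts to a division by `y ^ j`. -/
theorem pow_mul_sum_ext {M r : ℕ} (hM : (M : T) = 0) (h2 : 2 ≤ M) (hr : 0 < r) {y : T}
    (hy : y ^ r = -1) (f : ℕ → ℕ) (β j : ℕ) :
    y ^ j * ∑ q ∈ Finset.range r, (ext M r f β (q + j) : T) * y ^ q = blk r f y β := by
  induction j with
  | zero =>
    rw [pow_zero, one_mul, blk]
    exact Finset.sum_congr rfl fun q hq => by
      rw [Nat.add_zero, ext_of_lt _ _ _ _ (Finset.mem_range.1 hq)]
  | succ j ih =>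
    rw [← ih, pow_succ, mul_assoc]
    congr 1
    obtain ⟨r, rfl⟩ : ∃ k, r = k + 1 := ⟨r - 1, by omega⟩
    have e : ∀ q, (ext M (r + 1) f β (q + (j + 1)) : T) * y ^ q * y =
        (ext M (r + 1) f β (q + 1 + j) : T) * y ^ (q + 1) := fun q => by
      rw [show q + (j + 1) = q + 1 + j by ring]; ring
    rw [Finset.mul_sum,
      Finset.sum_range_succ' fun q => (ext M (r + 1) f β (q + j) : T) * y ^ q]
    simp only [mul_comm y, e]
    rw [Finset.sum_range_succ, hy, show r + 1 + j = j + (r + 1) by ring,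
      ext_add hM h2 (Nat.succ_pos r)]
    simp

/-- Reading a block from position `2 r - σ` on amounts to a multiplication by `y ^ σ`, as
`y ^ (2 r) = 1`. -/
theorem sum_ext_eq {M r : ℕ} (hM : (M : T) = 0) (h2 : 2 ≤ M) (hr : 0 < r) {y : T}
    (hy : y ^ r = -1) (f : ℕ → ℕ) (β σ j : ℕ) (hσ : σ + j = 2 * r) :
    ∑ q ∈ Finset.range r, (ext M r f β (q + j) : T) * y ^ q = y ^ σ * blk r f y β := by
  have h1 : y ^ (2 * r) = 1 := by rw [mul_comm, pow_mul, hy]; ring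
  rw [← pow_mul_sum_ext hM h2 hr hy f β j, ← mul_assoc, ← pow_add, hσ, h1, one_mul]

/-! ### The butterfly stages -/

/-- The exponents of the roots of unity, indexed by the nodes of a binary tree in heap order: at the
node `z` one works modulo `x ^ h - y ^ (rootExp r z)`. -/
def rootExp (r z : ℕ) : ℕ :=
  if z < 2 then 0 else rootExp r (z / 2) / 2 + z % 2 * r
decreasing_by omega

theorem rootExp_lt {r : ℕ} (hr : 0 < r) (z : ℕ) : rootExp r z < 2 * r := by
  induction z using Nat.strong_induction_on with
  | _ z ih =>
    rw [rootExp]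
    split_ifs with h
    · omega
    · have := ih (z / 2) (by omega)
      have : z % 2 * r ≤ 1 * r := Nat.mul_le_mul_right _ (by omega)
      omega

theorem rootExp_dvd {κ : ℕ} (d : ℕ) (hd : d ≤ κ + 1) (z : ℕ) (hz : z < 2 ^ (d + 1)) :
    2 ^ (κ + 1 - d) ∣ rootExp (2 ^ κ) z := by
  induction d generalizing z with
  | zero => rw [rootExp, if_pos (by simpa using hz)]; exact dvd_zero _
  | succ d ih =>
    rw [rootExp]
    split_ifs with h
    · exact dvd_zero _
    · refine dvd_add ?_ (Dvd.dvd.mul_left (pow_dvd_pow _ (by omega)) _)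
      obtain ⟨c, hc⟩ := ih (by omega) (z / 2) (by rw [pow_succ] at hz; omega)
      rw [hc, show κ + 1 - d = κ + 1 - (d + 1) + 1 by omega, pow_succ, mul_assoc,
        Nat.mul_div_assoc _ (Dvd.intro _ rfl), Nat.mul_div_cancel_left _ (by norm_num)]
      exact Dvd.intro _ rfl

/-- The exponents in the depth `d ≤ κ` of the tree are even, so that `y ^ rootExp r z` has the square root
`y ^ (rootExp r z / 2)`. -/
theorem rootExp_even {κ d z : ℕ} (hd : d ≤ κ) (hz : z < 2 ^ (d + 1)) :
    2 * (rootExp (2 ^ κ) z / 2) = rootExp (2 ^ κ) z := by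
  refine Nat.mul_div_cancel' (dvd_trans ?_ (rootExp_dvd d (by omega) z hz))
  exact dvd_pow_self 2 (by omega)

/-- The polynomial in `x` of degree below `h` whose coefficients are the blocks
`ν h, …, ν h + h - 1`. -/
def node (r h : ℕ) (f : ℕ → ℕ) (x y : T) (ν : ℕ) : T :=
  ∑ p ∈ Finset.range h, blk r f y (ν * h + p) * x ^ p

/-- `c` holds (up to the factor `2 ^ e`) the products of the first half of the `2 * cnt * 2 ^ d`
polynomials held by `f` with those of the second half, modulo `x ^ h - y ^ s`, where `s` depends on
the node. The congruences are expressed as identities in all rings of characteristic dividing `M` with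
elements `x`, `y` that satisfy the relations. -/
def NodeProd (M r cnt e d h : ℕ) (f c : ℕ → ℕ) : Prop :=
  ∀ (T : Type) [CommRing T] (x y : T), (M : T) = 0 → y ^ r = -1 → ∀ ν < cnt * 2 ^ d,
    x ^ h = y ^ rootExp r (2 ^ d + ν % 2 ^ d) →
      node r h c x y ν = 2 ^ e * (node r h f x y ν * node r h f x y (cnt * 2 ^ d + ν))

/-- `c` holds (up to the factor `2 ^ e`) the products of the first `cnt` blocks of `f` with the next
`cnt` blocks modulo `y ^ r + 1`. -/
def BlockProd (M r cnt e : ℕ) (f c : ℕ → ℕ) : Prop :=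
  ∀ (T : Type) [CommRing T] (y : T), (M : T) = 0 → y ^ r = -1 → ∀ I < cnt,
    blk r c y I = 2 ^ e * (blk r f y I * blk r f y (cnt + I))

/-- One stage of the forward transform: `u + x ^ h v` goes to `u + ζ v` and `u - ζ v`. -/
def fwdStage (M r d h : ℕ) (f : ℕ → ℕ) (t : ℕ) : ℕ :=
  let q := t % r
  let p := t / r % h
  let b := t / r / h % 2
  let ν := t / r / h / 2
  let σ := rootExp r (2 ^ d + ν % 2 ^ d) / 2
  (f ((ν * 2 * h + p) * r + q) +
    ext M r f (ν * 2 * h + h + p) (q + (2 * r - σ)) * (1 + b * (M - 2))) % M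

/-- One stage of the inverse transform: `a`, `b` go to `(a + b) + x ^ h ζ⁻¹ (a - b)`. -/
def bwdStage (M r d h : ℕ) (f : ℕ → ℕ) (t : ℕ) : ℕ :=
  let q := t % r
  let p := t / r % h
  let b := t / r / h % 2
  let ν := t / r / h / 2
  let σ := rootExp r (2 ^ d + ν % 2 ^ d) / 2
  (ext M r f (ν * 2 * h + p) (q + b * σ) +
    ext M r f (ν * 2 * h + h + p) (q + b * σ) * (1 + b * (M - 2))) % M

/-- The cell `t` belongs to the coefficient `q` of the block `p` in the half `b` of the node `ν`. -/
theorem decode {r h ν b p q : ℕ} (hq : q < r) (hp : p < h) (hb : b < 2) :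
    let t := ((2 * ν + b) * h + p) * r + q
    t % r = q ∧ t / r % h = p ∧ t / r / h % 2 = b ∧ t / r / h / 2 = ν := by
  intro t
  have h1 : t / r = (2 * ν + b) * h + p := by
    simp only [t]
    rw [mul_comm _ r, Nat.mul_add_div (by omega), Nat.div_eq_of_lt hq, add_zero]
  have h2 : t / r / h = 2 * ν + b := by
    rw [h1, mul_comm _ h, Nat.mul_add_div (by omega), Nat.div_eq_of_lt hp, add_zero]
  refine ⟨?_, ?_, ?_, ?_⟩
  · simp only [t]; rw [Nat.mul_add_mod', Nat.mod_eq_of_lt hq]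
  · rw [h1, Nat.mul_add_mod', Nat.mod_eq_of_lt hp]
  · rw [h2]; omega
  · rw [h2]; omega

theorem blk_fwdStage {M r d h : ℕ} (hM : (M : T) = 0) (h2 : 2 ≤ M) {y : T} (hr : 0 < r)
    (hy : y ^ r = -1) (f : ℕ → ℕ) {ν b p : ℕ} (hb : b < 2) (hp : p < h) :
    blk r (fwdStage M r d h f) y ((2 * ν + b) * h + p) = blk r f y (ν * 2 * h + p) +
      (-1) ^ b * (y ^ (rootExp r (2 ^ d + ν % 2 ^ d) / 2) * blk r f y (ν * 2 * h + h + p)) := by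
  have hσ := rootExp_lt hr (2 ^ d + ν % 2 ^ d)
  rw [← sum_ext_eq hM h2 hr hy f (ν * 2 * h + h + p) _
    (2 * r - rootExp r (2 ^ d + ν % 2 ^ d) / 2) (by omega), blk, blk, Finset.mul_sum,
    ← Finset.sum_add_distrib]
  refine Finset.sum_congr rfl fun q hq => ?_
  obtain ⟨e1, e2, e3, e4⟩ := decode (ν := ν) (Finset.mem_range.1 hq) hp hb
  rw [fwdStage]
  simp only [e1, e2, e3, e4]
  rw [cast_mod hM]
  interval_cases b
  · push_cast; ring
  · rw [Nat.cast_add, Nat.cast_mul, cast_pred hM h2]; ring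

theorem blk_bwdStage {M r d h : ℕ} (hM : (M : T) = 0) (h2 : 2 ≤ M) {y : T} (hr : 0 < r)
    (hy : y ^ r = -1) (f : ℕ → ℕ) {ν b p : ℕ} (hb : b < 2) (hp : p < h) :
    y ^ (b * (rootExp r (2 ^ d + ν % 2 ^ d) / 2)) *
      blk r (bwdStage M r d h f) y ((2 * ν + b) * h + p) =
      blk r f y (ν * 2 * h + p) + (-1) ^ b * blk r f y (ν * 2 * h + h + p) := by
  set σ := rootExp r (2 ^ d + ν % 2 ^ d) / 2 with hσ
  rw [← pow_mul_sum_ext hM h2 hr hy f (ν * 2 * h + p) (b * σ),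
    ← pow_mul_sum_ext hM h2 hr hy f (ν * 2 * h + h + p) (b * σ), blk, mul_left_comm, ← mul_add,
    Finset.mul_sum _ _ ((-1 : T) ^ b), ← Finset.sum_add_distrib]
  congr 1
  refine Finset.sum_congr rfl fun q hq => ?_
  obtain ⟨e1, e2, e3, e4⟩ := decode (ν := ν) (Finset.mem_range.1 hq) hp hb
  rw [bwdStage]
  simp only [e1, e2, e3, e4, ← hσ]
  rw [cast_mod hM]
  interval_cases b
  · push_cast; ring
  · rw [Nat.cast_add, Nat.cast_mul, cast_pred hM h2]; ring

theorem node_double {r h : ℕ} (f : ℕ → ℕ) (x y : T) (ν : ℕ) :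
    node r (2 * h) f x y ν = ∑ p ∈ Finset.range h, blk r f y (ν * 2 * h + p) * x ^ p +
      x ^ h * ∑ p ∈ Finset.range h, blk r f y (ν * 2 * h + h + p) * x ^ p := by
  rw [node, two_mul, Finset.sum_range_add, Finset.mul_sum]
  congr 1
  · exact Finset.sum_congr rfl fun p _ => by rw [show ν * (h + h) + p = ν * 2 * h + p by ring]
  · exact Finset.sum_congr rfl fun p _ => by
      rw [show ν * (h + h) + (h + p) = ν * 2 * h + h + p by ring]; ring

theorem mul_add_lt {a b A B : ℕ} (ha : a < A) (hb : b < B) : a * B + b < A * B :=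
  calc a * B + b < a * B + B := by omega
    _ = (a + 1) * B := by ring
    _ ≤ A * B := Nat.mul_le_mul_right _ ha

theorem blk_congr {r : ℕ} {f g : ℕ → ℕ} (y : T) {β : ℕ}
    (h : ∀ q < r, f (β * r + q) = g (β * r + q)) : blk r f y β = blk r g y β :=
  Finset.sum_congr rfl fun q hq => by rw [h q (Finset.mem_range.1 hq)]

theorem map_blk {S : Type} [CommRing S] (φ : T →+* S) (r : ℕ) (f : ℕ → ℕ) (y : T) (β : ℕ) :
    φ (blk r f y β) = blk r f (φ y) β := by
  simp [blk]

theorem map_node {S : Type} [CommRing S] (φ : T →+* S) (r h : ℕ) (f : ℕ → ℕ) (x y : T) (ν : ℕ) :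
    φ (node r h f x y ν) = node r h f (φ x) (φ y) ν := by
  simp [node, map_blk]

/-- If `g' * g = 0`, then to prove `g' * z = 0` one may compute modulo `g`. -/
theorem mul_eq_zero_of_quotient {g g' z : T} (hg : g' * g = 0)
    (hz : Ideal.Quotient.mk (Ideal.span {g}) z = 0) : g' * z = 0 := by
  obtain ⟨u, rfl⟩ := Ideal.mem_span_singleton.1 (Ideal.Quotient.eq_zero_iff_mem.1 hz)
  rw [← mul_assoc, hg, zero_mul]

theorem node_fwd {M r d h C : ℕ} (hM : (M : T) = 0) (h2 : 2 ≤ M) {x y : T} (hr : 0 < r)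
    (hy : y ^ r = -1) {f f' : ℕ → ℕ} (hf : ∀ t < C * (2 * h) * r, f' t = fwdStage M r d h f t)
    {ν b : ℕ} (hν : ν < C) (hb : b < 2) :
    node r h f' x y (2 * ν + b) =
      ∑ p ∈ Finset.range h, blk r f y (ν * 2 * h + p) * x ^ p +
      (-1) ^ b * (y ^ (rootExp r (2 ^ d + ν % 2 ^ d) / 2) *
        ∑ p ∈ Finset.range h, blk r f y (ν * 2 * h + h + p) * x ^ p) := by
  rw [node, Finset.mul_sum, Finset.mul_sum, ← Finset.sum_add_distrib]
  refine Finset.sum_congr rfl fun p hp => ?_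
  have hp := Finset.mem_range.1 hp
  rw [blk_congr y fun q hq => hf _ ?_, blk_fwdStage hM h2 hr hy f hb hp]
  · ring
  · refine mul_add_lt ?_ hq
    rw [← mul_assoc]
    exact mul_add_lt (by omega) hp

theorem node_bwd {M r d h C : ℕ} (hM : (M : T) = 0) (h2 : 2 ≤ M) {x y : T} (hr : 0 < r)
    (hy : y ^ r = -1) {f f' : ℕ → ℕ} (hf : ∀ t < C * (2 * h) * r, f' t = bwdStage M r d h f t)
    {ν b : ℕ} (hν : ν < C) (hb : b < 2) :
    y ^ (b * (rootExp r (2 ^ d + ν % 2 ^ d) / 2)) * node r h f' x y (2 * ν + b) =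
      node r h f x y (2 * ν) + (-1) ^ b * node r h f x y (2 * ν + 1) := by
  rw [node, node, node, Finset.mul_sum, Finset.mul_sum, ← Finset.sum_add_distrib]
  refine Finset.sum_congr rfl fun p hp => ?_
  have hp := Finset.mem_range.1 hp
  rw [blk_congr y fun q hq => hf _ ?_, ← mul_assoc, blk_bwdStage hM h2 hr hy f hb hp,
    show 2 * ν * h + p = ν * 2 * h + p by ring,
    show (2 * ν + 1) * h + p = ν * 2 * h + h + p by ring]
  · ring
  · refine mul_add_lt ?_ hq
    rw [← mul_assoc]
    exact mul_add_lt (by omega) hp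

/-- The children of a node belong to the two square roots of its root of unity, as `y ^ r = -1`. -/
theorem rootExp_child (r d ν b : ℕ) (hb : b < 2) :
    rootExp r (2 ^ (d + 1) + (2 * ν + b) % 2 ^ (d + 1)) =
      rootExp r (2 ^ d + ν % 2 ^ d) / 2 + b * r := by
  have h1 : (2 * ν + b) % 2 ^ (d + 1) = 2 * (ν % 2 ^ d) + b := by
    have h := Nat.div_add_mod ν (2 ^ d)
    have h' : 2 * ν + b = 2 * (ν % 2 ^ d) + b + 2 ^ (d + 1) * (ν / 2 ^ d) := by
      rw [pow_succ]; nlinarith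
    have hlt : ν % 2 ^ d < 2 ^ d := Nat.mod_lt _ (by positivity)
    rw [h', Nat.add_mul_mod_self_left, Nat.mod_eq_of_lt (by rw [pow_succ]; omega)]
  have hd : 0 < 2 ^ d := by positivity
  rw [h1, pow_succ, rootExp, if_neg (by omega),
    show (2 ^ d * 2 + (2 * (ν % 2 ^ d) + b)) / 2 = 2 ^ d + ν % 2 ^ d by omega,
    show (2 ^ d * 2 + (2 * (ν % 2 ^ d) + b)) % 2 = b by omega]

/-- A forward stage, products, and the matching inverse stage give products. This is the Chinese
remainder theorem for `x ^ (2 h) - ζ ^ 2 = (x ^ h - ζ) (x ^ h + ζ)`. -/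
theorem NodeProd.stage {M κ cnt e d h : ℕ} {f f' c c' : ℕ → ℕ} (h2 : 2 ≤ M) (hd : d ≤ κ)
    (hf : ∀ t < 2 * cnt * 2 ^ d * (2 * h) * 2 ^ κ, f' t = fwdStage M (2 ^ κ) d h f t)
    (hc : ∀ t < cnt * 2 ^ d * (2 * h) * 2 ^ κ, c' t = bwdStage M (2 ^ κ) d h c t)
    (H : NodeProd M (2 ^ κ) cnt e (d + 1) h f' c) :
    NodeProd M (2 ^ κ) cnt (e + 1) d (2 * h) f c' := by
  intro T _ x y hM hy ν hν hx
  set r := 2 ^ κ with hr'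
  have hr : 0 < r := by positivity
  set s := rootExp r (2 ^ d + ν % 2 ^ d) with hs
  have hs2 : 2 * (s / 2) = s := rootExp_even hd (by
    have : ν % 2 ^ d < 2 ^ d := Nat.mod_lt _ (by positivity)
    rw [pow_succ]; omega)
  set ζ := y ^ (s / 2) with hζ
  have hw : x ^ h * x ^ h = ζ * ζ := by
    rw [← pow_add, ← two_mul, hx, hζ, ← pow_add, ← two_mul, hs2]
  have hν' : ν < 2 * cnt * 2 ^ d := by nlinarith
  have hν'' : cnt * 2 ^ d + ν < 2 * cnt * 2 ^ d := by nlinarith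
  have hmod : (cnt * 2 ^ d + ν) % 2 ^ d = ν % 2 ^ d := by
    rw [Nat.mul_add_mod']
  -- the products at the children, multiplied by the other factor of `x ^ (2 h) - ζ ^ 2`
  have key : ∀ b < 2, (x ^ h + (-1) ^ b * ζ) * (node r h c x y (2 * ν + b) -
      2 ^ e * (node r h f' x y (2 * ν + b) *
        node r h f' x y (2 * (cnt * 2 ^ d + ν) + b))) = 0 := by
    intro b hb
    have hbb : (-1 : T) ^ b * (-1) ^ b = 1 := by rw [← pow_add, ← two_mul, pow_mul]; simp
    refine mul_eq_zero_of_quotient (g := x ^ h - (-1) ^ b * ζ) ?_ ?_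
    · linear_combination hw - ζ * ζ * hbb
    · set φ := Ideal.Quotient.mk (Ideal.span {x ^ h - (-1) ^ b * ζ}) with hφ
      have hφ0 : φ (x ^ h - (-1) ^ b * ζ) = 0 :=
        Ideal.Quotient.eq_zero_iff_mem.2 (Ideal.mem_span_singleton_self _)
      have h' := H _ (φ x) (φ y) (by rw [← map_natCast φ, hM, map_zero])
        (by rw [← map_pow, hy, map_neg, map_one]) (2 * ν + b)
        (by rw [pow_succ, ← mul_assoc]; omega) (by
          rw [rootExp_child r d ν b hb, pow_add, mul_comm b r, pow_mul, ← map_pow φ y r, hy,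
            ← map_pow φ y, ← hs, ← hζ, ← map_pow, ← map_pow, ← map_mul]
          rw [map_sub, sub_eq_zero] at hφ0
          exact hφ0.trans (congrArg φ (mul_comm _ _)))
      rw [show cnt * 2 ^ (d + 1) + (2 * ν + b) = 2 * (cnt * 2 ^ d + ν) + b by
        rw [pow_succ]; ring] at h'
      rw [map_sub, map_mul, map_pow, map_mul, map_node, map_node, map_node, h', map_ofNat,
        sub_self]
  have k0 := key 0 (by norm_num)
  have k1 := key 1 (by norm_num)
  have a0 := node_fwd hM h2 (x := x) hr hy hf hν' (b := 0) (by norm_num)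
  have a1 := node_fwd hM h2 (x := x) hr hy hf hν' (b := 1) (by norm_num)
  have b0 := node_fwd hM h2 (x := x) hr hy hf hν'' (b := 0) (by norm_num)
  have b1 := node_fwd hM h2 (x := x) hr hy hf hν'' (b := 1) (by norm_num)
  have c0 := node_bwd hM h2 (x := x) hr hy hc hν (b := 0) (by norm_num)
  have c1 := node_bwd hM h2 (x := x) hr hy hc hν (b := 1) (by norm_num)
  rw [hmod] at b0 b1
  rw [← hs, ← hζ] at a0 a1 b0 b1
  rw [← hs] at c0 c1
  rw [a0, b0] at k0
  rw [a1, b1] at k1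
  rw [one_mul, ← hζ] at c1
  simp only [pow_zero, pow_one, one_mul, add_zero, zero_mul] at k0 k1 c0 c1
  have hζu : IsUnit ζ := by
    refine IsUnit.pow _ (IsUnit.of_mul_eq_one (-y ^ (r - 1)) ?_)
    rw [mul_neg, ← pow_succ', Nat.sub_add_cancel hr, hy, neg_neg]
  refine hζu.mul_left_cancel ?_
  have n1 : node r (2 * h) c' x y ν =
      node r h c' x y (2 * ν) + x ^ h * node r h c' x y (2 * ν + 1) := by
    rw [node_double, node, node]
    congr 1
    · exact Finset.sum_congr rfl fun p _ => by rw [show 2 * ν * h + p = ν * 2 * h + p by ring]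
    · congr 1
      exact Finset.sum_congr rfl fun p _ => by
        rw [show (2 * ν + 1) * h + p = ν * 2 * h + h + p by ring]
  rw [n1, node_double f, node_double f]
  generalize (∑ p ∈ Finset.range h, blk r f y (ν * 2 * h + p) * x ^ p) = U at *
  generalize (∑ p ∈ Finset.range h, blk r f y (ν * 2 * h + h + p) * x ^ p) = V at *
  generalize (∑ p ∈ Finset.range h, blk r f y ((cnt * 2 ^ d + ν) * 2 * h + p) * x ^ p) = U' at *
  generalize (∑ p ∈ Finset.range h, blk r f y ((cnt * 2 ^ d + ν) * 2 * h + h + p) * x ^ p)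
    = V' at *
  linear_combination ζ * c0 + x ^ h * c1 + k0 - k1 - 2 ^ (e + 1) * ζ * V * V' * hw

/-! ### One level of the recursion -/

/-- The substitution `y = x ^ m`: a polynomial of degree below `m r` in `x` becomes a polynomial of
degree below `m` in `x` over the polynomials in `y`, and is padded to degree below `2 m`. -/
def expandStage (m r : ℕ) (f : ℕ → ℕ) (t : ℕ) : ℕ :=
  let q := t % r
  let P := t / r % (2 * m)
  let I := t / r / (2 * m)
  (1 - P / m) * f (I * (m * r) + P % m + m * q)

/-- The inverse substitution; the coefficient of `x ^ (m + p)` contributes to that of `x ^ p`,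
multiplied by `y`. -/
def contractStage (M m r : ℕ) (c : ℕ → ℕ) (t : ℕ) : ℕ :=
  let I := t / (m * r)
  let p := t % (m * r) % m
  let q := t % (m * r) / m
  (c ((I * (2 * m) + p) * r + q) + ext M r c (I * (2 * m) + (m + p)) (q + (2 * r - 1))) % M

/-- `f'` arises from `f` by the forward transform of one level. -/
def FwdLevel (M μ r cnt : ℕ) (f f' : ℕ → ℕ) : Prop :=
  ∃ g : ℕ → ℕ → ℕ, g (μ + 1) = f' ∧
    (∀ t < 2 * cnt * (2 * 2 ^ μ) * r, g 0 t = expandStage (2 ^ μ) r f t) ∧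
    ∀ d ≤ μ, ∀ t < 2 * cnt * (2 * 2 ^ μ) * r, g (d + 1) t = fwdStage M r d (2 ^ (μ - d)) (g d) t

/-- `c'` arises from `c` by the inverse transform of one level. -/
def BwdLevel (M μ r cnt : ℕ) (c c' : ℕ → ℕ) : Prop :=
  ∃ g : ℕ → ℕ → ℕ, g 0 = c ∧
    (∀ j ≤ μ, ∀ t < cnt * (2 * 2 ^ μ) * r, g (j + 1) t = bwdStage M r (μ - j) (2 ^ j) (g j) t) ∧
    ∀ t < cnt * (2 ^ μ * r), c' t = contractStage M (2 ^ μ) r (g (μ + 1)) t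

theorem BlockProd.nodeProd {M r cnt e D : ℕ} {f c : ℕ → ℕ}
    (H : BlockProd M r (cnt * 2 ^ D) e f c) : NodeProd M r cnt e D 1 f c := by
  intro T _ x y hM hy ν hν hx
  simpa [node] using H T y hM hy ν hν

theorem sum_range_mul (m r : ℕ) (g : ℕ → T) : ∑ j ∈ Finset.range (m * r), g j =
    ∑ q ∈ Finset.range r, ∑ p ∈ Finset.range m, g (m * q + p) := by
  induction r with
  | zero => simp
  | succ r ih => rw [Nat.mul_succ, Finset.sum_range_add, ih, Finset.sum_range_succ]

theorem blk_contract {M m r cnt : ℕ} (hM : (M : T) = 0) (h2 : 2 ≤ M) (hr : 0 < r) {x : T}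
    (hx : x ^ (m * r) = -1) {c c' : ℕ → ℕ} {I : ℕ} (hI : I < cnt)
    (hc : ∀ t < cnt * (m * r), c' t = contractStage M m r c t) :
    blk (m * r) c' x I = node r (2 * m) c x (x ^ m) I := by
  have hy : (x ^ m) ^ r = -1 := by rw [← pow_mul, hx]
  have h1 : node r (2 * m) c x (x ^ m) I = ∑ p ∈ Finset.range m,
      ∑ q ∈ Finset.range r, ((c ((I * (2 * m) + p) * r + q) : T) +
        ext M r c (I * (2 * m) + (m + p)) (q + (2 * r - 1))) * (x ^ m) ^ q * x ^ p := by
    rw [node, two_mul m, Finset.sum_range_add, ← Finset.sum_add_distrib, ← two_mul m]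
    refine Finset.sum_congr rfl fun p _ => ?_
    rw [pow_add, ← mul_assoc (blk _ _ _ _), ← add_mul, ← Finset.sum_mul, mul_comm _ (x ^ m)]
    congr 1
    have h := sum_ext_eq hM h2 hr hy c (I * (2 * m) + (m + p)) 1 (2 * r - 1) (by omega)
    rw [pow_one] at h
    rw [← h, blk, ← Finset.sum_add_distrib]
    exact Finset.sum_congr rfl fun q _ => by ring
  rw [h1, blk, sum_range_mul, Finset.sum_comm]
  refine Finset.sum_congr rfl fun p hp => Finset.sum_congr rfl fun q hq => ?_
  have hp := Finset.mem_range.1 hp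
  have hq := Finset.mem_range.1 hq
  have hj : m * q + p < m * r := by
    have := mul_add_lt hq hp
    rwa [mul_comm q, mul_comm r] at this
  have e1 : (I * (m * r) + (m * q + p)) / (m * r) = I := by
    rw [mul_comm I, Nat.mul_add_div (by omega), Nat.div_eq_of_lt hj, add_zero]
  have e2 : (I * (m * r) + (m * q + p)) % (m * r) = m * q + p := by
    rw [Nat.mul_add_mod', Nat.mod_eq_of_lt hj]
  rw [hc _ (mul_add_lt hI hj), contractStage]
  simp only [e1, e2]
  rw [Nat.mul_add_mod, Nat.mod_eq_of_lt hp, Nat.mul_add_div (by omega), Nat.div_eq_of_lt hp,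
    add_zero, cast_mod hM]
  push_cast
  ring

theorem node_expand {m r cnt : ℕ} (x y : T) {f f' : ℕ → ℕ} {I : ℕ} (hI : I < cnt)
    (hf : ∀ t < cnt * (2 * m) * r, f' t = expandStage m r f t) :
    node r (2 * m) f' x y I = ∑ p ∈ Finset.range m,
      (∑ q ∈ Finset.range r, (f (I * (m * r) + (m * q + p)) : T) * y ^ q) * x ^ p := by
  have key : ∀ P < 2 * m, ∀ q < r, f' ((I * (2 * m) + P) * r + q) =
      (1 - P / m) * f (I * (m * r) + P % m + m * q) := by
    intro P hP q hq
    have e1 : ((I * (2 * m) + P) * r + q) / r = I * (2 * m) + P := by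
      rw [mul_comm _ r, Nat.mul_add_div (by omega), Nat.div_eq_of_lt hq, add_zero]
    have e2 : ((I * (2 * m) + P) * r + q) % r = q := by
      rw [Nat.mul_add_mod', Nat.mod_eq_of_lt hq]
    rw [hf _ (mul_add_lt (mul_add_lt hI hP) hq), expandStage]
    simp only [e1, e2]
    rw [mul_comm I (2 * m), Nat.mul_add_mod, Nat.mod_eq_of_lt hP, Nat.mul_add_div (by omega),
      Nat.div_eq_of_lt hP, add_zero]
  rw [node, two_mul m, Finset.sum_range_add, ← two_mul m, add_eq_left.2]
  · refine Finset.sum_congr rfl fun p hp => ?_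
    have hp := Finset.mem_range.1 hp
    congr 1
    refine Finset.sum_congr rfl fun q hq => ?_
    rw [key p (by omega) q (Finset.mem_range.1 hq), Nat.div_eq_of_lt hp, Nat.mod_eq_of_lt hp,
      tsub_zero, one_mul, show I * (m * r) + p + m * q = I * (m * r) + (m * q + p) by ring]
  · refine Finset.sum_eq_zero fun p hp => ?_
    have hp := Finset.mem_range.1 hp
    rw [blk, Finset.sum_eq_zero, zero_mul]
    intro q hq
    rw [key (m + p) (by omega) q (Finset.mem_range.1 hq), Nat.add_div_left _ (by omega)]
    simp

theorem node_expand_self {m r cnt : ℕ} (x : T) {f f' : ℕ → ℕ} {I : ℕ} (hI : I < cnt)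
    (hf : ∀ t < cnt * (2 * m) * r, f' t = expandStage m r f t) :
    node r (2 * m) f' x (x ^ m) I = blk (m * r) f x I := by
  rw [node_expand x _ hI hf, blk, sum_range_mul, Finset.sum_comm]
  refine Finset.sum_congr rfl fun p _ => ?_
  rw [Finset.sum_mul]
  exact Finset.sum_congr rfl fun q _ => by rw [← pow_mul]; ring

open Polynomial in
/-- The products modulo `x ^ (2 m) - 1` of polynomials of degree below `m` are true products, so
that one may substitute any `x`, in particular one with `y = x ^ m`. -/
theorem node_root {M m r cnt e : ℕ} {f g c : ℕ → ℕ} (hm : 0 < m)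
    (hg : ∀ t < 2 * cnt * (2 * m) * r, g t = expandStage m r f t)
    (H : NodeProd M r cnt e 0 (2 * m) g c) (hM : (M : T) = 0) (x : T) {y : T} (hy : y ^ r = -1)
    {I : ℕ} (hI : I < cnt) :
    node r (2 * m) c x y I = 2 ^ e * (node r (2 * m) g x y I * node r (2 * m) g x y (cnt + I)) := by
  set D : T[X] := node r (2 * m) c X (C y) I -
    2 ^ e * (node r (2 * m) g X (C y) I * node r (2 * m) g X (C y) (cnt + I)) with hD
  suffices h : D = 0 by
    have h' := congrArg (Polynomial.evalRingHom x) h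
    rw [hD, map_sub, map_mul, map_mul, map_node, map_node, map_node, map_pow, map_ofNat,
      map_zero, sub_eq_zero] at h'
    simpa using h'
  have hmonic : (X ^ (2 * m) - 1 : T[X]).Monic := monic_X_pow_sub_C (1 : T) (by omega)
  rcases subsingleton_or_nontrivial T with hT | hT
  · exact Subsingleton.elim _ _
  have hdvd : (X ^ (2 * m) - 1 : T[X]) ∣ D := by
    set φ := Ideal.Quotient.mk (Ideal.span {(X ^ (2 * m) - 1 : T[X])}) with hφ
    have h0 : φ (X ^ (2 * m) - 1) = 0 :=
      Ideal.Quotient.eq_zero_iff_mem.2 (Ideal.mem_span_singleton_self _)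
    rw [← Ideal.mem_span_singleton, ← Ideal.Quotient.eq_zero_iff_mem, ← hφ, hD]
    have := H _ (φ X) (φ (C y))
      (by rw [← map_natCast φ, ← map_natCast (C : T →+* T[X]), hM, map_zero, map_zero])
      (by rw [← map_pow, ← map_pow, hy]; simp) I (by simpa using hI) (by
        rw [map_sub, sub_eq_zero] at h0
        rw [← map_pow, h0, rootExp, if_pos (by omega), pow_zero, map_one])
    rw [pow_zero, mul_one] at this
    rw [map_sub, map_mul, map_mul, map_node, map_node, map_node, this, map_pow, map_ofNat,
      sub_self]
  have hmem : D ∈ degreeLT T (2 * m) := by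
    have hmono : ∀ (a : T) (i : ℕ), i < 2 * m → C a * X ^ i ∈ degreeLT T (2 * m) := fun a i hi =>
      mem_degreeLT.2 ((degree_C_mul_X_pow_le i a).trans_lt (by exact_mod_cast hi))
    refine Submodule.sub_mem _ ?_ ?_
    · refine Submodule.sum_mem _ fun p hp => ?_
      rw [← map_blk C]
      exact hmono _ _ (Finset.mem_range.1 hp)
    · have h2 : (2 : T[X]) ^ e = C (2 ^ e) := by rw [map_pow, map_ofNat]
      rw [h2, ← smul_eq_C_mul, node_expand _ _ (by omega) hg, node_expand _ _ (by omega) hg,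
        Finset.sum_mul_sum]
      refine Submodule.smul_mem _ _ (Submodule.sum_mem _ fun p hp => Submodule.sum_mem _
        fun p' hp' => ?_)
      have := hmono ((∑ q ∈ Finset.range r, (f (I * (m * r) + (m * q + p)) : T) * y ^ q) *
        ∑ q ∈ Finset.range r, (f ((cnt + I) * (m * r) + (m * q + p')) : T) * y ^ q) (p + p')
        (by have := Finset.mem_range.1 hp; have := Finset.mem_range.1 hp'; omega)
      rw [pow_add, map_mul, mul_mul_mul_comm] at this
      simpa using this
  by_contra hne
  refine hmonic.not_dvd_of_degree_lt hne ?_ hdvd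
  have hdeg : (X ^ (2 * m) - 1 : T[X]).degree = (2 * m : ℕ) := degree_X_pow_sub_C (by omega) 1
  rw [hdeg]
  exact mem_degreeLT.1 hmem

/-- The forward transform, products, and the inverse transform of one level give products. -/
theorem BlockProd.level {M μ κ cnt e : ℕ} {f f' c c' : ℕ → ℕ} (h2 : 2 ≤ M) (hμ : μ ≤ κ)
    (hf : FwdLevel M μ (2 ^ κ) cnt f f') (hc : BwdLevel M μ (2 ^ κ) cnt c c')
    (H : BlockProd M (2 ^ κ) (cnt * 2 ^ (μ + 1)) e f' c) :
    BlockProd M (2 ^ μ * 2 ^ κ) cnt (e + (μ + 1)) f c' := by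
  obtain ⟨g, rfl, hg0, hg⟩ := hf
  obtain ⟨k, rfl, hk, hk'⟩ := hc
  have key : ∀ j ≤ μ + 1, NodeProd M (2 ^ κ) cnt (e + j) (μ + 1 - j) (2 ^ j) (g (μ + 1 - j))
      (k j) := by
    intro j
    induction j with
    | zero => intro _; exact H.nodeProd
    | succ j ih =>
      intro hj
      have hd : μ + 1 - j = μ - j + 1 := by omega
      have ih := ih (by omega)
      rw [hd] at ih
      have h1 : 2 ^ (μ - j) * (2 * 2 ^ j) = 2 * 2 ^ μ := by
        rw [mul_left_comm, ← pow_add, Nat.sub_add_cancel (by omega)]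
      have := NodeProd.stage (f := g (μ - j)) (c' := k (j + 1)) h2 (by omega) (fun t ht => ?_)
        (fun t ht => hk j (by omega) t (by rw [mul_assoc cnt, h1] at ht; exact ht)) ih
      · rw [pow_succ', show μ + 1 - (j + 1) = μ - j by omega]
        exact this
      · rw [mul_assoc (2 * cnt), h1] at ht
        rw [hg (μ - j) (by omega) t ht, show μ - (μ - j) = j by omega]
  have h0 := key (μ + 1) le_rfl
  rw [Nat.sub_self, pow_succ' 2 μ] at h0
  intro T _ x hM hx I hI
  have hm : 0 < 2 ^ μ := by positivity
  have hr : 0 < 2 ^ κ := by positivity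
  rw [blk_contract hM h2 hr hx hI hk', node_root hm hg0 h0 hM x (by rw [← pow_mul, hx]) hI,
    node_expand_self x (by omega) hg0, node_expand_self x (by omega) hg0]

/-- The direct product in rings with `y ^ 2 = -1`. -/
def baseStage (M cnt : ℕ) (f : ℕ → ℕ) (t : ℕ) : ℕ :=
  (f (t / 2 * 2) * ext M 2 f (cnt + t / 2) (t % 2) +
    f (t / 2 * 2 + 1) * ext M 2 f (cnt + t / 2) (t % 2 + 3)) % M

theorem blockProd_base {M cnt : ℕ} {f c : ℕ → ℕ} (h2 : 2 ≤ M)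
    (hc : ∀ t < cnt * 2, c t = baseStage M cnt f t) : BlockProd M 2 cnt 0 f c := by
  intro T _ y hM hy I hI
  have h0 := sum_ext_eq hM h2 (by norm_num) hy f (cnt + I) 4 0 (by norm_num)
  have h1 := sum_ext_eq hM h2 (by norm_num) hy f (cnt + I) 1 3 (by norm_num)
  have hy4 : y ^ 4 = 1 := by rw [show (4 : ℕ) = 2 * 2 by norm_num, pow_mul, hy]; ring
  rw [hy4, one_mul] at h0
  rw [pow_one] at h1
  rw [blk, Finset.sum_congr rfl fun q hq => by
    have hq := Finset.mem_range.1 hq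
    rw [hc _ (by omega), baseStage, show (I * 2 + q) / 2 = I by omega,
      show (I * 2 + q) % 2 = q by omega, cast_mod hM]]
  have : blk 2 f y I = f (I * 2) + f (I * 2 + 1) * y := by
    simp [blk, Finset.sum_range_succ]
  rw [pow_zero, one_mul, this, add_mul, mul_assoc _ y, ← h1]
  conv_rhs => rw [← h0]
  simp only [Finset.sum_range_succ, Finset.sum_range_zero]
  push_cast
  ring

open Polynomial in
/-- The products in the rings with `x ^ N = -1` determine the coefficients modulo `M`. -/
theorem BlockProd.coeff {M N e : ℕ} {f c : ℕ → ℕ} (h2 : 2 ≤ M) (hN : 0 < N)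
    (H : BlockProd M N 1 e f c) (h1 : ∀ i < N, N ≤ 2 * i → f i = 0)
    (h1' : ∀ j < N, N ≤ 2 * j → f (N + j) = 0) {k : ℕ} (hk : k < N) :
    (c k : ZMod M) = 2 ^ e * ((∑ i ∈ Finset.range (k + 1), f i * f (N + (k - i)) : ℕ) : ZMod M) := by
  have : Fact (1 < M) := ⟨h2⟩
  set φ := Ideal.Quotient.mk (Ideal.span {(X ^ N + 1 : (ZMod M)[X])}) with hφ
  have hmonic : (X ^ N + 1 : (ZMod M)[X]).Monic := monic_X_pow_add_C (1 : ZMod M) (by omega)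
  have h0 : φ (X ^ N + 1) = 0 :=
    Ideal.Quotient.eq_zero_iff_mem.2 (Ideal.mem_span_singleton_self _)
  have h := H _ (φ X) (by rw [← map_natCast φ, ← map_natCast (C : ZMod M →+* (ZMod M)[X])]; simp)
    (by rw [map_add, map_one] at h0; rw [← map_pow]; exact eq_neg_of_add_eq_zero_left h0) 0
    one_pos
  set A : (ZMod M)[X] := blk N f X 0 with hA
  set B : (ZMod M)[X] := blk N f X 1 with hB
  set D : (ZMod M)[X] := blk N c X 0 - 2 ^ e * (A * B) with hD
  have coeff_blk : ∀ (g : ℕ → ℕ) β i, (blk N g (X : (ZMod M)[X]) β).coeff i =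
      if i < N then (g (β * N + i) : ZMod M) else 0 := by
    intro g β i
    simp only [blk, finsetSum_coeff, ← C_eq_natCast, coeff_C_mul, coeff_X_pow]
    simp
  have coeff_mul : ∀ i, (A * B).coeff i = if i < N then
      ((∑ l ∈ Finset.range (i + 1), f l * f (N + (i - l)) : ℕ) : ZMod M) else 0 := by
    intro i
    rw [Polynomial.coeff_mul, Finset.Nat.sum_antidiagonal_eq_sum_range_succ
      (fun a b => A.coeff a * B.coeff b)]
    split_ifs with hi
    · push_cast
      refine Finset.sum_congr rfl fun l hl => ?_
      have := Finset.mem_range.1 hl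
      rw [hA, hB, coeff_blk, coeff_blk, if_pos (by omega), if_pos (by omega), zero_mul, zero_add,
        one_mul]
    · refine Finset.sum_eq_zero fun l hl => ?_
      have := Finset.mem_range.1 hl
      rw [hA, hB, coeff_blk, coeff_blk]
      split_ifs with h3 h4 <;> try simp
      rcases le_or_gt N (2 * l) with h5 | h5
      · rw [h1 l h3 h5]; simp
      · rw [h1' (i - l) h4 (by omega)]; simp
  have coeff_D : ∀ i, D.coeff i = if i < N then (c i : ZMod M) - 2 ^ e *
      ((∑ l ∈ Finset.range (i + 1), f l * f (N + (i - l)) : ℕ) : ZMod M) else 0 := by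
    intro i
    have : (2 : (ZMod M)[X]) ^ e = C (2 ^ e) := by rw [map_pow, map_ofNat]
    rw [hD, this, coeff_sub, coeff_C_mul, coeff_mul, coeff_blk, zero_mul, zero_add]
    split_ifs <;> simp
  have hD0 : D = 0 := by
    by_contra hne
    refine hmonic.not_dvd_of_degree_lt hne ?_ ?_
    · have hdeg : (X ^ N + 1 : (ZMod M)[X]).degree = N := degree_X_pow_add_C hN 1
      rw [hdeg, degree_lt_iff_coeff_zero]
      intro i hi
      rw [coeff_D, if_neg (by omega)]
    · rw [← Ideal.mem_span_singleton, ← Ideal.Quotient.eq_zero_iff_mem, ← hφ, hD, map_sub,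
        map_mul, map_mul, hA, hB, map_blk, map_blk, map_blk, h, map_pow, map_ofNat, sub_self]
  have h3 := coeff_D k
  rw [hD0, coeff_zero, if_pos hk] at h3
  exact sub_eq_zero.1 h3.symm

/-- If the entries of `f` are `0` and `1`, then no factor `2 ^ e` and no reduction modulo a large odd
number can hide a nonzero coefficient. -/
theorem BlockProd.ne_zero_iff {M N e : ℕ} {f c : ℕ → ℕ} (hM : N < M) (hodd : M % 2 = 1)
    (hN : 0 < N) (H : BlockProd M N 1 e f c) (hc : ∀ i < N, c i < M)
    (hf : ∀ i < 2 * N, f i ≤ 1)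
    (h1 : ∀ i < N, N ≤ 2 * i → f i = 0) (h1' : ∀ j < N, N ≤ 2 * j → f (N + j) = 0) {k : ℕ}
    (hk : k < N) : c k ≠ 0 ↔ ∃ i j, i + j = k ∧ f i ≠ 0 ∧ f (N + j) ≠ 0 := by
  have h := H.coeff (by omega) hN h1 h1' hk
  set S := ∑ i ∈ Finset.range (k + 1), f i * f (N + (k - i)) with hS
  have hS1 : S ≤ k + 1 := by
    calc S ≤ ∑ i ∈ Finset.range (k + 1), 1 :=
          Finset.sum_le_sum fun i hi => by
            have := Finset.mem_range.1 hi
            exact Nat.mul_le_mul (hf _ (by omega)) (hf _ (by omega))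
      _ = k + 1 := by simp
  have hu : IsUnit ((2 : ZMod M) ^ e) := by
    refine IsUnit.pow _ ?_
    have := (ZMod.isUnit_iff_coprime 2 M).2
      (Nat.coprime_two_left.2 (Nat.odd_iff.2 hodd))
    simpa using this
  have hz : ∀ x < M, (x : ZMod M) = 0 ↔ x = 0 := fun x hx => by
    rw [ZMod.natCast_eq_zero_iff]
    exact ⟨fun h => Nat.eq_zero_of_dvd_of_lt h hx, fun h => h ▸ dvd_zero _⟩
  have : c k = 0 ↔ S = 0 := by
    rw [← hz _ (hc k hk), ← hz S (by omega), h]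
    exact ⟨fun h => (hu.mul_right_eq_zero).1 h, fun h => by rw [h, mul_zero]⟩
  rw [Ne, this, hS, Finset.sum_eq_zero_iff]
  push Not
  constructor
  · rintro ⟨i, hi, h⟩
    have := Finset.mem_range.1 hi
    exact ⟨i, k - i, by omega, left_ne_zero_of_mul h, right_ne_zero_of_mul h⟩
  · rintro ⟨i, j, rfl, hi, hj⟩
    exact ⟨i, Finset.mem_range.2 (by omega), mul_ne_zero hi (by rwa [Nat.add_sub_cancel_left])⟩

end FastConv

/-! ### The convolution program -/

namespace RAM

-- The names of the word arrays. Those below `10` are parameters that are not written here; `F` holds the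
-- factors and `C` the product, and `stack` records the sizes of the levels of the recursion.
local notation "w_N" => (3 : ℕ)
local notation "w_logN" => (4 : ℕ)
local notation "w_M" => (5 : ℕ)
local notation "w_pow" => (6 : ℕ)
local notation "w_F" => (10 : ℕ)
local notation "w_tmp" => (11 : ℕ)
local notation "w_C" => (12 : ℕ)
local notation "w_root" => (13 : ℕ)
local notation "w_stack" => (14 : ℕ)
local notation "w_k" => (15 : ℕ)
local notation "w_cnt" => (16 : ℕ)
local notation "w_l" => (17 : ℕ)
local notation "w_m" => (18 : ℕ)
local notation "w_r" => (19 : ℕ)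
local notation "w_d" => (20 : ℕ)
local notation "w_t" => (21 : ℕ)
local notation "w_h" => (22 : ℕ)
local notation "w_D" => (23 : ℕ)

namespace Conv
open WordExpr FastConv

-- The expressions with names in `E` compute the functions `ext`, `expandStage`, `fwdStage`, … of the same
-- name at the loop variable `t`, and parts of them.

/-- The expression for `FastConv.ext`. -/
def extE (a : ℕ) (β w : WordExpr) : WordExpr :=
  .get a (β * var w_r + w % var w_r) * (1 + w / var w_r % 2 * (var w_M - 2))

def rootE : WordExpr := .get w_root ((var w_t + 2) / 2) / 2 + var w_t % 2 * var w_r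

def expandE : WordExpr :=
  (1 - var w_t / var w_r % (2 * var w_m) / var w_m) *
    .get w_F (var w_t / var w_r / (2 * var w_m) * (var w_m * var w_r) +
      var w_t / var w_r % (2 * var w_m) % var w_m + var w_m * (var w_t % var w_r))

def nodeE : WordExpr := var w_t / var w_r / var w_h / 2
def sideE : WordExpr := var w_t / var w_r / var w_h % 2
def sigmaE : WordExpr := .get w_root (var w_D + nodeE % var w_D) / 2

def fwdE : WordExpr :=
  (.get w_F ((nodeE * 2 * var w_h + var w_t / var w_r % var w_h) * var w_r + var w_t % var w_r) +
    extE w_F (nodeE * 2 * var w_h + var w_h + var w_t / var w_r % var w_h)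
      (var w_t % var w_r + (2 * var w_r - sigmaE)) * (1 + sideE * (var w_M - 2))) % var w_M

def bwdE : WordExpr :=
  (extE w_C (nodeE * 2 * var w_h + var w_t / var w_r % var w_h)
      (var w_t % var w_r + sideE * sigmaE) +
    extE w_C (nodeE * 2 * var w_h + var w_h + var w_t / var w_r % var w_h)
      (var w_t % var w_r + sideE * sigmaE) * (1 + sideE * (var w_M - 2))) % var w_M

def contractE : WordExpr :=
  (.get w_C ((var w_t / (var w_m * var w_r) * (2 * var w_m) +
      var w_t % (var w_m * var w_r) % var w_m) * var w_r +
      var w_t % (var w_m * var w_r) / var w_m) +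
    extE w_C (var w_t / (var w_m * var w_r) * (2 * var w_m) +
      (var w_m + var w_t % (var w_m * var w_r) % var w_m))
      (var w_t % (var w_m * var w_r) / var w_m + (2 * var w_r - 1))) % var w_M

def ext2E (a : ℕ) (β w : WordExpr) : WordExpr :=
  .get a (β * 2 + w % 2) * (1 + w / 2 % 2 * (var w_M - 2))

def baseE : WordExpr :=
  (.get w_F (var w_t / 2 * 2) * ext2E w_F (var w_cnt + var w_t / 2) (var w_t % 2) +
    .get w_F (var w_t / 2 * 2 + 1) * ext2E w_F (var w_cnt + var w_t / 2) (var w_t % 2 + 3)) %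
    var w_M

/-- Sets up `m`, `r` and the table of exponents for the level given by `k`. -/
def setupP : Program :=
  .setVar w_m (.get w_pow (var w_k / 2)) ;;
  .setVar w_r (.get w_pow (var w_k - var w_k / 2)) ;;
  .setWord w_root 1 0 ;;
  .forLoop w_t (2 * var w_m - 2) (.setWord w_root (var w_t + 2) rootE)

/-- All butterfly stages of the forward transform of one level. -/
def fwdStagesP : Program :=
  .forLoop w_d (var w_k / 2 + 1)
    (.setVar w_h (.get w_pow (var w_k / 2 - var w_d)) ;;
     .setVar w_D (.get w_pow (var w_d)) ;;
     .mapStage w_t (4 * var w_cnt * var w_m * var w_r) w_tmp w_F fwdE)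

/-- The forward transform of one level. -/
def fwdLevelP : Program :=
  setupP ;;
  .mapStage w_t (4 * var w_cnt * var w_m * var w_r) w_tmp w_F expandE ;;
  fwdStagesP ;;
  .setWord w_stack (var w_l) (var w_k) ;;
  .setVar w_l (var w_l + 1) ;;
  .setVar w_cnt (var w_cnt * (2 * var w_m)) ;;
  .setVar w_k (var w_k - var w_k / 2)

/-- All butterfly stages of the inverse transform of one level. -/
def bwdStagesP : Program :=
  .forLoop w_d (var w_k / 2 + 1)
    (.setVar w_h (.get w_pow (var w_d)) ;;
     .setVar w_D (.get w_pow (var w_k / 2 - var w_d)) ;;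
     .mapStage w_t (2 * var w_cnt * var w_m * var w_r) w_tmp w_C bwdE)

/-- The inverse transform of one level. -/
def bwdLevelP : Program :=
  .setVar w_l (var w_l - 1) ;;
  .setVar w_k (.get w_stack (var w_l)) ;;
  setupP ;;
  .setVar w_cnt (var w_cnt / (2 * var w_m)) ;;
  bwdStagesP ;;
  .mapStage w_t (var w_cnt * var w_m * var w_r) w_tmp w_C contractE

/-- The product of the two halves of the array `F`, polynomials of degree below `N`, modulo
`x ^ N + 1` and `M` and up to a power of `2`. -/
def convP : Program :=
  .setVar w_k (var w_logN) ;;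
  .setVar w_cnt 1 ;;
  .setVar w_l 0 ;;
  .while (.wordLT 1 (var w_k)) fwdLevelP ;;
  .forLoop w_t (var w_cnt * 2) (.setWord w_C (var w_t) baseE) ;;
  .while (.wordLT 0 (var w_l)) bwdLevelP

theorem convP_writes : (∀ a ∈ convP.wordWrites, 10 ≤ a ∧ a ≤ 23) ∧ convP.weightWrites = [] := by
  decide

variable {X : ℕ} {s : State} {Q : State → Prop}

/-- The table of powers of two up to `2 ^ κ` that `convP` relies on. -/
def PowTable (κ : ℕ) (s : State) : Prop := ∀ i ≤ κ, s.word w_pow i = 2 ^ i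

theorem cost_expandE : expandE.cost ≤ 1000 := by decide
theorem cost_fwdE : fwdE.cost ≤ 1000 := by decide
theorem cost_bwdE : bwdE.cost ≤ 1000 := by decide
theorem cost_contractE : contractE.cost ≤ 1000 := by decide
theorem cost_baseE : baseE.cost ≤ 1000 := by decide

/-- Memory in which the exponents of the roots of unity for `m`, `r` are available. -/
structure Ready (m r : ℕ) (s : State) : Prop where
  m_eq : s.word w_m 0 = m
  r_eq : s.word w_r 0 = r
  root : ∀ z, 1 ≤ z → z < 2 * m → s.word w_root z = rootExp r z

theorem runs_setupP {κ k : ℕ} (hp : PowTable κ s) (hk : s.word w_k 0 = k) (hkκ : k ≤ κ)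
    (hX : 4 * 2 ^ κ < X) :
    Runs X setupP s (2 ^ κ * 20000) (Ready (2 ^ (k / 2)) (2 ^ (k - k / 2))) := by
  refine Runs.of_small fun hs => ?_
  have hm : 2 ^ (k / 2) ≤ 2 ^ κ := Nat.pow_le_pow_right (by norm_num) (by omega)
  have hr : 2 ^ (k - k / 2) ≤ 2 ^ κ := Nat.pow_le_pow_right (by norm_num) (by omega)
  have hm0 : 0 < 2 ^ (k / 2) := by positivity
  have hr0 : 0 < 2 ^ (k - k / 2) := by positivity
  have e1 := hp (k / 2) (by omega)
  have e2 := hp (k - k / 2) (by omega)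
  generalize 2 ^ (k / 2) = m at *
  generalize 2 ^ (k - k / 2) = r at *
  refine Runs.mono (t₁ := 1002 + (1002 + (2001 + (2 * m - 2 + 2) * (2001 + 2003)))) ?_ ?_
    (fun _ _ _ h => h)
  swap
  · have : 1 ≤ 2 ^ κ := Nat.one_le_two_pow
    omega
  refine runs_setVar_seq (by decide) (by simp) (fun _ => hs.2 _ _) ?_
  refine runs_setVar_seq (by decide) (by simp) (fun h => h.2 _ _) ?_
  refine runs_setWord_seq (by decide) (by simp) (by simp) (fun h => by
    have := h.1; simp; omega) ?_
  refine (runs_for (fun i s' => ∀ z, 1 ≤ z → z < i + 2 → s'.word w_root z = rootExp r z)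
    (n := 2 * m - 2) (by decide)
    (by decide) (fun i s' hF _ => ?_) (fun i s' hi hs' hF hI hv => ?_) ?_ ?_).mono le_rfl
    (fun s' _ hF h => ?_)
  · simp [hF.1 w_m (by decide), hk, e1]
  · refine runs_setWord (by decide) (by simp) (by simp [rootE]) (fun _ => ?_) (fun z h1 h2 => ?_)
    all_goals
      have h3 : rootExp r (i / 2 + 1) / 2 + i % 2 * r = rootExp r (i + 2) := by
        rw [rootExp.eq_1 r (i + 2), if_neg (by omega), Nat.add_mod_right,
          Nat.add_div_right _ (by norm_num)]
      simp [rootE, hF.1 w_r (by decide), hk, e2, hv, hI (i / 2 + 1) (by omega) (by omega), h3]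
    · have := rootExp_lt hr0 (i + 2)
      omega
    · split_ifs with h
      · rw [h]
      · exact hI z h1 (by omega)
  · intro z h1 h2
    have : z = 1 := by omega
    subst this
    simp [rootExp]
  · intro _; omega
  · refine ⟨?_, ?_, fun z h1 h2 => h z h1 (by omega)⟩
    · rw [hF.1 w_m (by decide)]; simp [hk, e1]
    · rw [hF.1 w_r (by decide)]; simp [hk, e2]

theorem val_expandE {m r : ℕ} (hm : s.word w_m 0 = m) (hr : s.word w_r 0 = r) (hm0 : 0 < m)
    (hr0 : 0 < r) : expandE.safe s ∧
      expandE.val s = expandStage m r (s.word w_F) (s.word w_t 0) := by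
  refine ⟨?_, ?_⟩
  · simp [expandE, hm, hr]; omega
  · simp [expandE, hm, hr, expandStage]

theorem val_fwdE {m r M d h : ℕ} (H : Ready m r s) (hM : s.word w_M 0 = M)
    (hh : s.word w_h 0 = h) (hD : s.word w_D 0 = 2 ^ d) (hr0 : 0 < r) (hh0 : 0 < h) (hM0 : 0 < M)
    (hd : 2 ^ d ≤ m) :
    fwdE.safe s ∧ fwdE.val s = fwdStage M r d h (s.word w_F) (s.word w_t 0) := by
  have h1 := H.r_eq
  have h2 := H.root (2 ^ d + s.word w_t 0 / r / h / 2 % 2 ^ d)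
    (by have : 0 < 2 ^ d := by positivity
        omega)
    (by have := Nat.mod_lt (s.word w_t 0 / r / h / 2) (show 0 < 2 ^ d by positivity); omega)
  refine ⟨?_, ?_⟩
  · simp [fwdE, extE, nodeE, sideE, sigmaE, h1, hM, hh, hD]; omega
  · simp [fwdE, extE, nodeE, sideE, sigmaE, h1, hM, hh, hD, h2, fwdStage, ext]

theorem val_bwdE {m r M d h : ℕ} (H : Ready m r s) (hM : s.word w_M 0 = M)
    (hh : s.word w_h 0 = h) (hD : s.word w_D 0 = 2 ^ d) (hr0 : 0 < r) (hh0 : 0 < h) (hM0 : 0 < M)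
    (hd : 2 ^ d ≤ m) :
    bwdE.safe s ∧ bwdE.val s = bwdStage M r d h (s.word w_C) (s.word w_t 0) := by
  have h1 := H.r_eq
  have h2 := H.root (2 ^ d + s.word w_t 0 / r / h / 2 % 2 ^ d)
    (by have : 0 < 2 ^ d := by positivity
        omega)
    (by have := Nat.mod_lt (s.word w_t 0 / r / h / 2) (show 0 < 2 ^ d by positivity); omega)
  refine ⟨?_, ?_⟩
  · simp [bwdE, extE, nodeE, sideE, sigmaE, h1, hM, hh, hD]; omega
  · simp [bwdE, extE, nodeE, sideE, sigmaE, h1, hM, hh, hD, h2, bwdStage, ext]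

theorem val_contractE {m r M : ℕ} (hm : s.word w_m 0 = m) (hr : s.word w_r 0 = r)
    (hM : s.word w_M 0 = M) (hm0 : 0 < m) (hr0 : 0 < r) (hM0 : 0 < M) : contractE.safe s ∧
      contractE.val s = contractStage M m r (s.word w_C) (s.word w_t 0) := by
  refine ⟨?_, ?_⟩
  · simp [contractE, extE, hm, hr, hM]; omega
  · simp [contractE, extE, hm, hr, hM, contractStage, ext]

theorem val_baseE {cnt M : ℕ} (hc : s.word w_cnt 0 = cnt) (hM : s.word w_M 0 = M) (hM0 : 0 < M) :
    baseE.safe s ∧ baseE.val s = baseStage M cnt (s.word w_F) (s.word w_t 0) := by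
  refine ⟨?_, ?_⟩
  · simp [baseE, ext2E, hM]; omega
  · simp [baseE, ext2E, hc, hM, baseStage, ext]

/-- The facts about the memory that hold throughout `convP`; `L` bounds the lengths of all loops. -/
structure Env (κ M L X : ℕ) (s : State) : Prop where
  pow : PowTable κ s
  M_eq : s.word w_M 0 = M
  two_le : 2 ≤ M
  M_lt : M < X
  le_L : 8 * 2 ^ κ ≤ L
  L_lt : L < X

theorem Env.congr {κ M L : ℕ} {s s' : State} (h : Env κ M L X s)
    (hF : ∀ a < 10, ∀ i, s'.word a i = s.word a i) : Env κ M L X s' :=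
  ⟨fun i hi => by rw [hF _ (by norm_num)]; exact h.pow i hi,
    by rw [hF _ (by norm_num)]; exact h.M_eq, h.two_le, h.M_lt, h.le_L, h.L_lt⟩

theorem runs_fwdStagesP {κ k cnt M L : ℕ} (hE : Env κ M L X s) (hk : s.word w_k 0 = k)
    (hkκ : k ≤ κ) (hc : s.word w_cnt 0 = cnt) (hR : Ready (2 ^ (k / 2)) (2 ^ (k - k / 2)) s)
    (hL : 4 * cnt * 2 ^ k ≤ L) :
    Runs X fwdStagesP s ((k / 2 + 3) * (L * 20000)) (fun s' => ∃ g : ℕ → ℕ → ℕ,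
      g 0 = s.word w_F ∧ g (k / 2 + 1) = s'.word w_F ∧
        ∀ d < k / 2 + 1, ∀ t < 2 * cnt * (2 * 2 ^ (k / 2)) * 2 ^ (k - k / 2),
          g (d + 1) t = fwdStage M (2 ^ (k - k / 2)) d (2 ^ (k / 2 - d)) (g d) t) := by
  set μ := k / 2 with hμ
  set r := 2 ^ (k - μ) with hr
  have hmr : 2 ^ μ * r = 2 ^ k := by rw [hr, ← pow_add, Nat.add_sub_cancel' (by omega)]
  have hn : 2 * cnt * (2 * 2 ^ μ) * r = 4 * cnt * 2 ^ k := by rw [← hmr]; ring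
  have hκ : κ < 2 ^ κ := Nat.lt_two_pow_self
  have hLX := hE.L_lt
  have hLκ := hE.le_L
  rw [hn]
  refine (runs_for (t := 2 * 1002 + (L + 2) * 10000) (n := μ + 1) (fun d s' => ∃ g : ℕ → ℕ → ℕ,
    g 0 = s.word w_F ∧ g d = s'.word w_F ∧ ∀ d' < d, ∀ t < 4 * cnt * 2 ^ k,
      g (d' + 1) t = fwdStage M r d' (2 ^ (μ - d')) (g d') t) (by decide)
    (by decide) (fun i s' hF _ => ?_) (fun d s' hd hs' hF hI hv => ?_) ?_ ?_).mono
    (Nat.mul_le_mul_left _ (by omega))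
    (fun s' _ hF h => h)
  · simp [hF.1 w_k (by decide), hk, hμ]
  · obtain ⟨g, g0, gd, hg⟩ := hI
    have f1 := hE.pow (μ - d) (by omega)
    have f2 := hE.pow d (by omega)
    have hr0 : 0 < r := by positivity
    have hdm : 2 ^ d ≤ 2 ^ μ := Nat.pow_le_pow_right (by norm_num) (by omega)
    have hlt : ∀ a ≤ κ, 2 ^ a < X := fun a ha =>
      lt_of_le_of_lt (Nat.pow_le_pow_right (by norm_num) ha) (by omega)
    refine Runs.mono (t₁ := 1002 + (1002 + (4 * cnt * 2 ^ k + 2) * 10000)) (Q := fun s'' =>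
      ∀ t, s''.word w_F t = if t < 4 * cnt * 2 ^ k then
        fwdStage M r d (2 ^ (μ - d)) (s'.word w_F) t else s'.word w_F t) ?_ (by omega)
      (fun s'' _ hF' h => ?_)
    · refine runs_setVar_seq (by decide) (by simp) (fun h => h.2 _ _) ?_
      refine runs_setVar_seq (by decide) (by simp) (fun h => h.2 _ _) ?_
      have q5 := hF.1 w_M (by decide) 0
      have q6 := hF.1 w_pow (by decide)
      have q13 := hF.1 w_root (by decide)
      have q15 := hF.1 w_k (by decide) 0
      have q16 := hF.1 w_cnt (by decide) 0
      have q18 := hF.1 w_m (by decide) 0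
      have q19 := hF.1 w_r (by decide) 0
      have v1 := hR.m_eq
      have v2 := hR.r_eq
      refine (runs_mapStage (n := 4 * cnt * 2 ^ k) (F := fwdStage M r d (2 ^ (μ - d))
        (s'.word w_F)) (by decide) cost_fwdE (by decide) (fun s₁ h => ?_) (fun t ht s₁ h hv₁ => ?_)
        ?_ ?_).mono le_rfl (fun s₁ _ _ h t => ?_)
      · simp only [WordExpr.val_mul, val_var, val_ofNat, safe_mul, safe_var, safe_ofNat]
        rw [h w_cnt (by decide) (by decide) (by decide), h w_m (by decide) (by decide) (by decide),
          h w_r (by decide) (by decide) (by decide)]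
        simp [q16, q18, q19, hc, v1, v2, ← hmr, mul_assoc]
      · have hF₁ : s₁.word w_F = s'.word w_F := by
          funext i
          rw [h w_F (by decide) (by decide)]
          simp
        rw [← hv₁, ← hF₁]
        refine val_fwdE (m := 2 ^ μ) ⟨?_, ?_, fun z h1 h2 => ?_⟩ ?_ ?_ ?_ hr0 (by positivity)
          (by have := hE.two_le; omega) hdm
        · rw [h w_m (by decide) (by decide)]; simp [q18, v1]
        · rw [h w_r (by decide) (by decide)]; simp [q19, v2, hr]
        · rw [h w_root (by decide) (by decide)]; simp [q13, hR.root z h1 h2, hr]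
        · rw [h w_M (by decide) (by decide)]; simp [q5, hE.M_eq]
        · rw [h w_h (by decide) (by decide)]; simp [q6, q15, hv, hk, ← hμ, f1]
        · rw [h w_D (by decide) (by decide)]; simp [q6, hv, f2]
      · intro _ t _
        exact (Nat.mod_lt _ (by have := hE.two_le; omega)).trans hE.M_lt
      · intro _; omega
      · simpa using h t
    · refine ⟨fun i => if i ≤ d then g i else s''.word w_F, ?_, ?_, fun d' hd' t ht => ?_⟩
      · simp [g0]
      · funext i; simp
      · rcases Nat.lt_succ_iff_lt_or_eq.1 hd' with h1 | rfl
        · simp only [show d' + 1 ≤ d by omega, h1.le, if_true]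
          exact hg d' h1 t ht
        · simp only [le_rfl, if_true, show ¬ d' + 1 ≤ d' by omega, if_false]
          rw [h t, if_pos ht, gd]
  · exact ⟨fun _ => s.word w_F, rfl, by funext i; simp, fun d' h => absurd h (by omega)⟩
  · intro _; omega

theorem runs_fwdLevelP {κ k cnt l M L : ℕ} (hE : Env κ M L X s) (hk : s.word w_k 0 = k)
    (hkκ : k ≤ κ) (hc : s.word w_cnt 0 = cnt) (hl : s.word w_l 0 = l) (hlκ : l ≤ κ)
    (hL : 4 * cnt * 2 ^ k ≤ L) :
    Runs X fwdLevelP s ((κ + 5) * (L * 20000)) (fun s' =>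
      FwdLevel M (k / 2) (2 ^ (k - k / 2)) cnt (s.word w_F) (s'.word w_F) ∧
      (∀ i, s'.word w_stack i = if i = l then k else s.word w_stack i) ∧
      s'.word w_l 0 = l + 1 ∧ s'.word w_cnt 0 = cnt * 2 ^ (k / 2 + 1) ∧
      s'.word w_k 0 = k - k / 2) := by
  refine Runs.of_small fun hs => ?_
  have hκ : κ < 2 ^ κ := Nat.lt_two_pow_self
  have hLX := hE.L_lt
  have hLκ := hE.le_L
  have hmr : 2 ^ (k / 2) * 2 ^ (k - k / 2) = 2 ^ k := by
    rw [← pow_add, Nat.add_sub_cancel' (by omega)]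
  have hn : 2 * cnt * (2 * 2 ^ (k / 2)) * 2 ^ (k - k / 2) = 4 * cnt * 2 ^ k := by
    rw [← hmr]; ring
  refine Runs.mono (t₁ := 2 ^ κ * 20000 + ((4 * cnt * 2 ^ k + 2) * 10000 +
    ((k / 2 + 3) * (L * 20000) + (2001 + (1002 + (1002 + 1002)))))) ?_ ?_ (fun _ _ _ h => h)
  swap
  · have h1 : (k / 2 + 3) * (L * 20000) ≤ (κ + 3) * (L * 20000) :=
      Nat.mul_le_mul_right _ (by omega)
    have h2 : (κ + 5) * (L * 20000) = (κ + 3) * (L * 20000) + L * 40000 := by ring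
    have h3 : 1 ≤ 2 ^ κ := Nat.one_le_two_pow
    omega
  refine (runs_setupP hE.pow hk hkκ (by omega)).seq fun s₁ hs₁ hF₁ hR => ?_
  have hE₁ : Env κ M L X s₁ := hE.congr fun a ha => hF₁.1 a (by
    revert a; decide)
  have k₁ : s₁.word w_k 0 = k := by rw [hF₁.1 _ (by decide), hk]
  have c₁ : s₁.word w_cnt 0 = cnt := by rw [hF₁.1 _ (by decide), hc]
  have v1 := hR.m_eq
  have v2 := hR.r_eq
  refine (runs_mapStage (n := 4 * cnt * 2 ^ k) (F := expandStage (2 ^ (k / 2)) (2 ^ (k - k / 2))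
    (s₁.word w_F)) (by decide) cost_expandE (by decide) (fun s₂ h => ?_) (fun t ht s₂ h hv => ?_)
    ?_ ?_).seq fun s₂ hs₂ hF₂ h₂ => ?_
  · simp only [WordExpr.val_mul, val_var, val_ofNat, safe_mul, safe_var, safe_ofNat]
    rw [h w_cnt (by decide) (by decide) (by decide), h w_m (by decide) (by decide) (by decide),
      h w_r (by decide) (by decide) (by decide), c₁, v1, v2, mul_assoc, hmr]
    simp
  · have hF₃ : s₂.word w_F = s₁.word w_F := by
      funext i
      rw [h w_F (by decide) (by decide)]
    rw [← hv, ← hF₃]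
    exact val_expandE (by rw [h w_m (by decide) (by decide), v1])
      (by rw [h w_r (by decide) (by decide), v2]) (by positivity) (by positivity)
  · intro hs t _
    refine lt_of_le_of_lt (Nat.mul_le_mul_right _ (Nat.sub_le _ _)) ?_
    rw [one_mul]
    exact hs.2 _ _
  · intro _; omega
  have hE₂ : Env κ M L X s₂ := hE₁.congr fun a ha => hF₂.1 a (by revert a; decide)
  have k₂ : s₂.word w_k 0 = k := by rw [hF₂.1 _ (by decide), k₁]
  have c₂ : s₂.word w_cnt 0 = cnt := by rw [hF₂.1 _ (by decide), c₁]
  have R₂ : Ready (2 ^ (k / 2)) (2 ^ (k - k / 2)) s₂ :=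
    ⟨by rw [hF₂.1 _ (by decide), v1], by rw [hF₂.1 _ (by decide), v2],
      fun z h1 h2 => by rw [hF₂.1 _ (by decide), hR.root z h1 h2]⟩
  refine (runs_fwdStagesP hE₂ k₂ hkκ c₂ R₂ hL).seq fun s₃ hs₃ hF₃ h₃ => ?_
  have k₃ : s₃.word w_k 0 = k := by rw [hF₃.1 _ (by decide), k₂]
  have c₃ : s₃.word w_cnt 0 = cnt := by rw [hF₃.1 _ (by decide), c₂]
  have l₃ : s₃.word w_l 0 = l := by
    rw [hF₃.1 _ (by decide), hF₂.1 _ (by decide), hF₁.1 _ (by decide), hl]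
  have m₃ : s₃.word w_m 0 = 2 ^ (k / 2) := by rw [hF₃.1 _ (by decide), R₂.m_eq]
  have K₃ : ∀ i, s₃.word w_stack i = s.word w_stack i := fun i => by
    rw [hF₃.1 _ (by decide), hF₂.1 _ (by decide), hF₁.1 _ (by decide)]
  have F₁ : s₁.word w_F = s.word w_F := by funext i; rw [hF₁.1 _ (by decide)]
  have hb : cnt * (2 * 2 ^ (k / 2)) ≤ L := by
    have : 1 ≤ 2 ^ (k - k / 2) := Nat.one_le_two_pow
    nlinarith
  refine runs_setWord_seq (by decide) (by simp) (by simp) (fun h => by simpa using h.2 _ _) ?_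
  refine runs_setVar_seq (by decide) (by simp) (fun h => by simp [l₃]; omega) ?_
  refine runs_setVar_seq (by decide) (by simp) (fun h => by simp [c₃, m₃]; omega) ?_
  refine runs_setVar (by decide) (by simp) (fun h => by simp [k₃]; omega) ?_
  obtain ⟨g, g0, gd, hg⟩ := h₃
  refine ⟨⟨g, ?_, fun t ht => ?_, fun d hd t ht => hg d (by omega) t ht⟩, fun i => ?_, ?_, ?_, ?_⟩
  · rw [gd]; funext i; simp
  · rw [g0, h₂, if_pos (by omega), F₁]
  · simp [l₃, k₃, K₃]
  · simp [l₃]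
  · simp [c₃, m₃, pow_succ']
  · simp [k₃]

theorem runs_bwdStagesP {κ k cnt M L : ℕ} (hE : Env κ M L X s) (hk : s.word w_k 0 = k)
    (hkκ : k ≤ κ) (hc : s.word w_cnt 0 = cnt) (hR : Ready (2 ^ (k / 2)) (2 ^ (k - k / 2)) s)
    (hL : 4 * cnt * 2 ^ k ≤ L) :
    Runs X bwdStagesP s ((k / 2 + 3) * (L * 20000)) (fun s' => ∃ g : ℕ → ℕ → ℕ,
      g 0 = s.word w_C ∧ g (k / 2 + 1) = s'.word w_C ∧
        ∀ d < k / 2 + 1, ∀ t < cnt * (2 * 2 ^ (k / 2)) * 2 ^ (k - k / 2),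
          g (d + 1) t = bwdStage M (2 ^ (k - k / 2)) (k / 2 - d) (2 ^ d) (g d) t) := by
  set μ := k / 2 with hμ
  set r := 2 ^ (k - μ) with hr
  have hmr : 2 ^ μ * r = 2 ^ k := by rw [hr, ← pow_add, Nat.add_sub_cancel' (by omega)]
  have hn : cnt * (2 * 2 ^ μ) * r = 2 * cnt * 2 ^ k := by rw [← hmr]; ring
  have hκ : κ < 2 ^ κ := Nat.lt_two_pow_self
  have hLX := hE.L_lt
  have hLκ := hE.le_L
  have hL2 : 4 * cnt * 2 ^ k = 2 * (2 * cnt * 2 ^ k) := by ring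
  rw [hn]
  refine (runs_for (t := 2 * 1002 + (L + 2) * 10000) (n := μ + 1) (fun d s' => ∃ g : ℕ → ℕ → ℕ,
    g 0 = s.word w_C ∧ g d = s'.word w_C ∧ ∀ d' < d, ∀ t < 2 * cnt * 2 ^ k,
      g (d' + 1) t = bwdStage M r (μ - d') (2 ^ d') (g d') t) (by decide)
    (by decide) (fun i s' hF _ => ?_) (fun d s' hd hs' hF hI hv => ?_) ?_ ?_).mono
    (Nat.mul_le_mul_left _ (by omega))
    (fun s' _ hF h => h)
  · simp [hF.1 w_k (by decide), hk, hμ]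
  · obtain ⟨g, g0, gd, hg⟩ := hI
    have f1 := hE.pow (μ - d) (by omega)
    have f2 := hE.pow d (by omega)
    have hr0 : 0 < r := by positivity
    have hdm : 2 ^ (μ - d) ≤ 2 ^ μ := Nat.pow_le_pow_right (by norm_num) (by omega)
    refine Runs.mono (t₁ := 1002 + (1002 + (2 * cnt * 2 ^ k + 2) * 10000)) (Q := fun s'' =>
      ∀ t, s''.word w_C t = if t < 2 * cnt * 2 ^ k then
        bwdStage M r (μ - d) (2 ^ d) (s'.word w_C) t else s'.word w_C t) ?_ (by omega)
      (fun s'' _ hF' h => ?_)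
    · refine runs_setVar_seq (by decide) (by simp) (fun h => h.2 _ _) ?_
      refine runs_setVar_seq (by decide) (by simp) (fun h => h.2 _ _) ?_
      have q5 := hF.1 w_M (by decide) 0
      have q6 := hF.1 w_pow (by decide)
      have q13 := hF.1 w_root (by decide)
      have q15 := hF.1 w_k (by decide) 0
      have q16 := hF.1 w_cnt (by decide) 0
      have q18 := hF.1 w_m (by decide) 0
      have q19 := hF.1 w_r (by decide) 0
      have v1 := hR.m_eq
      have v2 := hR.r_eq
      refine (runs_mapStage (n := 2 * cnt * 2 ^ k) (F := bwdStage M r (μ - d) (2 ^ d)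
        (s'.word w_C)) (by decide) cost_bwdE (by decide) (fun s₁ h => ?_) (fun t ht s₁ h hv₁ => ?_)
        ?_ ?_).mono le_rfl (fun s₁ _ _ h t => ?_)
      · simp only [WordExpr.val_mul, val_var, val_ofNat, safe_mul, safe_var, safe_ofNat]
        rw [h w_cnt (by decide) (by decide) (by decide), h w_m (by decide) (by decide) (by decide),
          h w_r (by decide) (by decide) (by decide)]
        simp [q16, q18, q19, hc, v1, v2, ← hmr, mul_assoc]
      · have hF₁ : s₁.word w_C = s'.word w_C := by
          funext i
          rw [h w_C (by decide) (by decide)]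
          simp
        rw [← hv₁, ← hF₁]
        refine val_bwdE (m := 2 ^ μ) ⟨?_, ?_, fun z h1 h2 => ?_⟩ ?_ ?_ ?_ hr0 (by positivity)
          (by have := hE.two_le; omega) hdm
        · rw [h w_m (by decide) (by decide)]; simp [q18, v1]
        · rw [h w_r (by decide) (by decide)]; simp [q19, v2, hr]
        · rw [h w_root (by decide) (by decide)]; simp [q13, hR.root z h1 h2, hr]
        · rw [h w_M (by decide) (by decide)]; simp [q5, hE.M_eq]
        · rw [h w_h (by decide) (by decide)]; simp [q6, hv, f2]
        · rw [h w_D (by decide) (by decide)]; simp [q6, q15, hv, hk, ← hμ, f1]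
      · intro _ t _
        exact (Nat.mod_lt _ (by have := hE.two_le; omega)).trans hE.M_lt
      · intro _; omega
      · simpa using h t
    · refine ⟨fun i => if i ≤ d then g i else s''.word w_C, ?_, ?_, fun d' hd' t ht => ?_⟩
      · simp [g0]
      · funext i; simp
      · rcases Nat.lt_succ_iff_lt_or_eq.1 hd' with h1 | rfl
        · simp only [show d' + 1 ≤ d by omega, h1.le, if_true]
          exact hg d' h1 t ht
        · simp only [le_rfl, if_true, show ¬ d' + 1 ≤ d' by omega, if_false]
          rw [h t, if_pos ht, gd]
  · exact ⟨fun _ => s.word w_C, rfl, by funext i; simp, fun d' h => absurd h (by omega)⟩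
  · intro _; omega

theorem runs_bwdLevelP {κ k cnt l M L : ℕ} (hE : Env κ M L X s) (hl : s.word w_l 0 = l + 1)
    (hk : s.word w_stack l = k) (hkκ : k ≤ κ) (hc : s.word w_cnt 0 = cnt * 2 ^ (k / 2 + 1))
    (hL : 4 * cnt * 2 ^ k ≤ L) :
    Runs X bwdLevelP s ((κ + 5) * (L * 20000)) (fun s' =>
      BwdLevel M (k / 2) (2 ^ (k - k / 2)) cnt (s.word w_C) (s'.word w_C) ∧
      (∀ t < cnt * 2 ^ k, s'.word w_C t < M) ∧
      s'.word w_l 0 = l ∧ s'.word w_cnt 0 = cnt ∧ s'.word w_k 0 = k) := by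
  refine Runs.of_small fun hs => ?_
  have hκ : κ < 2 ^ κ := Nat.lt_two_pow_self
  have hLX := hE.L_lt
  have hLκ := hE.le_L
  have hM2 := hE.two_le
  have hmr : 2 ^ (k / 2) * 2 ^ (k - k / 2) = 2 ^ k := by
    rw [← pow_add, Nat.add_sub_cancel' (by omega)]
  have hL2 : 4 * cnt * 2 ^ k = 4 * (cnt * 2 ^ k) := by ring
  have hlX : l + 1 < X := hl ▸ hs.2 w_l 0
  refine Runs.mono (t₁ := 1002 + (1002 + (2 ^ κ * 20000 + (1002 + ((k / 2 + 3) * (L * 20000) +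
    (cnt * 2 ^ k + 2) * 10000))))) ?_ ?_ (fun _ _ _ h => h)
  swap
  · have h1 : (k / 2 + 3) * (L * 20000) ≤ (κ + 3) * (L * 20000) :=
      Nat.mul_le_mul_right _ (by omega)
    have h2 : (κ + 5) * (L * 20000) = (κ + 3) * (L * 20000) + L * 40000 := by ring
    have h3 : 1 ≤ 2 ^ κ := Nat.one_le_two_pow
    omega
  refine runs_setVar_seq (by decide) (by simp) (fun h => by simp [hl]; omega) ?_
  refine runs_setVar_seq (by decide) (by simp) (fun h => h.2 _ _) ?_
  set s₀ := (s.setWord w_l 0 (WordExpr.val s (var w_l - 1))).setWord w_k 0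
    (WordExpr.val (s.setWord w_l 0 (WordExpr.val s (var w_l - 1))) (.get w_stack (var w_l)))
    with hs₀
  have hE₀ : Env κ M L X s₀ := hE.congr fun a ha i => by
    rw [hs₀, State.word_setWord, if_neg (by omega), State.word_setWord, if_neg (by omega)]
  have k₀ : s₀.word w_k 0 = k := by simp [hs₀, hl, hk]
  have l₀ : s₀.word w_l 0 = l := by simp [hs₀, hl]
  have c₀ : s₀.word w_cnt 0 = cnt * 2 ^ (k / 2 + 1) := by simp [hs₀, hc]
  have C₀ : s₀.word w_C = s.word w_C := by funext i; simp [hs₀]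
  refine (runs_setupP hE₀.pow k₀ hkκ (by omega)).seq fun s₁ hs₁ hF₁ hR => ?_
  have hE₁ : Env κ M L X s₁ := hE₀.congr fun a ha => hF₁.1 a (by revert a; decide)
  have k₁ : s₁.word w_k 0 = k := by rw [hF₁.1 _ (by decide), k₀]
  have c₁ : s₁.word w_cnt 0 = cnt * 2 ^ (k / 2 + 1) := by rw [hF₁.1 _ (by decide), c₀]
  have hdiv : s₁.word w_cnt 0 / (2 * s₁.word w_m 0) = cnt := by
    rw [c₁, hR.m_eq, pow_succ', Nat.mul_div_cancel _ (by positivity)]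
  have hm0 : s₁.word w_m 0 ≠ 0 := by rw [hR.m_eq]; positivity
  have hcX : cnt < X := by
    have : 1 ≤ 2 ^ k := Nat.one_le_two_pow
    nlinarith
  refine runs_setVar_seq (by decide) (by simp [hm0]) (fun h => by simp [hdiv, hcX]) ?_
  set s₂ := s₁.setWord w_cnt 0 (WordExpr.val s₁ (var w_cnt / (2 * var w_m))) with hs₂
  have hE₂ : Env κ M L X s₂ := hE₁.congr fun a ha i => by
    rw [hs₂, State.word_setWord, if_neg (by omega)]
  have k₂ : s₂.word w_k 0 = k := by simp [hs₂, k₁]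
  have c₂ : s₂.word w_cnt 0 = cnt := by simp [hs₂, hdiv]
  have R₂ : Ready (2 ^ (k / 2)) (2 ^ (k - k / 2)) s₂ :=
    ⟨by simp [hs₂, hR.m_eq], by simp [hs₂, hR.r_eq],
      fun z h1 h2 => by simp [hs₂, hR.root z h1 h2]⟩
  have C₂ : s₂.word w_C = s.word w_C := by
    funext i; simp [hs₂, hF₁.1 w_C (by decide), C₀]
  have l₂ : s₂.word w_l 0 = l := by simp [hs₂, hF₁.1 w_l (by decide), l₀]
  refine (runs_bwdStagesP hE₂ k₂ hkκ c₂ R₂ hL).seq fun s₃ hs₃ hF₃ h₃ => ?_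
  have k₃ : s₃.word w_k 0 = k := by rw [hF₃.1 _ (by decide), k₂]
  have c₃ : s₃.word w_cnt 0 = cnt := by rw [hF₃.1 _ (by decide), c₂]
  have l₃ : s₃.word w_l 0 = l := by rw [hF₃.1 _ (by decide), l₂]
  have m₃ : s₃.word w_m 0 = 2 ^ (k / 2) := by rw [hF₃.1 _ (by decide), R₂.m_eq]
  have r₃ : s₃.word w_r 0 = 2 ^ (k - k / 2) := by rw [hF₃.1 _ (by decide), R₂.r_eq]
  have M₃ : s₃.word w_M 0 = M := by rw [hF₃.1 _ (by decide), hE₂.M_eq]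
  obtain ⟨g, g0, gd, hg⟩ := h₃
  have hlt : ∀ t, contractStage M (2 ^ (k / 2)) (2 ^ (k - k / 2)) (s₃.word w_C) t < M := fun t =>
    Nat.mod_lt _ (by omega)
  refine (runs_mapStage (n := cnt * 2 ^ k) (F := contractStage M (2 ^ (k / 2)) (2 ^ (k - k / 2))
    (s₃.word w_C)) (by decide) cost_contractE (by decide) (fun s₄ h => ?_)
    (fun t ht s₄ h hv => ?_) (fun _ t _ => (hlt t).trans hE.M_lt) (fun _ => by omega)).mono le_rfl
    fun s₄ _ hF₄ h₄ => ?_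
  · simp only [WordExpr.val_mul, val_var, safe_mul, safe_var]
    rw [h w_cnt (by decide) (by decide) (by decide), h w_m (by decide) (by decide) (by decide),
      h w_r (by decide) (by decide) (by decide), c₃, m₃, r₃, mul_assoc, hmr]
    simp
  · have hC₄ : s₄.word w_C = s₃.word w_C := by
      funext i
      rw [h w_C (by decide) (by decide)]
    rw [← hv, ← hC₄]
    exact val_contractE (by rw [h w_m (by decide) (by decide), m₃])
      (by rw [h w_r (by decide) (by decide), r₃]) (by rw [h w_M (by decide) (by decide), M₃])
      (by positivity) (by positivity) (by omega)
  · refine ⟨⟨g, g0.trans C₂, fun j hj t ht => hg j (by omega) t ht, fun t ht => ?_⟩,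
      fun t ht => ?_, ?_, ?_, ?_⟩
    · rw [hmr] at ht
      rw [h₄, if_pos ht, gd]
    · rw [h₄, if_pos ht]
      exact hlt t
    · rw [hF₄.1 _ (by decide), l₃]
    · rw [hF₄.1 _ (by decide), c₃]
    · rw [hF₄.1 _ (by decide), k₃]

/-- The levels of the recursion that lead from polynomials of degree below `2 ^ κ` in the array `f₀` to
`2 * cnt` polynomials of degree below `2 ^ k` in `f`. The values of `k` on the way are on the stack. -/
inductive Chain (M κ : ℕ) (f₀ stack : ℕ → ℕ) : ℕ → ℕ → ℕ → (ℕ → ℕ) → Prop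
  | start : Chain M κ f₀ stack 0 κ 1 f₀
  | step {l k cnt : ℕ} {f f' : ℕ → ℕ} (h : Chain M κ f₀ stack l k cnt f) (hk : 1 < k)
      (hf : FwdLevel M (k / 2) (2 ^ (k - k / 2)) cnt f f') (hs : stack l = k) :
      Chain M κ f₀ stack (l + 1) (k - k / 2) (cnt * 2 ^ (k / 2 + 1)) f'

theorem Chain.congr {M κ l k cnt : ℕ} {f₀ st st' f : ℕ → ℕ} (h : Chain M κ f₀ st l k cnt f)
    (hst : ∀ i < l, st' i = st i) : Chain M κ f₀ st' l k cnt f := by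
  induction h with
  | start => exact .start
  | step _ hk hf hs ih =>
    exact .step (ih fun i hi => hst i (by omega)) hk hf (by rw [hst _ (by omega), hs])

/-- Each level doubles the total length `cnt * 2 ^ k` and halves `k - 1`; so the number of levels is
logarithmic in `κ`, and the lengths stay below `κ * 2 ^ κ` up to a constant. -/
theorem Chain.bounds {M κ l k cnt : ℕ} {f₀ st f : ℕ → ℕ} (h : Chain M κ f₀ st l k cnt f)
    (hκ : 1 ≤ κ) :
    cnt * 2 ^ k = 2 ^ κ * 2 ^ l ∧ 1 ≤ k ∧ (k - 1) * 2 ^ l ≤ κ - 1 ∧ k + l ≤ κ := by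
  induction h with
  | start => simp [hκ]
  | @step l k cnt f f' h hk hf hs ih =>
    obtain ⟨h1, h2, h3, h4⟩ := ih
    refine ⟨?_, by omega, ?_, by omega⟩
    · rw [pow_succ 2 l, ← mul_assoc, ← h1, mul_assoc, ← pow_add,
        show k / 2 + 1 + (k - k / 2) = k + 1 by omega]
      ring
    · refine le_trans ?_ h3
      rw [pow_succ', ← mul_assoc]
      exact Nat.mul_le_mul_right _ (by omega)

theorem Chain.length_le {M κ l k cnt : ℕ} {f₀ st f : ℕ → ℕ} (h : Chain M κ f₀ st l k cnt f)
    (hκ : 1 ≤ κ) (hk : 1 < k) : 4 * cnt * 2 ^ k ≤ 8 * κ * 2 ^ κ := by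
  obtain ⟨h1, h2, h3, h4⟩ := h.bounds hκ
  have : 1 * 2 ^ l ≤ (k - 1) * 2 ^ l := Nat.mul_le_mul_right _ (by omega)
  rw [mul_assoc, h1, mul_assoc 8, mul_comm κ]
  have : 2 ^ κ * 2 ^ l ≤ 2 ^ κ * κ := Nat.mul_le_mul_left _ (by omega)
  omega

theorem Chain.length_le' {M κ l k cnt : ℕ} {f₀ st f : ℕ → ℕ} (h : Chain M κ f₀ st l k cnt f)
    (hκ : 1 ≤ κ) : cnt * 2 ^ k ≤ 8 * κ * 2 ^ κ := by
  cases h with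
  | start => nlinarith [Nat.zero_le (2 ^ κ)]
  | @step l k cnt f f' h hk hf hs =>
    have := h.length_le hκ hk
    rw [mul_assoc cnt, ← pow_add, show k / 2 + 1 + (k - k / 2) = k + 1 by omega, pow_succ]
    have : cnt * (2 ^ k * 2) ≤ 4 * cnt * 2 ^ k := by nlinarith [Nat.zero_le (cnt * 2 ^ k)]
    omega

/-- The convolution program: cell `x` of the array `C` is nonzero exactly if `x` is the sum of the
positions of ones in the two halves of the array `F`. -/
theorem runs_convP {κ M : ℕ} (hκ : 1 ≤ κ) (hP : PowTable κ s) (hlog : s.word w_logN 0 = κ)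
    (hM : s.word w_M 0 = M) (hMX : M < X) (hNM : 2 ^ κ < M) (hodd : M % 2 = 1)
    (hX : 8 * κ * 2 ^ κ < X) (hF : ∀ i < 2 * 2 ^ κ, s.word w_F i ≤ 1)
    (h1 : ∀ i < 2 ^ κ, 2 ^ κ ≤ 2 * i → s.word w_F i = 0)
    (h1' : ∀ j < 2 ^ κ, 2 ^ κ ≤ 2 * j → s.word w_F (2 ^ κ + j) = 0) :
    Runs X convP s (2 ^ κ * κ ^ 3 * 10 ^ 8) (fun s' => ∀ x < 2 ^ κ, s'.word w_C x ≠ 0 ↔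
      ∃ i j, i + j = x ∧ s.word w_F i ≠ 0 ∧ s.word w_F (2 ^ κ + j) ≠ 0) := by
  set L := 8 * κ * 2 ^ κ with hL
  have hLκ : 8 * 2 ^ κ ≤ L := by rw [hL]; exact Nat.mul_le_mul_right _ (by omega)
  have hκ2 : κ < 2 ^ κ := Nat.lt_two_pow_self
  have hM2 : 2 ≤ M := by omega
  have hE : Env κ M L X s := ⟨hP, hM, hM2, hMX, hLκ, hX⟩
  refine Runs.mono (t₁ := 1002 + (1002 + (1002 + ((κ + 1) * ((κ + 5) * (L * 20000) + 1001) +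
    ((L + 2) * 5000 + (κ + 1) * ((κ + 5) * (L * 20000) + 1001)))))) (Q := fun s' =>
    ∃ e, BlockProd M (2 ^ κ) 1 e (s.word w_F) (s'.word w_C) ∧ ∀ i < 2 ^ κ, s'.word w_C i < M)
    ?_ ?_ (fun s' _ _ h x hx => ?_)
  · refine runs_setVar_seq (by decide) (by simp) (fun h => h.2 _ _) ?_
    refine runs_setVar_seq (by decide) (by simp) (fun h => by
      have := h.1; rw [val_ofNat]; omega) ?_
    refine runs_setVar_seq (by decide) (by simp) (fun h => by
      have := h.1; rw [val_ofNat]; omega) ?_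
    set s₀ := ((s.setWord w_k 0 (WordExpr.val s (var w_logN))).setWord w_cnt 0
      (WordExpr.val (s.setWord w_k 0 (WordExpr.val s (var w_logN))) 1)).setWord w_l 0
      (WordExpr.val ((s.setWord w_k 0 (WordExpr.val s (var w_logN))).setWord w_cnt 0
      (WordExpr.val (s.setWord w_k 0 (WordExpr.val s (var w_logN))) 1)) 0) with hs₀
    have hE₀ : Env κ M L X s₀ := hE.congr fun a ha i => by
      rw [hs₀, State.word_setWord, if_neg (by omega), State.word_setWord, if_neg (by omega),
        State.word_setWord, if_neg (by omega)]
    have k₀ : s₀.word w_k 0 = κ := by simp [hs₀, hlog]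
    have c₀ : s₀.word w_cnt 0 = 1 := by simp [hs₀]
    have l₀ : s₀.word w_l 0 = 0 := by simp [hs₀]
    have F₀ : s₀.word w_F = s.word w_F := by funext i; simp [hs₀]
    refine Runs.seq (t₁ := (κ + 1) * ((κ + 5) * (L * 20000) + 1001)) (R := fun s' => ∃ l cnt,
      Chain M κ (s.word w_F) (s'.word w_stack) l 1 cnt (s'.word w_F) ∧ s'.word w_k 0 = 1 ∧
        s'.word w_cnt 0 = cnt ∧ s'.word w_l 0 = l) ?_ fun s₁ hs₁ hF₁ h₁ => ?_
    · refine (runs_while (t := (κ + 5) * (L * 20000)) (b := .wordLT 1 (var w_k)) (by decide)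
        (fun s' => ∃ l k cnt,
        Chain M κ (s.word w_F) (s'.word w_stack) l k cnt (s'.word w_F) ∧ s'.word w_k 0 = k ∧
        s'.word w_cnt 0 = cnt ∧ s'.word w_l 0 = l) (fun s' => s'.word w_k 0)
        (fun s' _ => ⟨by simp, by simp⟩) (fun s' hs' hF' hI hb => ?_) ?_).mono (by rw [k₀])
        (fun s' _ _ h => ?_)
      · obtain ⟨l, k, cnt, hC, hk, hc, hl⟩ := hI
        have hk1 : 1 < k := by simpa [Test.holds, hk] using hb
        obtain ⟨b1, b2, b3, b4⟩ := hC.bounds hκ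
        refine (runs_fwdLevelP (hE₀.congr fun a ha => hF'.1 a (by revert a; decide)) hk
          (by omega) hc hl (by omega) (hC.length_le hκ hk1)).mono le_rfl
          fun s'' _ _ ⟨h2, h3, h4, h5, h6⟩ => ⟨⟨l + 1, k - k / 2, cnt * 2 ^ (k / 2 + 1),
            .step (hC.congr fun i hi => ?_) hk1 h2 ?_, h6, h5, h4⟩, ?_⟩
        · rw [h3, if_neg (by omega)]
        · rw [h3, if_pos rfl]
        · rw [h6, hk]; omega
      · exact ⟨0, κ, 1, F₀ ▸ .start, k₀, c₀, l₀⟩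
      · obtain ⟨⟨l, k, cnt, hC, hk, hc, hl⟩, hb⟩ := h
        have hk1 : ¬ 1 < k := by simpa [Test.holds, hk] using hb
        obtain ⟨b1, b2, b3, b4⟩ := hC.bounds hκ
        obtain rfl : k = 1 := by omega
        exact ⟨l, cnt, hC, hk, hc, hl⟩
    obtain ⟨l, cnt, hC, hk, hc, hl⟩ := h₁
    have hE₁ : Env κ M L X s₁ := hE₀.congr fun a ha => hF₁.1 a (by revert a; decide)
    have hn := hC.length_le' hκ
    rw [pow_one] at hn
    refine ((runs_fill (n := cnt * 2) (F := baseStage M cnt (s₁.word w_F)) (by decide)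
      cost_baseE (by decide) (fun s₂ h => ?_) (fun t ht s₂ h hv => ?_)
      (fun _ t _ => (Nat.mod_lt _ (by omega)).trans hMX) (fun _ => by omega)).mono
      (Nat.mul_le_mul_right _ (by omega)) fun _ _ _ h => h).seq fun s₂ hs₂ hF₂ h₂ => ?_
    · simp [h w_cnt (by decide) (by decide), hc]
    · have hC₂ : s₂.word w_F = s₁.word w_F := by
        funext i
        rw [h w_F (by decide) (by decide)]
      rw [← hv, ← hC₂]
      exact val_baseE (by rw [h w_cnt (by decide) (by decide), hc])
        (by rw [h w_M (by decide) (by decide), hE₁.M_eq]) (by omega)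
    have hE₂ : Env κ M L X s₂ := hE₁.congr fun a ha => hF₂.1 a (by revert a; decide)
    have st₂ : s₂.word w_stack = s₁.word w_stack := by
      funext i; rw [hF₂.1 _ (by decide)]
    have l₂ : s₂.word w_l 0 = l := by rw [hF₂.1 _ (by decide), hl]
    have hlκ : l ≤ κ := by have := hC.bounds hκ; omega
    refine (runs_while (t := (κ + 5) * (L * 20000)) (b := .wordLT 0 (var w_l)) (by decide)
      (fun s' => ∃ l k cnt f e,
      Chain M κ (s.word w_F) (s'.word w_stack) l k cnt f ∧
      s'.word w_cnt 0 = cnt ∧ s'.word w_l 0 = l ∧ BlockProd M (2 ^ k) cnt e f (s'.word w_C) ∧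
      ∀ i < cnt * 2 ^ k, s'.word w_C i < M) (fun s' => s'.word w_l 0)
      (fun s' _ => ⟨by simp, by simp⟩) (fun s' hs' hF' hI hb => ?_) ?_).mono
      (Nat.mul_le_mul_right _ (by omega)) (fun s' _ _ h => ?_)
    · obtain ⟨l, k, cnt, f, e, hC, hc, hl, hB, -⟩ := hI
      have hb : 0 < l := by simpa [Test.holds, hl] using hb
      cases hC with
      | start => omega
      | @step l k cnt f f' hC hk hf hst =>
        obtain ⟨b1, b2, b3, b4⟩ := hC.bounds hκ
        refine (runs_bwdLevelP (hE₂.congr fun a ha => hF'.1 a (by revert a; decide)) hl hst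
          (by omega) hc (hC.length_le hκ hk)).mono le_rfl
          fun s'' _ hF'' ⟨h2, h3, h4, h5, h6⟩ => ⟨⟨l, k, cnt, f, e + (k / 2 + 1), ?_, h5, h4, ?_,
            h3⟩, ?_⟩
        · exact hC.congr fun i hi => hF''.1 w_stack (by decide) i
        · have := BlockProd.level hM2 (by omega) hf h2 hB
          rwa [← pow_add, Nat.add_sub_cancel' (by omega)] at this
        · rw [hl, h4]; omega
    · refine ⟨l, 1, cnt, s₁.word w_F, 0, st₂ ▸ hC, ?_, l₂, ?_, fun i hi => ?_⟩
      · rw [hF₂.1 _ (by decide), hc]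
      · exact blockProd_base hM2 fun t ht => by rw [h₂, if_pos ht]
      · rw [pow_one] at hi
        rw [h₂, if_pos hi]
        exact Nat.mod_lt _ (by omega)
    · obtain ⟨⟨l, k, cnt, f, e, hC, hc, hl, hB, hlt⟩, hb⟩ := h
      have hb : ¬ 0 < l := by simpa [Test.holds, hl] using hb
      cases hC with
      | start => exact ⟨e, hB, fun i hi => hlt i (by omega)⟩
      | step => omega
  · have hκ1 : 2 ^ κ * κ ^ 3 = κ ^ 2 * (κ * 2 ^ κ) := by ring
    have e1 : L = 8 * (κ * 2 ^ κ) := by rw [hL]; ring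
    have e2 : 1 ≤ κ * 2 ^ κ := Nat.mul_pos (by omega) (by positivity)
    rw [e1, hκ1]
    generalize κ * 2 ^ κ = w at e2
    have e3 : (κ + 1) * ((κ + 5) * (8 * w * 20000) + 1001) =
        (κ + 1) * (κ + 5) * (w * 160000) + (κ + 1) * 1001 := by ring
    have e4 : (κ + 1) * (κ + 5) * (w * 160000) ≤ 12 * κ ^ 2 * (w * 160000) :=
      Nat.mul_le_mul_right _ (by nlinarith)
    have e5 : κ ≤ κ ^ 2 := Nat.le_self_pow (by norm_num) κ
    have e6 : κ ^ 2 * 1 ≤ κ ^ 2 * w := Nat.mul_le_mul_left _ e2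
    have e7 : 1 * w ≤ κ ^ 2 * w := Nat.mul_le_mul_right _ (by omega)
    have e8 : 12 * κ ^ 2 * (w * 160000) = κ ^ 2 * w * 1920000 := by ring
    rw [e3]
    omega
  · obtain ⟨e, hB, hlt⟩ := h
    exact hB.ne_zero_iff hNM hodd (by positivity) hlt hF h1 h1' hx

end Conv
end RAM

/-! ### Sorting -/

namespace RAM

-- The names of the word arrays: `perm` is the sorted order, and `min` holds the minima of the blocks.
local notation "w_n" => (0 : ℕ)
local notation "w_tau" => (2 : ℕ)
local notation "w_perm" => (30 : ℕ)
local notation "w_used" => (31 : ℕ)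
local notation "w_min" => (32 : ℕ)
local notation "w_b" => (33 : ℕ)
local notation "w_u" => (34 : ℕ)
local notation "w_j" => (35 : ℕ)
local notation "w_best" => (36 : ℕ)
local notation "w_x" => (37 : ℕ)

namespace Sorting
open WordExpr

/-- `w` encodes the position of a minimum of `A` on the set `S`: it is that position plus one, or zero
if `S` is empty. -/
def IsArgmin (A : ℕ → ℝ≥0∞) (S : ℕ → Prop) (w : ℕ) : Prop :=
  (w = 0 → ∀ x, ¬ S x) ∧ (w ≠ 0 → S (w - 1) ∧ ∀ x, S x → A (w - 1) ≤ A x)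

theorem IsArgmin.congr {A : ℕ → ℝ≥0∞} {S S' : ℕ → Prop} {w : ℕ} (h : IsArgmin A S w)
    (hS : ∀ x, S' x ↔ S x) : IsArgmin A S' w := by
  rwa [show S' = S from funext fun x => propext (hS x)]

/-- The set grows by a set with the minimum `v`, which is smaller. -/
theorem IsArgmin.replace {A : ℕ → ℝ≥0∞} {S S' S'' : ℕ → Prop} {w v : ℕ} (h : IsArgmin A S w)
    (h' : IsArgmin A S' v) (hv : v ≠ 0) (hS : ∀ x, S'' x ↔ S x ∨ S' x)
    (hlt : w = 0 ∨ A (v - 1) ≤ A (w - 1)) : IsArgmin A S'' v := by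
  refine ⟨fun h0 => absurd h0 hv, fun _ => ⟨(hS _).2 (Or.inr (h'.2 hv).1), fun x hx => ?_⟩⟩
  rcases (hS x).1 hx with hx | hx
  · rcases eq_or_ne w 0 with h0 | h0
    · exact absurd hx (h.1 h0 x)
    · exact (hlt.resolve_left h0).trans ((h.2 h0).2 x hx)
  · exact (h'.2 hv).2 x hx

/-- The set grows by a set with the minimum `v`, which is not smaller. -/
theorem IsArgmin.keep {A : ℕ → ℝ≥0∞} {S S' S'' : ℕ → Prop} {w v : ℕ} (h : IsArgmin A S w)
    (h' : IsArgmin A S' v) (hS : ∀ x, S'' x ↔ S x ∨ S' x)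
    (hlt : v = 0 ∨ w ≠ 0 ∧ A (w - 1) ≤ A (v - 1)) : IsArgmin A S'' w := by
  rcases eq_or_ne v 0 with h0 | h0
  · exact h.congr fun x => (hS x).trans ⟨fun hx => hx.resolve_right (h'.1 h0 x), Or.inl⟩
  · obtain ⟨hw, hle⟩ := hlt.resolve_left h0
    refine ⟨fun h1 => absurd h1 hw, fun _ => ⟨(hS _).2 (Or.inl (h.2 hw).1), fun x hx => ?_⟩⟩
    rcases (hS x).1 hx with hx | hx
    · exact (h.2 hw).2 x hx
    · exact hle.trans ((h'.2 h0).2 x hx)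

theorem isArgmin_single (A : ℕ → ℝ≥0∞) (x : ℕ) : IsArgmin A (· = x) (x + 1) :=
  ⟨fun h => by omega, fun _ => ⟨rfl, fun y hy => by rw [hy]; rfl⟩⟩

/-- Finds the smallest unused entry in the block `b`. -/
def blockMinP : Program :=
  .setWord w_min (var w_b) 0 ;;
  .forLoop w_u (var w_tau)
    (.setVar w_x (var w_b * var w_tau + var w_u) ;;
     .ite (.and (.wordLT (var w_x) (var w_n)) (.and (.wordLT (.get w_used (var w_x)) 1)
        (.not (.and (.wordLT 0 (.get w_min (var w_b)))
          (.weightLE (.get 0 (.get w_min (var w_b) - 1)) (.get 0 (var w_x)))))))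
      (.setWord w_min (var w_b) (var w_x + 1)) .skip)

/-- Finds the smallest unused entry. -/
def selectP : Program :=
  .setVar w_best 0 ;;
  .forLoop w_b (var w_n / var w_tau + 1)
    (.ite (.and (.wordLT 0 (.get w_min (var w_b)))
        (.not (.and (.wordLT 0 (var w_best))
          (.weightLE (.get 0 (var w_best - 1)) (.get 0 (.get w_min (var w_b) - 1))))))
      (.setVar w_best (.get w_min (var w_b))) .skip)

/-- Selection sort, with the minima of blocks of length `τ` as an index. -/
def sortP : Program :=
  .forLoop w_u (var w_n) (.setWord w_used (var w_u) 0) ;;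
  .forLoop w_b (var w_n / var w_tau + 1) blockMinP ;;
  .forLoop w_j (var w_n)
    (selectP ;;
     .setWord w_perm (var w_j) (var w_best - 1) ;;
     .setWord w_used (var w_best - 1) 1 ;;
     .setVar w_b ((var w_best - 1) / var w_tau) ;;
     blockMinP)

theorem sortP_writes : (∀ a ∈ sortP.wordWrites, 30 ≤ a ∧ a ≤ 37) ∧ sortP.weightWrites = [] := by
  decide

/-- `P` lists the positions `0, …, n - 1` in the order of the values of `A`. -/
structure SortedBy (n : ℕ) (A : ℕ → ℝ≥0∞) (P : ℕ → ℕ) : Prop where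
  lt : ∀ i < n, P i < n
  surj : ∀ x < n, ∃ i < n, P i = x
  mono : ∀ i j, i ≤ j → j < n → A (P i) ≤ A (P j)

variable {X : ℕ} {s : State}

theorem runs_blockMinP {n τ b : ℕ} (hn : s.word w_n 0 = n) (hτ : s.word w_tau 0 = τ)
    (hτ0 : 0 < τ) (hb : s.word w_b 0 = b) (hbX : b * τ + τ + 1 < X) :
    Runs X blockMinP s ((τ + 4) * 10000) (fun s' =>
      IsArgmin (s.weight 0) (fun x => x < n ∧ s.word w_used x = 0 ∧ x / τ = b) (s'.word w_min b) ∧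
      ∀ b', b' ≠ b → s'.word w_min b' = s.word w_min b') := by
  refine Runs.of_small fun hs => ?_
  refine Runs.mono (t₁ := 2001 + (τ + 2) * (1002 + (2001 + 1001) + 2003)) ?_ (by omega)
    (fun _ _ _ h => h)
  refine runs_setWord_seq (by decide) (by simp) (by simp) (fun h => by
    have := h.1; rw [val_ofNat]; omega) ?_
  refine (runs_for (n := τ) (fun u s' =>
    IsArgmin (s.weight 0) (fun x => x < n ∧ s.word w_used x = 0 ∧ b * τ ≤ x ∧ x < b * τ + u)
      (s'.word w_min b) ∧ ∀ b', b' ≠ b → s'.word w_min b' = s.word w_min b') (by decide)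
    (by decide) (fun u s' hF _ => ?_) (fun u s' hu hs' hF hI hv => ?_) ?_ ?_).mono le_rfl
    (fun s' _ hF h => ?_)
  · simp [hF.1 w_tau (by decide), hτ]
  · obtain ⟨h1, h2⟩ := hI
    have qn := hF.1 w_n (by decide) 0
    have qτ := hF.1 w_tau (by decide) 0
    have qb := hF.1 w_b (by decide) 0
    have qu := hF.1 w_used (by decide)
    have qA := hF.2 0 (by decide)
    simp only [State.word_setWord, State.weight_setWord] at qn qτ qb qu qA
    norm_num at qn qτ qb qu
    rw [hn] at qn
    rw [hτ] at qτ
    rw [hb] at qb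
    have hS : ∀ x, (x < n ∧ s.word w_used x = 0 ∧ b * τ ≤ x ∧ x < b * τ + (u + 1)) ↔
        (x < n ∧ s.word w_used x = 0 ∧ b * τ ≤ x ∧ x < b * τ + u) ∨
          (x = b * τ + u ∧ x < n ∧ s.word w_used x = 0) := fun x => by
      constructor
      · rintro ⟨h1, h2, h3, h4⟩
        rcases Nat.lt_or_ge x (b * τ + u) with h5 | h5
        · exact Or.inl ⟨h1, h2, h3, h5⟩
        · exact Or.inr ⟨by omega, h1, h2⟩
      · rintro (⟨h1, h2, h3, h4⟩ | ⟨h1, h2, h3⟩)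
        · exact ⟨h1, h2, h3, by omega⟩
        · exact ⟨h2, h3, by omega, by omega⟩
    refine runs_setVar_seq (by decide) (by simp) (fun h => by simp [qb, qτ, hv]; omega) ?_
    refine runs_ite (by decide) (by simp [Test.safe, WeightExpr.safe]) (fun hc => ?_)
      (fun hc => ?_)
    · refine runs_setWord (by decide) (by simp) (by simp)
        (fun h => by simp [qb, qτ, hv]; omega) ?_
      simp [Test.holds, WeightExpr.val, qn, qb, qτ, qu, qA, hv] at hc ⊢
      obtain ⟨c1, c2, c3⟩ := hc
      refine ⟨h1.replace (isArgmin_single _ (b * τ + u)) (by omega) (fun x => (hS x).trans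
        (or_congr_right ⟨fun h => h.1, fun h => ⟨h, h ▸ c1, h ▸ c2⟩⟩)) ?_, fun b' hb' => ?_⟩
      · rcases Nat.eq_zero_or_pos (s'.word w_min b) with h | h
        · exact Or.inl h
        · exact Or.inr (c3 h).le
      · simp [hb', h2 b' hb']
    · refine (runs_skip ?_).mono (by norm_num) fun _ _ _ h => h
      simp [Test.holds, WeightExpr.val, qn, qb, qτ, qu, qA, hv] at hc ⊢
      refine ⟨?_, h2⟩
      by_cases hc1 : b * τ + u < n ∧ s.word w_used (b * τ + u) = 0
      · obtain ⟨c3, c4⟩ := hc hc1.1 hc1.2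
        exact h1.keep (isArgmin_single _ (b * τ + u)) (fun x => (hS x).trans
          (or_congr_right ⟨fun h => h.1, fun h => ⟨h, h ▸ hc1.1, h ▸ hc1.2⟩⟩))
          (Or.inr ⟨c3.ne', c4⟩)
      · refine h1.congr fun x => (hS x).trans ⟨fun h => h.resolve_right ?_, Or.inl⟩
        rintro ⟨rfl, h3, h4⟩
        exact hc1 ⟨h3, h4⟩
  · simp [hb, IsArgmin]
    exact fun b' h h' => absurd h' h
  · intro _; omega
  · refine ⟨h.1.congr fun x => ?_, h.2⟩
    rw [Nat.div_eq_iff hτ0]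
    constructor
    · rintro ⟨h1, h2, h3, h4⟩
      exact ⟨h1, h2, by omega, by omega⟩
    · rintro ⟨h1, h2, h3, h4⟩
      exact ⟨h1, h2, by omega, by omega⟩

theorem runs_selectP {n τ : ℕ} (hn : s.word w_n 0 = n) (hτ : s.word w_tau 0 = τ)
    (hτ0 : 0 < τ) (hX : n + 1 < X)
    (hmin : ∀ b < n / τ + 1, IsArgmin (s.weight 0)
      (fun x => x < n ∧ s.word w_used x = 0 ∧ x / τ = b) (s.word w_min b)) :
    Runs X selectP s ((n / τ + 4) * 10000) (fun s' =>
      IsArgmin (s.weight 0) (fun x => x < n ∧ s.word w_used x = 0) (s'.word w_best 0)) := by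
  have hdiv := Nat.div_le_self n τ
  refine Runs.of_small fun hs => ?_
  refine Runs.mono (t₁ := 1002 + (n / τ + 1 + 2) * ((1002 + 1001) + 2003)) ?_ (by omega)
    (fun _ _ _ h => h)
  refine runs_setVar_seq (by decide) (by simp) (fun h => by
    have := h.1; rw [val_ofNat]; omega) ?_
  refine (runs_for (n := n / τ + 1) (fun b s' =>
    IsArgmin (s.weight 0) (fun x => x < n ∧ s.word w_used x = 0 ∧ x / τ < b)
      (s'.word w_best 0)) (by decide)
    (by decide) (fun u s' hF _ => ?_) (fun b s' hb hs' hF hI hv => ?_) ?_ ?_).mono le_rfl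
    (fun s' _ hF h => ?_)
  · simp [hF.1 w_tau (by decide), hF.1 w_n (by decide), hn, hτ, hτ0.ne']
  · have qm := hF.1 w_min (by decide)
    have qA := hF.2 0 (by decide)
    simp only [State.word_setWord, State.weight_setWord] at qm qA
    norm_num at qm
    have hS : ∀ x, (x < n ∧ s.word w_used x = 0 ∧ x / τ ≤ b) ↔
        (x < n ∧ s.word w_used x = 0 ∧ x / τ < b) ∨
          (x < n ∧ s.word w_used x = 0 ∧ x / τ = b) := fun x => by
      rw [Nat.le_iff_lt_or_eq]; tauto
    refine runs_ite (by decide) (by simp [Test.safe, WeightExpr.safe]) (fun hc => ?_)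
      (fun hc => ?_)
    · refine runs_setVar (by decide) (by simp) (fun h => h.2 _ _) ?_
      simp [Test.holds, WeightExpr.val, qm, qA, hv] at hc ⊢
      refine hI.replace (hmin b hb) hc.1.ne' hS ?_
      rcases Nat.eq_zero_or_pos (s'.word w_best 0) with h | h
      · exact Or.inl h
      · exact Or.inr (hc.2 h).le
    · refine (runs_skip ?_).mono (by norm_num) fun _ _ _ h => h
      simp [Test.holds, WeightExpr.val, qm, qA, hv] at hc ⊢
      refine hI.keep (hmin b hb) hS ?_
      rcases Nat.eq_zero_or_pos (s.word w_min b) with h | h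
      · exact Or.inl h
      · exact Or.inr ⟨(hc h).1.ne', (hc h).2⟩
  · simp [IsArgmin]
  · intro _; omega
  · refine h.congr fun x => ⟨fun h => ⟨h.1, h.2, ?_⟩, fun h => ⟨h.1, h.2.1⟩⟩
    exact Nat.lt_succ_of_le (Nat.div_le_div_right h.1.le)

theorem runs_sortP {n τ : ℕ} (hn : s.word w_n 0 = n) (hτ : s.word w_tau 0 = τ)
    (hτ0 : 0 < τ) (hnτ : n ≤ τ * τ) (hX : n + 2 * τ + 2 < X) (hn0 : 0 < n) :
    Runs X sortP s (n * τ * 10 ^ 6) (fun s' => SortedBy n (s.weight 0) (s'.word w_perm)) := by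
  have hdiv : n / τ ≤ τ := Nat.div_le_of_le_mul hnτ
  have hdiv' := Nat.div_le_self n τ
  have hdm := Nat.div_mul_le_self n τ
  have hbX : ∀ b < n / τ + 1, b * τ + τ + 1 < X := fun b hb => by
    have : b * τ ≤ n / τ * τ := Nat.mul_le_mul_right _ (by omega)
    omega
  refine Runs.mono (t₁ := (n + 2) * 5000 + ((n / τ + 1 + 2) * ((τ + 4) * 10000 + 2003) +
    (n + 2) * (((n / τ + 4) * 10000 + (2001 + (2001 + (1002 + (τ + 4) * 10000)))) + 2003))) ?_ ?_
    (fun _ _ _ h => h)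
  swap
  · generalize n / τ = w at *
    have h1 : (w + 1 + 2) * ((τ + 4) * 10000 + 2003) ≤ (n + 3) * (τ * 60000) :=
      Nat.mul_le_mul (by linarith) (by linarith)
    have h2 : (n + 2) * ((w + 4) * 10000 + (2001 + (2001 + (1002 + (τ + 4) * 10000))) + 2003)
      ≤ (n + 2) * (τ * 120000) := Nat.mul_le_mul_left _ (by linarith)
    have h3 : 1 * τ ≤ n * τ := Nat.mul_le_mul_right _ hn0
    have h4 : n * 1 ≤ n * τ := Nat.mul_le_mul_left _ hτ0
    linarith
  refine (runs_fill (n := n) (F := fun _ => 0) (by decide) (by decide) (by decide)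
    (fun s' h => ?_) (fun t _ s' h _ => by simp) (fun h t _ => by have := h.1; omega)
    (fun _ => by omega)).seq fun s₁ hs₁ hF₁ h₁ => ?_
  · simp [h w_n (by decide) (by decide), hn]
  have n₁ : s₁.word w_n 0 = n := by rw [hF₁.1 _ (by decide), hn]
  have τ₁ : s₁.word w_tau 0 = τ := by rw [hF₁.1 _ (by decide), hτ]
  have A₁ : s₁.weight 0 = s.weight 0 := by funext i; rw [hF₁.2 _ (by decide)]
  have u₁ : ∀ x < n, s₁.word w_used x = 0 := fun x hx => by rw [h₁, if_pos hx]
  refine (runs_for (n := n / τ + 1) (t := (τ + 4) * 10000) (fun b s' => ∀ b' < b,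
    IsArgmin (s.weight 0) (fun x => x < n ∧ s₁.word w_used x = 0 ∧ x / τ = b') (s'.word w_min b'))
    (by decide) (by decide) (fun u s' hF _ => ?_) (fun b s' hb hs' hF hI hv => ?_) ?_ ?_).seq
    (fun s₂ hs₂ hF₂ h₂ => ?_)
  · simp [hF.1 w_tau (by decide), hF.1 w_n (by decide), n₁, τ₁, hτ0.ne']
  · refine (runs_blockMinP (by rw [hF.1 w_n (by decide), n₁]) (by rw [hF.1 w_tau (by decide), τ₁])
      hτ0 hv (hbX b hb)).mono le_rfl fun s'' _ _ h b' hb' => ?_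
    have e1 : s'.weight 0 = s.weight 0 := by funext i; rw [hF.2 _ (by decide), A₁]
    have e2 : s'.word w_used = s₁.word w_used := by funext i; rw [hF.1 _ (by decide)]
    rw [e1, e2] at h
    simp only [State.word_setWord, Nat.reduceEqDiff, false_and, if_false]
    rcases Nat.lt_succ_iff_lt_or_eq.1 hb' with h3 | rfl
    · rw [h.2 b' h3.ne]
      exact hI b' h3
    · exact h.1
  · intro b' hb'; omega
  · intro _; omega
  have n₂ : s₂.word w_n 0 = n := by rw [hF₂.1 _ (by decide), n₁]
  have τ₂ : s₂.word w_tau 0 = τ := by rw [hF₂.1 _ (by decide), τ₁]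
  have A₂ : s₂.weight 0 = s.weight 0 := by funext i; rw [hF₂.2 _ (by decide), A₁]
  have u₂ : s₂.word w_used = s₁.word w_used := by funext i; rw [hF₂.1 _ (by decide)]
  have hmem : ∀ x < n, x / τ < n / τ + 1 := fun x hx =>
    Nat.lt_succ_of_le (Nat.div_le_div_right hx.le)
  refine (runs_for (n := n) (fun j s' =>
    (∀ b' < n / τ + 1, IsArgmin (s.weight 0) (fun x => x < n ∧ s'.word w_used x = 0 ∧ x / τ = b')
      (s'.word w_min b')) ∧
    (∀ x < n, s'.word w_used x ≠ 0 ↔ ∃ i < j, s'.word w_perm i = x) ∧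
    (∀ i < j, s'.word w_perm i < n) ∧
    (∀ i i', i < i' → i' < j → s'.word w_perm i ≠ s'.word w_perm i' ∧
      s.weight 0 (s'.word w_perm i) ≤ s.weight 0 (s'.word w_perm i')) ∧
    (∀ i < j, ∀ x < n, s'.word w_used x = 0 → s.weight 0 (s'.word w_perm i) ≤ s.weight 0 x))
    (by decide) (by decide) (fun u s' hF _ => ?_) (fun j s' hj hs' hF hI hv => ?_) ?_ ?_).mono
    le_rfl (fun s' _ hF h => ?_)
  · simp [hF.1 w_n (by decide), n₂]
  · obtain ⟨i1, i2, i3, i4, i5⟩ := hI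
    have n₃ : s'.word w_n 0 = n := by rw [hF.1 _ (by decide), n₂]
    have τ₃ : s'.word w_tau 0 = τ := by rw [hF.1 _ (by decide), τ₂]
    have A₃ : s'.weight 0 = s.weight 0 := by funext i; rw [hF.2 _ (by decide), A₂]
    refine (runs_selectP n₃ τ₃ hτ0 (by omega) (by rw [A₃]; exact i1)).seq fun s₄ hs₄ hF₄ h₄ => ?_
    rw [A₃] at h₄
    have n₄ : s₄.word w_n 0 = n := by rw [hF₄.1 _ (by decide), n₃]
    have τ₄ : s₄.word w_tau 0 = τ := by rw [hF₄.1 _ (by decide), τ₃]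
    have A₄ : s₄.weight 0 = s.weight 0 := by funext i; rw [hF₄.2 _ (by decide), A₃]
    have j₄ : s₄.word w_j 0 = j := by rw [hF₄.1 _ (by decide), hv]
    have m₄ : s₄.word w_min = s'.word w_min := by funext i; rw [hF₄.1 _ (by decide)]
    have u₄ : s₄.word w_used = s'.word w_used := by funext i; rw [hF₄.1 _ (by decide)]
    have p₄ : s₄.word w_perm = s'.word w_perm := by funext i; rw [hF₄.1 _ (by decide)]
    -- only `j < n` positions are used
    obtain ⟨x₀, hx₀, hx₀'⟩ : ∃ x < n, s'.word w_used x = 0 := by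
      by_contra hcon
      push Not at hcon
      have hsub : Finset.range n ⊆ (Finset.range j).image (s'.word w_perm) := fun x hx => by
        obtain ⟨i, hi, hix⟩ := (i2 x (Finset.mem_range.1 hx)).1 (hcon x (Finset.mem_range.1 hx))
        exact Finset.mem_image.2 ⟨i, Finset.mem_range.2 hi, hix⟩
      have := (Finset.card_le_card hsub).trans Finset.card_image_le
      rw [Finset.card_range, Finset.card_range] at this
      omega
    have hbest : s₄.word w_best 0 ≠ 0 := fun h0 => h₄.1 h0 x₀ ⟨hx₀, hx₀'⟩
    obtain ⟨⟨y1, y2⟩, y3⟩ := h₄.2 hbest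
    set y := s₄.word w_best 0 - 1 with hy
    refine runs_setWord_seq (by decide) (by simp) (by simp) (fun h => by simp; omega) ?_
    refine runs_setWord_seq (by decide) (by simp) (by simp) (fun h => by
      have := h.1; rw [val_ofNat]; omega) ?_
    refine runs_setVar_seq (by decide) (by simp [τ₄, hτ0.ne']) (fun h => ?_) ?_
    · have := Nat.div_le_self y τ
      simp [τ₄, ← hy]; omega
    refine (runs_blockMinP (n := n) (τ := τ) (b := y / τ) (by simp [n₄]) (by simp [τ₄]) hτ0
      (by simp [τ₄, hy]) (hbX _ (hmem y y1))).mono le_rfl fun s₅ _ hF₅ h₅ => ?_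
    have u₅ := hF₅.1 w_used (by decide)
    have p₅ := hF₅.1 w_perm (by decide)
    simp [j₄, u₄, p₄, m₄, A₄, ← hy] at h₅ u₅ p₅
    simp only [State.word_setWord, Nat.reduceEqDiff, false_and, if_false]
    have used_y : ∀ x, s₅.word w_used x = 0 ↔ x ≠ y ∧ s'.word w_used x = 0 := fun x => by
      rw [u₅]
      split_ifs with h
      · simp [h]
      · simp [h]
    have perm_lt : ∀ i < j, s₅.word w_perm i = s'.word w_perm i := fun i hi => by
      rw [p₅, if_neg hi.ne]
    have perm_j : s₅.word w_perm j = y := by rw [p₅, if_pos rfl]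
    refine ⟨fun b' hb' => ?_, fun x hx => ?_, fun i hi => ?_, fun i i' hi hi' => ?_,
      fun i hi x hx hux => ?_⟩
    · rcases eq_or_ne b' (y / τ) with rfl | hne
      · refine h₅.1.congr fun x => ?_
        rw [← u₅]
      · rw [h₅.2 b' hne]
        refine (i1 b' (by omega)).congr fun x => ?_
        rw [used_y]
        constructor
        · tauto
        · rintro ⟨h1, h2, h3⟩
          exact ⟨h1, ⟨fun h => hne (h ▸ h3.symm), h2⟩, h3⟩
    · rw [ne_eq, used_y, not_and_or, not_not, ← ne_eq, i2 x hx]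
      constructor
      · rintro (rfl | ⟨i, hi, hix⟩)
        · exact ⟨j, by omega, perm_j⟩
        · exact ⟨i, by omega, (perm_lt i hi).trans hix⟩
      · rintro ⟨i, hi, hix⟩
        rcases Nat.lt_succ_iff_lt_or_eq.1 hi with h | rfl
        · exact Or.inr ⟨i, h, (perm_lt i h).symm.trans hix⟩
        · exact Or.inl (hix.symm.trans perm_j)
    · rcases Nat.lt_succ_iff_lt_or_eq.1 hi with h | rfl
      · rw [perm_lt i h]; exact i3 i h
      · rw [perm_j]; exact y1
    · rcases Nat.lt_succ_iff_lt_or_eq.1 hi' with h | rfl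
      · rw [perm_lt i (by omega), perm_lt i' h]; exact i4 i i' hi h
      · rw [perm_lt i hi, perm_j]
        exact ⟨fun h => (i2 y y1).2 ⟨i, hi, h⟩ y2, i5 i hi y y1 y2⟩
    · obtain ⟨hne, hux⟩ := (used_y x).1 hux
      rcases Nat.lt_succ_iff_lt_or_eq.1 hi with h | rfl
      · rw [perm_lt i h]; exact i5 i h x hx hux
      · rw [perm_j]; exact y3 x ⟨hx, hux⟩
  · simp only [State.word_setWord, Nat.reduceEqDiff, false_and, if_false]
    rw [u₂]
    exact ⟨h₂, fun x hx => ⟨fun h => absurd (u₁ x hx) h, fun ⟨i, hi, _⟩ => absurd hi (by omega)⟩,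
      fun i hi => absurd hi (by omega), fun i i' _ hi => absurd hi (by omega),
      fun i hi => absurd hi (by omega)⟩
  · intro _; omega
  · obtain ⟨-, -, i3, i4, -⟩ := h
    refine ⟨i3, fun x hx => ?_, fun i j hij hj => ?_⟩
    · have hinj : Function.Injective (fun i : Fin n => (⟨s'.word w_perm i, i3 i i.2⟩ : Fin n)) := by
        intro a b hab
        have hab : s'.word w_perm a = s'.word w_perm b := congrArg Fin.val hab
        by_contra hne
        rcases lt_or_gt_of_ne (fun h => hne (Fin.ext h) : (a : ℕ) ≠ b) with h | h
        · exact (i4 a b h b.2).1 hab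
        · exact (i4 b a h a.2).1 hab.symm
      obtain ⟨i, hi⟩ := (Finite.injective_iff_surjective.1 hinj) ⟨x, hx⟩
      exact ⟨i, i.2, congrArg Fin.val hi⟩
    · rcases hij.lt_or_eq with h | rfl
      · exact (i4 i j h hj).2
      · exact le_rfl

end Sorting
end RAM

/-! ### Rounding and marking -/

namespace RAM

-- The names of the word arrays (`w_`) and of the weight arrays (`x_`). The groups are the position ranges
-- between consecutive entries of `start`; `p`, `e` are the ends of the current group, `g` is its number,
-- and `fin` is the number of finite entries of `A`.
local notation "w_n" => (0 : ℕ)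
local notation "w_E" => (1 : ℕ)
local notation "w_tau" => (2 : ℕ)
local notation "w_N" => (3 : ℕ)
local notation "w_logN" => (4 : ℕ)
local notation "w_M" => (5 : ℕ)
local notation "w_F" => (10 : ℕ)
local notation "w_C" => (12 : ℕ)
local notation "w_perm" => (30 : ℕ)
local notation "w_p" => (40 : ℕ)
local notation "w_e" => (41 : ℕ)
local notation "w_g" => (42 : ℕ)
local notation "w_start" => (43 : ℕ)
local notation "w_first" => (44 : ℕ)
local notation "w_i" => (45 : ℕ)
local notation "w_code" => (46 : ℕ)
local notation "w_y" => (47 : ℕ)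
local notation "w_fin" => (48 : ℕ)
local notation "w_v" => (49 : ℕ)
local notation "x_A" => (0 : ℕ)
local notation "x_B" => (1 : ℕ)
local notation "x_D" => (3 : ℕ)
local notation "x_lo" => (5 : ℕ)
local notation "x_hi" => (6 : ℕ)
local notation "w_pow" => (6 : ℕ)
local notation "x_eps" => (2 : ℕ)
local notation "x_tmp" => (4 : ℕ)

namespace Group
open WordExpr Conv Sorting

/-- The parameters of the algorithm, as stored in memory: the resolution `E` of the rounding, the size
`τ` of the groups, and the length `2 ^ κ` of the convolutions. -/
structure Setup (n τ E κ X : ℕ) (s : State) : Prop where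
  n_eq : s.word w_n 0 = n
  E_eq : s.word w_E 0 = E
  tau_eq : s.word w_tau 0 = τ
  N_eq : s.word w_N 0 = 2 ^ κ
  log_eq : s.word w_logN 0 = κ
  M_eq : s.word w_M 0 = 2 * 2 ^ κ + 1
  pow : PowTable κ s
  n_pos : 0 < n
  E_pos : 0 < E
  tau_pos : 0 < τ
  log_pos : 1 ≤ κ
  le_N : 4 * n * (2 * E + 1) ≤ 2 ^ κ
  le_sq : n * E ≤ τ * τ
  tau_le : τ ≤ n * E
  lt_X : 8 * κ * 2 ^ κ < X

theorem Setup.congr {n τ E κ X : ℕ} {s s' : State} (h : Setup n τ E κ X s)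
    (hF : ∀ a < 10, ∀ i, s'.word a i = s.word a i) : Setup n τ E κ X s' where
  n_eq := by rw [hF _ (by norm_num), h.n_eq]
  E_eq := by rw [hF _ (by norm_num), h.E_eq]
  tau_eq := by rw [hF _ (by norm_num), h.tau_eq]
  N_eq := by rw [hF _ (by norm_num), h.N_eq]
  log_eq := by rw [hF _ (by norm_num), h.log_eq]
  M_eq := by rw [hF _ (by norm_num), h.M_eq]
  pow := fun i hi => by rw [hF _ (by norm_num)]; exact h.pow i hi
  n_pos := h.n_pos
  E_pos := h.E_pos
  tau_pos := h.tau_pos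
  log_pos := h.log_pos
  le_N := h.le_N
  le_sq := h.le_sq
  tau_le := h.tau_le
  lt_X := h.lt_X

/-- All numbers that occur are small in comparison with the bound for words. -/
theorem Setup.bounds {n τ E κ X : ℕ} {s : State} (h : Setup n τ E κ X s) :
    4 * n * (2 * E + 1) ≤ 2 ^ κ ∧ 8 * n * E + 4 * n ≤ 2 ^ κ ∧ 8 * n ≤ 2 ^ κ ∧ 8 * E ≤ 2 ^ κ ∧
      8 * τ ≤ 2 ^ κ ∧ 8 * 2 ^ κ < X := by
  have h1 := h.le_N
  have h2 := h.tau_le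
  have h3 : 1 * E ≤ n * E := Nat.mul_le_mul_right _ h.n_pos
  have h4 : n * 1 ≤ n * E := Nat.mul_le_mul_left _ h.E_pos
  have h5 : 4 * n * (2 * E + 1) = 8 * (n * E) + 4 * n := by ring
  have h6 : 8 * n * E = 8 * (n * E) := by ring
  have h7 : 8 * 1 * 2 ^ κ ≤ 8 * κ * 2 ^ κ :=
    Nat.mul_le_mul_right _ (Nat.mul_le_mul_left _ h.log_pos)
  have h8 := h.lt_X
  refine ⟨h1, ?_, ?_, ?_, ?_, ?_⟩ <;> omega

open Classical in
/-- The weight `y`, rounded down to a multiple of `v / E` and capped at `2 v`. -/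
noncomputable def code (v : ℝ≥0∞) (E : ℕ) (y : ℝ≥0∞) : ℕ :=
  Nat.findGreatest (fun w => (w : ℝ≥0∞) * v ≤ y * E) (2 * E)

theorem code_le (v : ℝ≥0∞) (E : ℕ) (y : ℝ≥0∞) : code v E y ≤ 2 * E :=
  Nat.findGreatest_le _

theorem code_mul_le (v : ℝ≥0∞) (E : ℕ) (y : ℝ≥0∞) : (code v E y : ℝ≥0∞) * v ≤ y * E := by
  classical
  exact Nat.findGreatest_spec (P := fun w : ℕ => (w : ℝ≥0∞) * v ≤ y * E) (Nat.zero_le _) (by simp)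

theorem eq_code {v : ℝ≥0∞} {E w : ℕ} {y : ℝ≥0∞} (hw : w ≤ 2 * E) (h1 : (w : ℝ≥0∞) * v ≤ y * E)
    (h2 : w < 2 * E → ¬ ((w + 1 : ℕ) : ℝ≥0∞) * v ≤ y * E) : code v E y = w := by
  classical
  refine Nat.findGreatest_eq_iff.2 ⟨hw, fun _ => h1, fun m hm hm' h => h2 (by omega) ?_⟩
  exact le_trans (mul_le_mul_left (by exact_mod_cast hm) v) h

/-- The cap `2 E` does no harm for weights below `2 v`. -/
theorem mul_le_code_succ {v : ℝ≥0∞} {E : ℕ} {y : ℝ≥0∞} (hy : y < 2 * v) :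
    y * E ≤ (code v E y + 1) * v := by
  classical
  rcases Nat.lt_or_ge (code v E y) (2 * E) with h | h
  · have := Nat.findGreatest_is_greatest (P := fun w : ℕ => (w : ℝ≥0∞) * v ≤ y * E)
      (Nat.lt_succ_self (code v E y)) h
    push_cast at this
    exact (not_le.1 this).le
  · rw [le_antisymm (code_le v E y) h]
    push_cast
    calc y * E ≤ 2 * v * E := by gcongr
      _ = 2 * E * v := by ring
      _ ≤ (2 * E + 1) * v := by gcongr; exact le_self_add

/-- Computes the rounded value of entry `y` of the weight array `a`. -/
def codeP (a : ℕ) : Program :=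
  .setVar w_code 0 ;;
  .while (.and (.wordLT (var w_code) (2 * var w_E))
      (.weightLE (.mulWord (.get x_lo 0) (var w_code + 1))
        (.mulWord (.get a (var w_y)) (var w_E))))
    (.setVar w_code (var w_code + 1))

variable {X : ℕ} {s : State}

theorem runs_codeP (a : ℕ) {E : ℕ} (hE : s.word w_E 0 = E) (hE0 : 0 < E) (hX : 2 * E + 1 < X) :
    Runs X (codeP a) s (E * 12000) (fun s' =>
      s'.word w_code 0 = code (s.weight x_lo 0) E (s.weight a (s.word w_y 0))) := by
  refine Runs.mono (t₁ := 1002 + (2 * E + 1) * (1002 + 1001)) ?_ (by omega) (fun _ _ _ h => h)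
  refine runs_setVar_seq (by decide) (by simp) (fun h => by
    have := h.1; rw [val_ofNat]; omega) ?_
  refine (runs_while (X := X) (t := 1002) (by change 22 ≤ 1000; decide)
    (fun s' => s'.word w_E 0 = E ∧ s'.word w_code 0 ≤ 2 * E ∧
      (s'.word w_code 0 : ℝ≥0∞) * s.weight x_lo 0 ≤ s.weight a (s.word w_y 0) * E)
    (fun s' => 2 * E - s'.word w_code 0) (fun s' h => ?_) (fun s' hs' hF hI hb => ?_) ?_).mono
    ?_ (fun s' _ hF h => ?_)
  · simp [Test.safe, WeightExpr.safe, h.1, hE0.ne']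
  · have q1 := hF.2 x_lo (by simp [Program.weightWrites, Program.setVar])
    have q2 := hF.2 a (by simp [Program.weightWrites, Program.setVar])
    have q3 := hF.1 w_y (by simp [Program.wordWrites, Program.setVar]) 0
    simp at q3
    simp [Test.holds, WeightExpr.val, hI.1, q1, q2, q3] at hb
    refine runs_setVar (by decide) (by simp) (fun h => by simp; omega) ?_
    simp [hI.1, mul_comm]
    refine ⟨⟨by omega, ?_⟩, by omega⟩
    rw [mul_comm, mul_comm (E : ℝ≥0∞)]; exact hb.2
  · simp [hE]
  · simp
  · obtain ⟨⟨h1, h2, h3⟩, hb⟩ := h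
    have q1 := hF.2 x_lo (by simp [Program.weightWrites, Program.setVar])
    have q2 := hF.2 a (by simp [Program.weightWrites, Program.setVar])
    have q3 := hF.1 w_y (by simp [Program.wordWrites, Program.setVar]) 0
    simp at q3
    refine (eq_code h2 h3 fun hlt hle => hb ?_).symm
    simp [Test.holds, WeightExpr.val, h1, q1, q2, q3, hlt]
    push_cast at hle
    rwa [mul_comm] at hle

/-- Marks the rounded entries of the group of positions `p, …, e - 1` in the first half of the array
`F`, and the rounded entries of `B` that are at most the largest entry of the group in the second
half. -/
def markP : Program :=
  .forLoop w_i (2 * var w_N) (.setWord w_F (var w_i) 0) ;;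
  .forLoop w_i (var w_e - var w_p)
    (.setVar w_y (.get w_perm (var w_p + var w_i)) ;;
     codeP x_A ;;
     .setWord w_F (var w_y + 2 * var w_n * var w_code) 1) ;;
  .forLoop w_i (var w_n)
    (.ite (.weightLE (.get x_B (var w_i)) (.get x_hi 0))
      (.setVar w_y (var w_i) ;;
       codeP x_B ;;
       .setWord w_F (var w_N + (var w_y + 2 * var w_n * var w_code)) 1)
      .skip)

/-- The cell in which `y` is marked. -/
noncomputable def slot (n E : ℕ) (v : ℝ≥0∞) (A : ℕ → ℝ≥0∞) (y : ℕ) : ℕ :=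
  y + 2 * n * code v E (A y)

theorem slot_lt {n E κ : ℕ} (hN : 4 * n * (2 * E + 1) ≤ 2 ^ κ) (v : ℝ≥0∞) (A : ℕ → ℝ≥0∞) {y : ℕ}
    (hy : y < n) : 2 * slot n E v A y < 2 ^ κ := by
  have h1 : 2 * n * code v E (A y) ≤ 2 * n * (2 * E) := Nat.mul_le_mul_left _ (code_le _ _ _)
  have h2 : 4 * n * (2 * E + 1) = 2 * (2 * n * (2 * E)) + 4 * n := by ring
  rw [slot]
  omega

/-- The contents of the array `F` after marking. -/
structure Marked (n E κ p e : ℕ) (lo hi : ℝ≥0∞) (A B : ℕ → ℝ≥0∞) (P F : ℕ → ℕ) : Prop where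
  le_one : ∀ x < 2 * 2 ^ κ, F x ≤ 1
  left : ∀ x < 2 ^ κ, F x ≠ 0 ↔ ∃ t, p ≤ t ∧ t < e ∧ slot n E lo A (P t) = x
  right : ∀ x < 2 ^ κ, F (2 ^ κ + x) ≠ 0 ↔ ∃ j < n, B j ≤ hi ∧ slot n E lo B j = x

theorem runs_markP {n τ E κ p e : ℕ} {lo hi : ℝ≥0∞} (hS : Setup n τ E κ X s)
    (hp : s.word w_p 0 = p) (he : s.word w_e 0 = e) (hen : e ≤ n)
    (hP : ∀ t < e, s.word w_perm t < n) (hlo : s.weight x_lo 0 = lo) (hhi : s.weight x_hi 0 = hi) :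
    Runs X markP s (2 ^ κ * 60000) (fun s' =>
      Marked n E κ p e lo hi (s.weight x_A) (s.weight x_B) (s.word w_perm) (s'.word w_F)) := by
  obtain ⟨b1, b2, b3, b4, b5, b6⟩ := hS.bounds
  have hE0 := hS.E_pos
  have hn0 := hS.n_pos
  have slt : ∀ A y, y < n → 2 * slot n E lo A y < 2 ^ κ := fun A y hy => slot_lt b1 lo A hy
  refine Runs.mono (t₁ := (2 * 2 ^ κ + 2) * 5000 + ((e - p + 2) * ((1002 + (E * 12000 + 2001)) +
    2003) + (n + 2) * ((1002 + (E * 12000 + 2001)) + 1001 + 2003))) ?_ ?_ (fun _ _ _ h => h)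
  swap
  · have h1 : (e - p + 2) * ((1002 + (E * 12000 + 2001)) + 2003) ≤ (3 * n) * (E * 18000) :=
      Nat.mul_le_mul (by omega) (by omega)
    have h2 : (n + 2) * ((1002 + (E * 12000 + 2001)) + 1001 + 2003) ≤ (3 * n) * (E * 19000) :=
      Nat.mul_le_mul (by omega) (by omega)
    linarith
  refine (runs_fill (n := 2 * 2 ^ κ) (F := fun _ => 0) (by decide) (by decide) (by decide)
    (fun s' h => ?_) (fun t _ s' h _ => by simp) (fun h t _ => by have := h.1; omega)
    (fun _ => by omega)).seq fun s₁ hs₁ hF₁ h₁ => ?_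
  · simp [h w_N (by decide) (by decide), hS.N_eq]
  have S₁ : Setup n τ E κ X s₁ := hS.congr fun a ha => hF₁.1 a (by revert a; decide)
  have p₁ : s₁.word w_p 0 = p := by rw [hF₁.1 _ (by decide), hp]
  have e₁ : s₁.word w_e 0 = e := by rw [hF₁.1 _ (by decide), he]
  have P₁ : s₁.word w_perm = s.word w_perm := by funext i; rw [hF₁.1 _ (by decide)]
  have W₁ : s₁.weight = s.weight := by funext a i; rw [hF₁.2 a (List.not_mem_nil)]
  refine (runs_for (n := e - p) (t := 1002 + (E * 12000 + 2001)) (fun i s' =>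
    (∀ x < 2 * 2 ^ κ, s'.word w_F x ≤ 1) ∧
    (∀ x < 2 ^ κ, s'.word w_F x ≠ 0 ↔ ∃ t, p ≤ t ∧ t < p + i ∧
      slot n E lo (s.weight x_A) (s.word w_perm t) = x) ∧
    (∀ x < 2 ^ κ, s'.word w_F (2 ^ κ + x) = 0)) (by decide) (by decide)
    (fun i s' hF _ => ?_) (fun i s' hi hs' hF hI hv => ?_) ?_ ?_).seq
    (fun s₂ hs₂ hF₂ h₂ => ?_)
  · simp [hF.1 w_e (by decide), hF.1 w_p (by decide), p₁, e₁]
  · obtain ⟨i1, i2, i3⟩ := hI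
    have S' : Setup n τ E κ X s' := S₁.congr fun a ha => hF.1 a (by revert a; decide)
    have p' : s'.word w_p 0 = p := by rw [hF.1 _ (by decide), p₁]
    have P' : s'.word w_perm = s.word w_perm := by funext i; rw [hF.1 _ (by decide), P₁]
    have W' : s'.weight = s.weight := by funext a i; rw [hF.2 a (by simp [Program.weightWrites,
      Program.forLoop, Program.setVar, codeP]), W₁]
    have hy := hP (p + i) (by omega)
    refine runs_setVar_seq (by decide) (by simp) (fun h => h.2 _ _) ?_
    refine (runs_codeP x_A (E := E) (by simp [S'.E_eq]) hE0 (by omega)).seq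
      fun s₃ hs₃ hF₃ h₃ => ?_
    have y₃ : s₃.word w_y 0 = s.word w_perm (p + i) := by
      rw [hF₃.1 _ (by decide)]; simp [p', P', hv]
    have n₃ : s₃.word w_n 0 = n := by rw [hF₃.1 _ (by decide)]; simp [S'.n_eq]
    have i₃ : s₃.word w_i 0 = i := by rw [hF₃.1 _ (by decide)]; simp [hv]
    have F₃ : s₃.word w_F = s'.word w_F := by funext x; rw [hF₃.1 _ (by decide)]; simp
    have hslot : (var w_y + 2 * var w_n * var w_code).val s₃ =
        slot n E lo (s.weight x_A) (s.word w_perm (p + i)) := by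
      simp [y₃, n₃, h₃, slot, W', hlo, p', P', hv]
    have hlt := slt (s.weight x_A) _ hy
    refine runs_setWord (by decide) (by simp) (by simp) (fun h => by
      have := h.1; rw [val_ofNat]; omega) ?_
    rw [hslot]
    simp only [State.word_setWord, Nat.reduceEqDiff, false_and, if_false, val_ofNat, true_and, F₃]
    refine ⟨fun x hx => ?_, fun x hx => ?_, fun x hx => ?_⟩
    · split_ifs
      · exact le_rfl
      · exact i1 x hx
    · split_ifs with h
      · simp only [ne_eq, one_ne_zero, not_false_eq_true, true_iff]
        exact ⟨p + i, by omega, by omega, h.symm⟩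
      · rw [i2 x hx]
        constructor
        · rintro ⟨t, h1, h2, h3⟩
          exact ⟨t, h1, by omega, h3⟩
        · rintro ⟨t, h1, h2, h3⟩
          refine ⟨t, h1, lt_of_le_of_ne (by omega) fun h4 => h ?_, h3⟩
          rw [← h3, h4]
    · rw [if_neg (by omega)]
      exact i3 x hx
  · simp only [State.word_setWord, Nat.reduceEqDiff, false_and, if_false, h₁]
    refine ⟨fun x hx => by simp [hx], fun x hx => ?_, fun x hx => by rw [if_pos (by omega)]⟩
    rw [if_pos (by omega)]
    constructor
    · intro h; exact absurd rfl h
    · rintro ⟨t, h1, h2, -⟩; omega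
  · intro _; omega
  have S₂ : Setup n τ E κ X s₂ := S₁.congr fun a ha => hF₂.1 a (by revert a; decide)
  have W₂ : s₂.weight = s.weight := by funext a i; rw [hF₂.2 a (by simp [Program.weightWrites,
    Program.forLoop, Program.setVar, codeP]), W₁]
  obtain ⟨k1, k2, k3⟩ := h₂
  refine (runs_for (n := n) (t := (1002 + (E * 12000 + 2001)) + 1001) (fun i s' =>
    (∀ x < 2 * 2 ^ κ, s'.word w_F x ≤ 1) ∧
    (∀ x < 2 ^ κ, s'.word w_F x = s₂.word w_F x) ∧
    (∀ x < 2 ^ κ, s'.word w_F (2 ^ κ + x) ≠ 0 ↔ ∃ j < i, s.weight x_B j ≤ hi ∧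
      slot n E lo (s.weight x_B) j = x)) (by decide) (by decide)
    (fun i s' hF _ => ?_) (fun i s' hi' hs' hF hI hv => ?_) ?_ ?_).mono le_rfl
    (fun s' _ hF h => ?_)
  · simp [hF.1 w_n (by decide), S₂.n_eq]
  · obtain ⟨i1, i2, i3⟩ := hI
    have S' : Setup n τ E κ X s' := S₂.congr fun a ha => hF.1 a (by revert a; decide)
    have W' : s'.weight = s.weight := by funext a i; rw [hF.2 a (by simp [Program.weightWrites,
      Program.forLoop, Program.setVar, codeP]), W₂]
    refine runs_ite (by decide) (by simp [Test.safe, WeightExpr.safe]) (fun hc => ?_)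
      (fun hc => ?_)
    · simp [Test.holds, WeightExpr.val, W', hv, hhi] at hc
      refine runs_setVar_seq (by decide) (by simp) (fun h => h.2 _ _) ?_
      refine (runs_codeP x_B (E := E) (by simp [S'.E_eq]) hE0 (by omega)).seq
        fun s₃ hs₃ hF₃ h₃ => ?_
      have y₃ : s₃.word w_y 0 = i := by rw [hF₃.1 _ (by decide)]; simp [hv]
      have n₃ : s₃.word w_n 0 = n := by rw [hF₃.1 _ (by decide)]; simp [S'.n_eq]
      have N₃ : s₃.word w_N 0 = 2 ^ κ := by rw [hF₃.1 _ (by decide)]; simp [S'.N_eq]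
      have F₃ : s₃.word w_F = s'.word w_F := by funext x; rw [hF₃.1 _ (by decide)]; simp
      have hslot : (var w_N + (var w_y + 2 * var w_n * var w_code)).val s₃ =
          2 ^ κ + slot n E lo (s.weight x_B) i := by
        simp [y₃, n₃, N₃, h₃, slot, W', hlo, hv]
      have hlt := slt (s.weight x_B) i hi'
      refine runs_setWord (by decide) (by simp) (by simp) (fun h => by
        have := h.1; rw [val_ofNat]; omega) ?_
      rw [hslot]
      simp only [State.word_setWord, Nat.reduceEqDiff, false_and, if_false, val_ofNat, true_and,
        F₃]
      refine ⟨fun x hx => ?_, fun x hx => ?_, fun x hx => ?_⟩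
      · split_ifs
        · exact le_rfl
        · exact i1 x hx
      · rw [if_neg (by omega)]
        exact i2 x hx
      · split_ifs with h
        · simp only [ne_eq, one_ne_zero, not_false_eq_true, true_iff]
          exact ⟨i, by omega, hc, by omega⟩
        · rw [i3 x hx]
          constructor
          · rintro ⟨j, h1, h2, h3⟩
            exact ⟨j, by omega, h2, h3⟩
          · rintro ⟨j, h1, h2, h3⟩
            refine ⟨j, lt_of_le_of_ne (by omega) fun h4 => h ?_, h2, h3⟩
            rw [← h3, h4]
    · refine (runs_skip ?_).mono (by omega) fun _ _ _ h => h
      simp [Test.holds, WeightExpr.val, W', hv, hhi] at hc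
      simp only [State.word_setWord, Nat.reduceEqDiff, false_and, if_false]
      refine ⟨i1, i2, fun x hx => (i3 x hx).trans ⟨?_, ?_⟩⟩
      · rintro ⟨j, h1, h2, h3⟩
        exact ⟨j, by omega, h2, h3⟩
      · rintro ⟨j, h1, h2, h3⟩
        refine ⟨j, lt_of_le_of_ne (by omega) fun h4 => ?_, h2, h3⟩
        subst h4
        exact absurd h2 (not_le.2 hc)
  · simp only [State.word_setWord, Nat.reduceEqDiff, false_and, if_false]
    refine ⟨k1, fun _ _ => trivial, fun x hx => ?_⟩
    rw [k3 x hx]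
    constructor
    · intro h; exact absurd rfl h
    · rintro ⟨j, hj, -⟩; omega
  · intro _; omega
  · refine ⟨h.1, fun x hx => ?_, h.2.2⟩
    rw [h.2.1 x hx, k2 x hx]
    constructor
    · rintro ⟨t, h1, h2, h3⟩
      exact ⟨t, h1, by omega, h3⟩
    · rintro ⟨t, h1, h2, h3⟩
      exact ⟨t, h1, by omega, h3⟩

/-! ### Reading off the sums -/

/-- Some sum `P t + j = k` has `t` in the group of positions `p, …, e - 1` and `B j ≤ hi`. -/
def Hit (n : ℕ) (B : ℕ → ℝ≥0∞) (P : ℕ → ℕ) (p e : ℕ) (hi : ℝ≥0∞) (k : ℕ) : Prop :=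
  ∃ t, p ≤ t ∧ t < e ∧ ∃ j < n, B j ≤ hi ∧ P t + j = k

/-- `D'` is at most `D`, and stays above the entries of the min-plus convolution of `A` and `B`
where it differs from `D`. -/
def Improves (n : ℕ) (A B D D' : ℕ → ℝ≥0∞) : Prop :=
  ∀ k < n, D' k ≤ D k ∧ (D' k = D k ∨ ∃ i < n, ∃ j < n, i + j = k ∧ A i + B j ≤ D' k)

theorem Improves.refl (n : ℕ) (A B D : ℕ → ℝ≥0∞) : Improves n A B D D :=
  fun _ _ => ⟨le_rfl, Or.inl rfl⟩

theorem Improves.trans {n : ℕ} {A B D D' D'' : ℕ → ℝ≥0∞} (h : Improves n A B D D')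
    (h' : Improves n A B D' D'') : Improves n A B D D'' := fun k hk => by
  obtain ⟨h1, h2⟩ := h k hk
  obtain ⟨h3, h4⟩ := h' k hk
  refine ⟨h3.trans h1, ?_⟩
  rcases h4 with h4 | h4
  · rwa [h4]
  · exact Or.inr h4

/-- Turns the product `C` of the marked sequences into updates: `first` records the first group with
a hit, and a group with more than `τ` members contributes an upper bound to the output. -/
def scanP : Program :=
  .forLoop w_i (var w_N)
    (.setVar w_y (var w_i % (2 * var w_n)) ;;
     .ite (.and (.wordLT 0 (.get w_C (var w_i))) (.wordLT (var w_y) (var w_n)))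
      (.ite (.wordLT (.get w_first (var w_y)) 1) (.setWord w_first (var w_y) (var w_g + 1)) .skip ;;
       .ite (.and (.wordLT (var w_tau) (var w_e - var w_p))
          (.weightLE (.divWord (.mulWord (.get x_lo 0) (var w_i / (2 * var w_n) + 2)) (var w_E))
            (.get x_D (var w_y))))
        (.setWeight x_D (var w_y)
          (.divWord (.mulWord (.get x_lo 0) (var w_i / (2 * var w_n) + 2)) (var w_E)))
        .skip)
      .skip)

/-- The effect of the first `N` steps of the scan of `C`: the cell `x` of `C` belongs to the output
`x % (2 n)` and stands for the upper bound `c x`, which counts for large groups only. -/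
structure Scanned (n N g : ℕ) (large : Prop) (c : ℕ → ℝ≥0∞) (C f f' : ℕ → ℕ)
    (D D' : ℕ → ℝ≥0∞) : Prop where
  first : ∀ k < n, f' k = f k ∨
    f k = 0 ∧ f' k = g + 1 ∧ ∃ x < N, C x ≠ 0 ∧ x % (2 * n) = k
  hit : ∀ x < N, C x ≠ 0 → x % (2 * n) < n → f' (x % (2 * n)) ≠ 0
  le : ∀ k < n, D' k ≤ D k
  near : large → ∀ x < N, C x ≠ 0 → x % (2 * n) < n → D' (x % (2 * n)) ≤ c x
  ge : ∀ k < n, D' k = D k ∨ large ∧ ∃ x < N, C x ≠ 0 ∧ x % (2 * n) = k ∧ D' k = c x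

theorem Scanned.init (n g : ℕ) (large : Prop) (c : ℕ → ℝ≥0∞) (C f : ℕ → ℕ) (D : ℕ → ℝ≥0∞) :
    Scanned n 0 g large c C f f D D where
  first _ _ := Or.inl rfl
  hit x hx := absurd hx (by omega)
  le _ _ := le_rfl
  near _ x hx := absurd hx (by omega)
  ge _ _ := Or.inl rfl

theorem Scanned.skip {n N g : ℕ} {large : Prop} {c : ℕ → ℝ≥0∞} {C f f' : ℕ → ℕ}
    {D D' : ℕ → ℝ≥0∞} (h : Scanned n N g large c C f f' D D')
    (hN : C N ≠ 0 → ¬ N % (2 * n) < n) : Scanned n (N + 1) g large c C f f' D D' where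
  first k hk := (h.first k hk).imp_right fun ⟨h1, h2, x, hx, h3⟩ => ⟨h1, h2, x, by omega, h3⟩
  hit x hx hC hk := by
    rcases Nat.lt_succ_iff_lt_or_eq.1 hx with hx | rfl
    · exact h.hit x hx hC hk
    · exact absurd hk (hN hC)
  le := h.le
  near hl x hx hC hk := by
    rcases Nat.lt_succ_iff_lt_or_eq.1 hx with hx | rfl
    · exact h.near hl x hx hC hk
    · exact absurd hk (hN hC)
  ge k hk := (h.ge k hk).imp_right fun ⟨h1, x, hx, h2⟩ => ⟨h1, x, by omega, h2⟩

theorem Scanned.step {n N g : ℕ} {large : Prop} {c : ℕ → ℝ≥0∞} {C f f' f'' : ℕ → ℕ}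
    {D D' D'' : ℕ → ℝ≥0∞} (h : Scanned n N g large c C f f' D D') (hC : C N ≠ 0)
    (hf : ∀ k, f'' k = if k = N % (2 * n) ∧ f' k = 0 then g + 1 else f' k)
    (hD : ∀ k, k ≠ N % (2 * n) → D'' k = D' k)
    (hDl : large → D'' (N % (2 * n)) = min (D' (N % (2 * n))) (c N))
    (hDs : ¬ large → D'' (N % (2 * n)) = D' (N % (2 * n))) :
    Scanned n (N + 1) g large c C f f'' D D'' := by
  have hle : ∀ k, D'' k ≤ D' k := fun k => by
    rcases eq_or_ne k (N % (2 * n)) with rfl | hk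
    · by_cases hl : large
      · rw [hDl hl]; exact min_le_left _ _
      · rw [hDs hl]
    · rw [hD k hk]
  have hne : ∀ k, f' k ≠ 0 → f'' k ≠ 0 := fun k hk => by
    rw [hf, if_neg (fun h => hk h.2)]; exact hk
  refine ⟨fun k hk => ?_, fun x hx hCx hk => ?_, fun k hk => (hle k).trans (h.le k hk),
    fun hl x hx hCx hk => ?_, fun k hk => ?_⟩
  · rw [hf]
    rcases h.first k hk with h1 | ⟨h1, h2, x, hx, h3⟩
    · split_ifs with h4
      · exact Or.inr ⟨h1.symm.trans h4.2, rfl, N, by omega, hC, h4.1.symm⟩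
      · exact Or.inl h1
    · rw [if_neg (by omega)]
      exact Or.inr ⟨h1, h2, x, by omega, h3⟩
  · rcases Nat.lt_succ_iff_lt_or_eq.1 hx with hx | rfl
    · exact hne _ (h.hit x hx hCx hk)
    · rw [hf]
      split_ifs with h4
      · omega
      · exact fun h5 => h4 ⟨rfl, h5⟩
  · rcases Nat.lt_succ_iff_lt_or_eq.1 hx with hx | rfl
    · exact (hle _).trans (h.near hl x hx hCx hk)
    · rw [hDl hl]; exact min_le_right _ _
  · have old : D'' k = D' k → D'' k = D k ∨ large ∧ ∃ x < N + 1, C x ≠ 0 ∧ x % (2 * n) = k ∧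
        D'' k = c x := fun e => by
      rw [e]
      exact (h.ge k hk).imp_right fun ⟨h1, x, hx, h2⟩ => ⟨h1, x, by omega, h2⟩
    rcases eq_or_ne k (N % (2 * n)) with rfl | hk'
    · by_cases hl : large
      · rcases min_choice (D' (N % (2 * n))) (c N) with h1 | h1
        · exact old ((hDl hl).trans h1)
        · exact Or.inr ⟨hl, N, by omega, hC, rfl, (hDl hl).trans h1⟩
      · exact old (hDs hl)
    · exact old (hD k hk')

theorem runs_scanP {n τ E κ p e g : ℕ} {lo : ℝ≥0∞} (hS : Setup n τ E κ X s)
    (hp : s.word w_p 0 = p) (he : s.word w_e 0 = e) (hg : s.word w_g 0 = g) (hgn : g ≤ n)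
    (hlo : s.weight x_lo 0 = lo) :
    Runs X scanP s (2 ^ κ * 30000) (fun s' =>
      Scanned n (2 ^ κ) g (τ < e - p) (fun x => lo * (x / (2 * n) + 2 : ℕ) / (E : ℕ))
        (s.word w_C) (s.word w_first) (s'.word w_first) (s.weight x_D) (s'.weight x_D)) := by
  obtain ⟨b1, b2, b3, b4, b5, b6⟩ := hS.bounds
  have hE0 := hS.E_pos
  have hn0 := hS.n_pos
  refine Runs.mono (t₁ := (2 ^ κ + 2) * ((1002 + ((2001 + 1001 + (2001 + 1001)) + 1001)) + 2003))
    ?_ (by omega) (fun _ _ _ h => h)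
  refine (runs_for (n := 2 ^ κ) (fun N s' =>
    Scanned n N g (τ < e - p) (fun x => lo * (x / (2 * n) + 2 : ℕ) / (E : ℕ))
        (s.word w_C) (s.word w_first) (s'.word w_first) (s.weight x_D) (s'.weight x_D))
    (by decide) (by decide)
    (fun i s' hF _ => ?_) (fun N s' hN hs' hF hI hv => ?_) ?_ ?_)
  · simp [hF.1 w_N (by decide), hS.N_eq]
  · have n' : s'.word w_n 0 = n := by rw [hF.1 _ (by decide), hS.n_eq]
    have E' : s'.word w_E 0 = E := by rw [hF.1 _ (by decide), hS.E_eq]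
    have τ' : s'.word w_tau 0 = τ := by rw [hF.1 _ (by decide), hS.tau_eq]
    have p' : s'.word w_p 0 = p := by rw [hF.1 _ (by decide), hp]
    have e' : s'.word w_e 0 = e := by rw [hF.1 _ (by decide), he]
    have g' : s'.word w_g 0 = g := by rw [hF.1 _ (by decide), hg]
    have C' : s'.word w_C = s.word w_C := by funext x; rw [hF.1 _ (by decide)]
    have lo' : s'.weight x_lo 0 = lo := by rw [hF.2 _ (by decide), hlo]
    have hmod : N % (2 * n) < X := by have := Nat.mod_lt N (show 0 < 2 * n by omega); omega
    refine runs_setVar_seq (by decide) (by simp [n', hn0.ne']) (fun h => by simpa [n', hv]) ?_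
    refine runs_ite (by decide) (by simp [Test.safe]) (fun hc => ?_) (fun hc => ?_)
    · simp [Test.holds, n', hv, C'] at hc
      obtain ⟨c1, c2⟩ := hc
      refine Runs.mono (t₁ := (2001 + 1001) + (2001 + 1001)) ?_ (by norm_num) fun _ _ _ h => h
      refine Runs.seq (R := fun s'' => ∀ k, s''.word w_first k =
        if k = N % (2 * n) ∧ s'.word w_first k = 0 then g + 1 else s'.word w_first k)
        (runs_ite (t := 2001) (b := .wordLT (.get w_first (var w_y)) 1) (by decide)
          (by simp [Test.safe]) (fun hc => ?_) (fun hc => ?_)) fun s₁ hs₁ hF₁ h₁ => ?_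
      · simp [Test.holds, n', hv] at hc
        refine runs_setWord (by decide) (by simp) (by simp) (fun _ => by simp [g']; omega) ?_
        intro k
        simp [n', hv, g']
        rcases eq_or_ne k (N % (2 * n)) with rfl | hk
        · simp [hc]
        · simp [hk]
      · refine (runs_skip fun k => ?_).mono (by norm_num) fun _ _ _ h => h
        simp [Test.holds, n', hv] at hc
        simp
        rintro rfl h
        exact absurd h hc
      have n₁ : s₁.word w_n 0 = n := by rw [hF₁.1 _ (by decide)]; simp [n']
      have E₁ : s₁.word w_E 0 = E := by rw [hF₁.1 _ (by decide)]; simp [E']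
      have τ₁ : s₁.word w_tau 0 = τ := by rw [hF₁.1 _ (by decide)]; simp [τ']
      have p₁ : s₁.word w_p 0 = p := by rw [hF₁.1 _ (by decide)]; simp [p']
      have e₁ : s₁.word w_e 0 = e := by rw [hF₁.1 _ (by decide)]; simp [e']
      have i₁ : s₁.word w_i 0 = N := by rw [hF₁.1 _ (by decide)]; simp [hv]
      have y₁ : s₁.word w_y 0 = N % (2 * n) := by rw [hF₁.1 _ (by decide)]; simp [hv, n']
      have lo₁ : s₁.weight x_lo 0 = lo := by rw [hF₁.2 _ (by decide)]; simp [lo']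
      have D₁ : s₁.weight x_D = s'.weight x_D := by funext k; rw [hF₁.2 _ (by decide)]; simp
      refine runs_ite (by decide) (by simp [Test.safe, WeightExpr.safe, n₁, E₁, hn0.ne', hE0.ne'])
        (fun hc => ?_) (fun hc => ?_)
      · simp [Test.holds, WeightExpr.val, n₁, E₁, τ₁, p₁, e₁, i₁, y₁, lo₁, D₁] at hc
        refine runs_setWeight (by decide) (by simp)
          (by simp [WeightExpr.safe, n₁, E₁, hn0.ne', hE0.ne']) ?_
        refine hI.step c1.ne' (fun k => ?_) (fun k hk => ?_) (fun hl => ?_) (fun hl => ?_)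
        · simp [h₁]
        · simp [y₁, hk, D₁]
        · simp [WeightExpr.val, y₁, n₁, E₁, i₁, lo₁]
          exact hc.2
        · omega
      · simp [Test.holds, WeightExpr.val, n₁, E₁, τ₁, p₁, e₁, i₁, y₁, lo₁, D₁] at hc
        refine (runs_skip ?_).mono (by norm_num) fun _ _ _ h => h
        refine hI.step c1.ne' (fun k => ?_) (fun k hk => ?_) (fun hl => ?_) (fun hl => ?_)
        · simp [h₁]
        · simp [D₁]
        · simp [D₁]
          exact (hc (by omega)).le
        · simp [D₁]
    · refine (runs_skip ?_).mono (by norm_num) fun _ _ _ h => h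
      simp [Test.holds, n', hv, C'] at hc
      rw [State.word_setWord_of_ne (by decide), State.word_setWord_of_ne (by decide)]
      refine hI.skip fun h => not_lt.2 (hc (Nat.pos_of_ne_zero h))
  · simp
    exact Scanned.init _ _ _ _ _ _ _
  · intro _; omega

/-- No carry occurs when slots are added: the sum of two slots determines the sum of the two indices and
the sum of the two codes. -/
theorem slot_add_mod {n i j : ℕ} (hi : i < n) (hj : j < n) (E : ℕ) (v : ℝ≥0∞)
    (A B : ℕ → ℝ≥0∞) :
    (slot n E v A i + slot n E v B j) % (2 * n) = i + j := by
  rw [show slot n E v A i + slot n E v B j =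
    (i + j) + (2 * n) * (code v E (A i) + code v E (B j)) by simp only [slot]; ring,
    Nat.add_mul_mod_self_left, Nat.mod_eq_of_lt (by omega)]

theorem slot_add_div {n i j : ℕ} (hi : i < n) (hj : j < n) (E : ℕ) (v : ℝ≥0∞)
    (A B : ℕ → ℝ≥0∞) :
    (slot n E v A i + slot n E v B j) / (2 * n) = code v E (A i) + code v E (B j) := by
  rw [show slot n E v A i + slot n E v B j =
    (i + j) + (2 * n) * (code v E (A i) + code v E (B j)) by simp only [slot]; ring,
    Nat.add_mul_div_left _ _ (by omega), Nat.div_eq_of_lt (by omega), zero_add]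

/-- The effect of the convolution of one group of positions `p, …, e - 1`. -/
structure Processed (n τ E p e g : ℕ) (lo hi : ℝ≥0∞) (A B : ℕ → ℝ≥0∞) (P f f' : ℕ → ℕ)
    (D D' : ℕ → ℝ≥0∞) : Prop where
  first : ∀ k < n, f' k = f k ∨ f k = 0 ∧ f' k = g + 1 ∧ Hit n B P p e hi k
  hit : ∀ k < n, Hit n B P p e hi k → f' k ≠ 0
  near : τ < e - p → ∀ t, p ≤ t → t < e → ∀ j < n, B j ≤ hi → P t + j < n →
    D' (P t + j) ≤ A (P t) + B j + 2 * lo / E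
  imp : Improves n A B D D'

/-- Correctness of the convolution of one group: the rounded sums are at most `2 lo / E` too large, and
never too small. -/
theorem processed {n τ E κ p e g : ℕ} {lo hi : ℝ≥0∞} {A B : ℕ → ℝ≥0∞} {P F C f f' : ℕ → ℕ}
    {D D' : ℕ → ℝ≥0∞} (hN : 4 * n * (2 * E + 1) ≤ 2 ^ κ) (hE : 0 < E)
    (hP : ∀ t < e, P t < n) (hA : ∀ t, p ≤ t → t < e → A (P t) ≤ hi)
    (hlarge : τ < e - p → hi < 2 * lo)
    (hF : Marked n E κ p e lo hi A B P F)
    (hC : ∀ x < 2 ^ κ, C x ≠ 0 ↔ ∃ i j, i + j = x ∧ F i ≠ 0 ∧ F (2 ^ κ + j) ≠ 0)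
    (hS : Scanned n (2 ^ κ) g (τ < e - p) (fun x => lo * (x / (2 * n) + 2 : ℕ) / (E : ℕ))
      C f f' D D') :
    Processed n τ E p e g lo hi A B P f f' D D' := by
  have hE' : (E : ℝ≥0∞) ≠ 0 := by exact_mod_cast hE.ne'
  have hE'' : (E : ℝ≥0∞) ≠ ∞ := ENNReal.natCast_ne_top E
  have key : ∀ x < 2 ^ κ, C x ≠ 0 ↔ ∃ t, p ≤ t ∧ t < e ∧ ∃ j < n, B j ≤ hi ∧
      slot n E lo A (P t) + slot n E lo B j = x := fun x hx => by
    rw [hC x hx]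
    constructor
    · rintro ⟨i, j, h1, h2, h3⟩
      obtain ⟨t, t1, t2, t3⟩ := (hF.left i (by omega)).1 h2
      obtain ⟨j', j1, j2, j3⟩ := (hF.right j (by omega)).1 h3
      exact ⟨t, t1, t2, j', j1, j2, by rw [t3, j3, h1]⟩
    · rintro ⟨t, t1, t2, j, j1, j2, h⟩
      exact ⟨_, _, h, (hF.left _ (by omega)).2 ⟨t, t1, t2, rfl⟩,
        (hF.right _ (by omega)).2 ⟨j, j1, j2, rfl⟩⟩
  have hlt : ∀ t < e, ∀ j < n, slot n E lo A (P t) + slot n E lo B j < 2 ^ κ := fun t ht j hj => by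
    have h1 := slot_lt hN lo A (hP t ht)
    have h2 := slot_lt hN lo B hj
    omega
  refine ⟨fun k hk => ?_, ?_, ?_, fun k hk => ⟨hS.le k hk, ?_⟩⟩
  · rcases hS.first k hk with h | ⟨h1, h2, x, hx, h3, h4⟩
    · exact Or.inl h
    · obtain ⟨t, t1, t2, j, j1, j2, rfl⟩ := (key x hx).1 h3
      rw [slot_add_mod (hP t t2) j1] at h4
      exact Or.inr ⟨h1, h2, t, t1, t2, j, j1, j2, h4⟩
  · rintro k hk ⟨t, t1, t2, j, j1, j2, rfl⟩
    have := hS.hit _ (hlt t t2 j j1) ((key _ (hlt t t2 j j1)).2 ⟨t, t1, t2, j, j1, j2, rfl⟩)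
    rw [slot_add_mod (hP t t2) j1] at this
    exact this hk
  · intro hl t t1 t2 j j1 j2 hk
    have := hS.near hl _ (hlt t t2 j j1) ((key _ (hlt t t2 j j1)).2 ⟨t, t1, t2, j, j1, j2, rfl⟩)
    rw [slot_add_mod (hP t t2) j1, slot_add_div (hP t t2) j1] at this
    refine (this hk).trans (ENNReal.div_le_of_le_mul ?_)
    rw [add_mul, ENNReal.div_mul_cancel hE' hE'']
    have h1 := code_mul_le lo E (A (P t))
    have h2 := code_mul_le lo E (B j)
    push_cast
    calc lo * (code lo E (A (P t)) + code lo E (B j) + 2)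
        = code lo E (A (P t)) * lo + code lo E (B j) * lo + 2 * lo := by ring
      _ ≤ A (P t) * E + B j * E + 2 * lo := by gcongr
      _ = _ := by ring
  · rcases hS.ge k hk with h | ⟨hl, x, hx, h1, h2, h3⟩
    · exact Or.inl h
    · obtain ⟨t, t1, t2, j, j1, j2, rfl⟩ := (key x hx).1 h1
      rw [slot_add_mod (hP t t2) j1] at h2
      refine Or.inr ⟨P t, hP t t2, j, j1, h2, ?_⟩
      rw [h3, slot_add_div (hP t t2) j1, ENNReal.le_div_iff_mul_le (Or.inl hE') (Or.inl hE'')]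
      have h4 := mul_le_code_succ (E := E) ((hA t t1 t2).trans_lt (hlarge hl))
      have h5 := mul_le_code_succ (E := E) (j2.trans_lt (hlarge hl))
      push_cast
      calc (A (P t) + B j) * E = A (P t) * E + B j * E := by ring
        _ ≤ (code lo E (A (P t)) + 1) * lo + (code lo E (B j) + 1) * lo := by gcongr
        _ = (code lo E (A (P t)) + code lo E (B j)) * lo + (1 + 1) * lo := by ring
        _ = lo * (code lo E (A (P t)) + code lo E (B j) + 2) := by rw [one_add_one_eq_two]; ring

/-- Processes the group of positions `p, …, e - 1`. -/
def processP : Program := markP ;; convP ;; scanP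

theorem runs_processP {n τ E κ p e g : ℕ} {lo hi : ℝ≥0∞} (hS : Setup n τ E κ X s)
    (hp : s.word w_p 0 = p) (he : s.word w_e 0 = e) (hg : s.word w_g 0 = g) (hgn : g ≤ n)
    (hen : e ≤ n) (hP : ∀ t < e, s.word w_perm t < n) (hlo : s.weight x_lo 0 = lo)
    (hhi : s.weight x_hi 0 = hi)
    (hA : ∀ t, p ≤ t → t < e → s.weight x_A (s.word w_perm t) ≤ hi)
    (hlarge : τ < e - p → hi < 2 * lo) :
    Runs X processP s (2 ^ κ * κ ^ 3 * (10 ^ 8 + 90000)) (fun s' =>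
      Processed n τ E p e g lo hi (s.weight x_A) (s.weight x_B) (s.word w_perm)
        (s.word w_first) (s'.word w_first) (s.weight x_D) (s'.weight x_D)) := by
  obtain ⟨b1, b2, b3, b4, b5, b6⟩ := hS.bounds
  have hn0 := hS.n_pos
  refine Runs.mono (t₁ := 2 ^ κ * 60000 + (2 ^ κ * κ ^ 3 * 10 ^ 8 + 2 ^ κ * 30000)) ?_ ?_
    (fun _ _ _ h => h)
  swap
  · have h1 : 2 ^ κ * 1 ≤ 2 ^ κ * κ ^ 3 := Nat.mul_le_mul_left _ (Nat.one_le_pow _ _ hS.log_pos)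
    linarith
  refine (runs_markP hS hp he hen hP hlo hhi).seq fun s₁ hs₁ hF₁ h₁ => ?_
  have S₁ : Setup n τ E κ X s₁ := hS.congr fun a ha => hF₁.1 a (by revert a; decide)
  refine (runs_convP (M := 2 * 2 ^ κ + 1) S₁.log_pos S₁.pow S₁.log_eq S₁.M_eq (by omega) (by omega)
    (by omega) S₁.lt_X h₁.le_one (fun i hi hi' => ?_) (fun j hj hj' => ?_)).seq
    fun s₂ hs₂ hF₂ h₂ => ?_
  · by_contra hne
    obtain ⟨t, t1, t2, rfl⟩ := (h₁.left i hi).1 hne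
    have := slot_lt b1 lo (s.weight x_A) (hP t t2)
    omega
  · by_contra hne
    obtain ⟨t, t1, t2, rfl⟩ := (h₁.right j hj).1 hne
    have := slot_lt b1 lo (s.weight x_B) t1
    omega
  have hw := convP_writes.1
  have fr : ∀ a, a < 10 ∨ 23 < a → s₂.word a = s₁.word a := fun a ha => by
    funext i
    exact hF₂.1 a (fun h => by have := hw a h; omega) i
  have S₂ : Setup n τ E κ X s₂ := S₁.congr fun a ha i => by rw [fr a (Or.inl ha)]
  have W₁ : s₁.weight = s.weight := by funext a i; rw [hF₁.2 a (by simp [Program.weightWrites,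
    Program.forLoop, Program.setVar, codeP, markP])]
  have W₂ : s₂.weight = s.weight := by
    funext a i; rw [hF₂.2 a (by rw [convP_writes.2]; exact List.not_mem_nil), W₁]
  have k₁ : ∀ a, a ∉ markP.wordWrites → a < 10 ∨ 23 < a → s₂.word a = s.word a := fun a h1 h2 => by
    rw [fr a h2]; funext i; exact hF₁.1 a h1 i
  refine (runs_scanP (g := g) (p := p) (e := e) (lo := lo) S₂
    (by rw [k₁ _ (by decide) (by decide), hp])
    (by rw [k₁ _ (by decide) (by decide), he]) (by rw [k₁ _ (by decide) (by decide), hg]) hgn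
    (by rw [W₂, hlo])).mono le_rfl fun s₃ _ _ h₃ => ?_
  rw [W₂, k₁ w_first (by decide) (by decide)] at h₃
  exact processed b1 hS.E_pos hP hA hlarge h₁ h₂ h₃

/-! ### The groups -/

/-- The state after `g` groups of the first `m` positions of the sorted order `P` have been
processed: `S i` is the start of the group `i`, and `f k` is `0` or the number of the first
group with a hit for `k`, plus one. -/
structure Groups (n τ E m : ℕ) (A B : ℕ → ℝ≥0∞) (P S f : ℕ → ℕ) (D : ℕ → ℝ≥0∞) (g : ℕ) :
    Prop where
  zero : S 0 = 0
  le : g ≤ S g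
  le_fin : S g ≤ m
  lt : ∀ i < g, S i < S (i + 1)
  sep : ∀ i < g, S (i + 1) < m → 2 * A (P (S i)) ≤ A (P (S (i + 1)))
  hit : ∀ i < g, ∀ k < n, Hit n B P (S i) (S (i + 1)) (A (P (S (i + 1) - 1))) k →
    f k ≠ 0 ∧ f k ≤ i + 1
  first : ∀ k < n, f k ≠ 0 → f k ≤ g ∧
    Hit n B P (S (f k - 1)) (S (f k)) (A (P (S (f k) - 1))) k
  near : ∀ i < g, τ < S (i + 1) - S i → ∀ t, S i ≤ t → t < S (i + 1) → ∀ j < n,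
    B j ≤ A (P (S (i + 1) - 1)) → P t + j < n →
      D (P t + j) ≤ A (P t) + B j + 2 * A (P (S i)) / E

/-- The next group is processed. The number `first k` of an earlier group is kept. -/
theorem Groups.step {n τ E m e g : ℕ} {A B : ℕ → ℝ≥0∞} {P S f S' f' : ℕ → ℕ} {D D' : ℕ → ℝ≥0∞}
    (h : Groups n τ E m A B P S f D g) (he : S g < e) (hem : e ≤ m)
    (hsep : e < m → 2 * A (P (S g)) ≤ A (P e))
    (hS : ∀ i, S' i = if i = g + 1 then e else S i)
    (hP : Processed n τ E (S g) e g (A (P (S g))) (A (P (e - 1))) A B P f f' D D') :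
    Groups n τ E m A B P S' f' D' (g + 1) := by
  have old : ∀ i ≤ g, S' i = S i := fun i hi => by rw [hS, if_neg (by omega)]
  have new : S' (g + 1) = e := by rw [hS, if_pos rfl]
  refine ⟨by rw [old 0 (by omega), h.zero], ?_, by rw [new]; exact hem, fun i hi => ?_,
    fun i hi => ?_, fun i hi k hk => ?_, fun k hk hf => ?_, fun i hi => ?_⟩
  · rw [new]; have := h.le; omega
  · rcases Nat.lt_succ_iff_lt_or_eq.1 hi with hi | rfl
    · rw [old i hi.le, old (i + 1) hi]; exact h.lt i hi
    · rw [old i le_rfl, new]; exact he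
  · rcases Nat.lt_succ_iff_lt_or_eq.1 hi with hi | rfl
    · rw [old i hi.le, old (i + 1) hi]; exact h.sep i hi
    · rw [old i le_rfl, new]; exact hsep
  · rcases Nat.lt_succ_iff_lt_or_eq.1 hi with hi | rfl
    · rw [old i hi.le, old (i + 1) hi]
      intro hh
      have h1 := h.hit i hi k hk hh
      rcases hP.first k hk with h2 | h2
      · rwa [h2]
      · exact absurd h2.1 h1.1
    · rw [old i le_rfl, new]
      intro hh
      refine ⟨hP.hit k hk hh, ?_⟩
      rcases hP.first k hk with h2 | h2
      · rw [h2]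
        rcases Nat.eq_zero_or_pos (f k) with h3 | h3
        · omega
        · have := (h.first k hk h3.ne').1; omega
      · omega
  · rcases hP.first k hk with h2 | ⟨-, h2, h3⟩
    · rw [h2] at hf ⊢
      obtain ⟨h4, h5⟩ := h.first k hk hf
      rw [old _ h4, old _ (by omega)]
      exact ⟨by omega, h5⟩
    · rw [h2, Nat.add_sub_cancel, new, old g le_rfl]
      exact ⟨le_rfl, h3⟩
  · rcases Nat.lt_succ_iff_lt_or_eq.1 hi with hi | rfl
    · rw [old i hi.le, old (i + 1) hi]
      intro h1 t h2 h3 j h4 h5 h6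
      exact (hP.imp _ h6).1.trans (h.near i hi h1 t h2 h3 j h4 h5 h6)
    · rw [old i le_rfl, new]
      exact hP.near

/-- Finds the end of the group that starts at `p`: the group takes `τ` members, and all further
members below twice the smallest one. -/
def endP : Program :=
  .setVar w_e (var w_p + var w_tau) ;;
  .ite (.wordLT (var w_fin) (var w_e)) (.setVar w_e (var w_fin)) .skip ;;
  .while (.and (.wordLT (var w_e) (var w_fin)) (.not (.weightLE (.mulWord (.get x_lo 0) 2)
      (.get x_A (.get w_perm (var w_e))))))
    (.setVar w_e (var w_e + 1))

theorem runs_endP {n τ m p : ℕ} (hτ : s.word w_tau 0 = τ) (hτ0 : 0 < τ)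
    (hm : s.word w_fin 0 = m) (hmn : m ≤ n) (hp : s.word w_p 0 = p) (hpm : p < m)
    (hX : n + τ + 1 < X) :
    Runs X endP s (n * 20000) (fun s' => p < s'.word w_e 0 ∧ s'.word w_e 0 ≤ m ∧
      (p + τ ≤ s'.word w_e 0 ∨ s'.word w_e 0 = m) ∧
      (s'.word w_e 0 < m → 2 * s.weight x_lo 0 ≤ s.weight x_A (s.word w_perm (s'.word w_e 0))) ∧
      (τ < s'.word w_e 0 - p →
        s.weight x_A (s.word w_perm (s'.word w_e 0 - 1)) < 2 * s.weight x_lo 0)) := by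
  refine Runs.mono (t₁ := 1002 + ((1002 + 1001) + (m + 1) * (1002 + 1001))) ?_ (by omega)
    (fun _ _ _ h => h)
  refine runs_setVar_seq (by decide) (by simp) (fun h => by simp [hp, hτ]; omega) ?_
  refine Runs.seq (R := fun s' => p < s'.word w_e 0 ∧ s'.word w_e 0 ≤ m ∧
      (p + τ ≤ s'.word w_e 0 ∨ s'.word w_e 0 = m) ∧ s'.word w_e 0 ≤ p + τ)
    (runs_ite (by decide) (by simp [Test.safe]) (fun hc => ?_) (fun hc => ?_))
    fun s₁ hs₁ hF₁ h₁ => ?_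
  · refine runs_setVar (by decide) (by simp) (fun h => h.2 _ _) ?_
    simp [Test.holds, hm, hp, hτ] at hc ⊢
    omega
  · refine (runs_skip ?_).mono (by norm_num) fun _ _ _ h => h
    simp [Test.holds, hm, hp, hτ] at hc ⊢
    omega
  have m₁ : s₁.word w_fin 0 = m := by rw [hF₁.1 _ (by decide)]; simp [hm]
  have P₁ : s₁.word w_perm = s.word w_perm := by funext x; rw [hF₁.1 _ (by decide)]; simp
  have W₁ : s₁.weight = s.weight := by
    funext a x; rw [hF₁.2 a (by simp [Program.weightWrites, Program.setVar])]; simp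
  refine (runs_while (t := 1002) (b := .and (.wordLT (var w_e) (var w_fin)) (.not (.weightLE
    (.mulWord (.get x_lo 0) 2) (.get x_A (.get w_perm (var w_e)))))) (by decide)
    (fun s' => p < s'.word w_e 0 ∧ s'.word w_e 0 ≤ m ∧
      (p + τ ≤ s'.word w_e 0 ∨ s'.word w_e 0 = m) ∧
      (τ < s'.word w_e 0 - p →
        s.weight x_A (s.word w_perm (s'.word w_e 0 - 1)) < 2 * s.weight x_lo 0))
    (fun s' => m - s'.word w_e 0) (fun s' h => by simp [Test.safe, WeightExpr.safe])
    (fun s' hs' hF hI hb => ?_) ?_).mono ?_ (fun s' _ hF h => ?_)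
  · have m' : s'.word w_fin 0 = m := by rw [hF.1 _ (by decide), m₁]
    have P' : s'.word w_perm = s.word w_perm := by funext x; rw [hF.1 _ (by decide), P₁]
    have W' : s'.weight = s.weight := by funext a x; rw [hF.2 a (by simp [Program.weightWrites,
      Program.setVar]), W₁]
    simp [Test.holds, WeightExpr.val, m', P', W'] at hb
    refine runs_setVar (by decide) (by simp) (fun h => by simp; omega) ?_
    obtain ⟨i1, i2, i3, i4⟩ := hI
    simp
    refine ⟨⟨by omega, by omega, by omega, fun _ => ?_⟩, by omega⟩
    rw [mul_comm]; exact hb.2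
  · obtain ⟨h1, h2, h3, h4⟩ := h₁
    exact ⟨h1, h2, h3, fun h => by omega⟩
  · exact Nat.mul_le_mul_right _ (by omega)
  · obtain ⟨⟨i1, i2, i3, i4⟩, hb⟩ := h
    have m' : s'.word w_fin 0 = m := by rw [hF.1 _ (by decide), m₁]
    have P' : s'.word w_perm = s.word w_perm := by funext x; rw [hF.1 _ (by decide), P₁]
    have W' : s'.weight = s.weight := by funext a x; rw [hF.2 a (by simp [Program.weightWrites,
      Program.setVar]), W₁]
    simp [Test.holds, WeightExpr.val, m', P', W'] at hb
    exact ⟨i1, i2, i3, fun h => by rw [mul_comm]; exact hb h, i4⟩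

/-- Splits the first `fin` positions of the sorted order into groups, and processes them. -/
def groupsP : Program :=
  .forLoop w_i (var w_n) (.setWord w_first (var w_i) 0) ;;
  .setVar w_p 0 ;; .setVar w_g 0 ;; .setWord w_start 0 0 ;;
  .while (.wordLT (var w_p) (var w_fin))
    (.setWeight x_lo 0 (.get x_A (.get w_perm (var w_p))) ;;
     endP ;;
     .setWeight x_hi 0 (.get x_A (.get w_perm (var w_e - 1))) ;;
     processP ;;
     .setVar w_g (var w_g + 1) ;;
     .setWord w_start (var w_g) (var w_e) ;;
     .setVar w_p (var w_e))

theorem groupsP_writes : (∀ a ∈ groupsP.wordWrites, 10 ≤ a ∧ a ≤ 23 ∨ 40 ≤ a ∧ a ≠ w_fin) ∧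
    ∀ a ∈ groupsP.weightWrites, a = x_D ∨ a = x_lo ∨ a = x_hi := by
  decide

theorem runs_groupsP {n τ E κ m : ℕ} (hS : Setup n τ E κ X s) (hm : s.word w_fin 0 = m)
    (hmn : m ≤ n) (hP : SortedBy n (s.weight x_A) (s.word w_perm)) :
    Runs X groupsP s ((n / τ + 3) * (2 ^ κ * κ ^ 3 * (2 * 10 ^ 8))) (fun s' =>
      (∃ g, Groups n τ E m (s.weight x_A) (s.weight x_B) (s.word w_perm) (s'.word w_start)
        (s'.word w_first) (s'.weight x_D) g ∧ s'.word w_start g = m) ∧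
      Improves n (s.weight x_A) (s.weight x_B) (s.weight x_D) (s'.weight x_D)) := by
  obtain ⟨b1, b2, b3, b4, b5, b6⟩ := hS.bounds
  have hn0 := hS.n_pos
  have hτ0 := hS.tau_pos
  have hdiv : (m + τ - 1) / τ ≤ n / τ + 1 := by
    rw [← Nat.add_div_right _ hτ0]
    exact Nat.div_le_div_right (by omega)
  refine Runs.of_small fun hs => ?_
  refine Runs.mono (t₁ := (n + 2) * 5000 + (1002 + (1002 + (2001 + ((m + τ - 1) / τ + 1) *
    ((2001 + (n * 20000 + (2001 + (2 ^ κ * κ ^ 3 * (10 ^ 8 + 90000) + (1002 + (2001 + 1002)))))) +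
      1001))))) ?_ ?_ (fun _ _ _ h => h)
  swap
  · have h1 : 2 ^ κ * 1 ≤ 2 ^ κ * κ ^ 3 := Nat.mul_le_mul_left _ (Nat.one_le_pow _ _ hS.log_pos)
    generalize 2 ^ κ * κ ^ 3 = T at *
    have h2 : ((m + τ - 1) / τ + 1) * ((2001 + (n * 20000 + (2001 + (T * (10 ^ 8 + 90000) +
      (1002 + (2001 + 1002)))))) + 1001) ≤ (n / τ + 2) * (T * (2 * 10 ^ 8)) :=
      Nat.mul_le_mul (by omega) (by omega)
    have h3 : (n / τ + 3) * (T * (2 * 10 ^ 8)) =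
      (n / τ + 2) * (T * (2 * 10 ^ 8)) + T * (2 * 10 ^ 8) := by ring
    linarith
  refine (runs_fill (n := n) (F := fun _ => 0) (by decide) (by decide) (by decide)
    (fun s' h => ?_) (fun t _ s' h _ => by simp) (fun h t _ => by have := h.1; omega)
    (fun _ => by omega)).seq fun s₁ hs₁ hF₁ h₁ => ?_
  · simp [h w_n (by decide) (by decide), hS.n_eq]
  have S₁ : Setup n τ E κ X s₁ := hS.congr fun a ha => hF₁.1 a (by revert a; decide)
  have P₁ : s₁.word w_perm = s.word w_perm := by funext x; rw [hF₁.1 _ (by decide)]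
  have m₁ : s₁.word w_fin 0 = m := by rw [hF₁.1 _ (by decide), hm]
  have W₁ : s₁.weight = s.weight := by funext a i; rw [hF₁.2 a (List.not_mem_nil)]
  refine runs_setVar_seq (by decide) (by simp) (fun h => by rw [val_ofNat]; omega) ?_
  refine runs_setVar_seq (by decide) (by simp) (fun h => by rw [val_ofNat]; omega) ?_
  refine runs_setWord_seq (by decide) (by simp) (by simp) (fun h => by rw [val_ofNat]; omega) ?_
  simp only [val_ofNat]
  set s₂ := ((s₁.setWord w_p 0 0).setWord w_g 0 0).setWord w_start 0 0 with hs₂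
  refine (runs_while (X := X) (s := s₂) (b := .wordLT (var w_p) (var w_fin))
    (t := 2001 + (n * 20000 + (2001 + (2 ^ κ * κ ^ 3 * (10 ^ 8 + 90000) + (1002 + (2001 + 1002))))))
    (by decide)
    (fun s' => Groups n τ E m (s.weight x_A) (s.weight x_B) (s.word w_perm) (s'.word w_start)
      (s'.word w_first) (s'.weight x_D) (s'.word w_g 0) ∧
      s'.word w_p 0 = s'.word w_start (s'.word w_g 0) ∧
      Improves n (s.weight x_A) (s.weight x_B) (s.weight x_D) (s'.weight x_D))
    -- a group has at least `τ` members unless it is the last one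
    (fun s' => (m - s'.word w_p 0 + τ - 1) / τ) (fun s' h => by simp [Test.safe])
    (fun s' hs' hF hI hb => ?_) ?_).mono ?_ (fun s' _ hF h => ?_)
  · obtain ⟨hG, hp, hD⟩ := hI
    have hw := groupsP_writes.1
    have S' : Setup n τ E κ X s' := by
      refine (S₁.congr (s' := s₂) fun a ha i => ?_).congr fun a ha => hF.1 a ?_
      · simp [hs₂, show a ≠ 40 by omega, show a ≠ 42 by omega, show a ≠ 43 by omega]
      · revert a; decide
    have P' : s'.word w_perm = s.word w_perm := by
      funext x; rw [hF.1 _ (by decide)]; simp [hs₂, P₁]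
    have m' : s'.word w_fin 0 = m := by rw [hF.1 _ (by decide)]; simp [hs₂, m₁]
    have A' : s'.weight x_A = s.weight x_A := by
      funext x; rw [hF.2 _ (by decide)]; simp [hs₂, W₁]
    have B' : s'.weight x_B = s.weight x_B := by
      funext x; rw [hF.2 _ (by decide)]; simp [hs₂, W₁]
    have hpm : s'.word w_p 0 < m := by simpa [Test.holds, m'] using hb
    set g := s'.word w_g 0 with hg
    set p := s'.word w_p 0 with hp'
    refine runs_setWeight_seq (by decide) (by simp) (by simp [WeightExpr.safe]) ?_
    refine (runs_endP (n := n) (τ := τ) (m := m) (p := p) (by simp [S'.tau_eq]) hτ0 (by simp [m'])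
      hmn (by simp [hp']) hpm (by omega)).seq fun s₃ hs₃ hF₃ h₃ => ?_
    simp [WeightExpr.val, P', A'] at h₃
    rw [← hp'] at h₃
    set e := s₃.word w_e 0 with he
    obtain ⟨e1, e2, e3, e4, e5⟩ := h₃
    have S₃ : Setup n τ E κ X s₃ := S'.congr fun a ha i => by
      rw [hF₃.1 a (by revert a; decide)]; rfl
    have k₃ : ∀ a, a ≠ w_e → s₃.word a = s'.word a := fun a ha => by
      funext x
      rw [hF₃.1 a (by simpa [endP, Program.wordWrites, Program.setVar] using ha)]
      rfl
    have A₃ : s₃.weight x_A = s.weight x_A := by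
      funext x; rw [hF₃.2 _ (by decide), ← A']; simp
    have B₃ : s₃.weight x_B = s.weight x_B := by
      funext x; rw [hF₃.2 _ (by decide), ← B']; simp
    have D₃ : s₃.weight x_D = s'.weight x_D := by
      funext x; rw [hF₃.2 _ (by decide)]; simp
    have lo₃ : s₃.weight x_lo 0 = s.weight x_A (s.word w_perm p) := by
      rw [hF₃.2 _ (by decide)]; simp [WeightExpr.val, A', P', hp']
    have P₃ : s₃.word w_perm = s.word w_perm := by rw [k₃ _ (by decide), P']
    refine runs_setWeight_seq (by decide) (by simp) (by simp [WeightExpr.safe]) ?_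
    refine Runs.seq (runs_processP (n := n) (τ := τ) (E := E) (κ := κ) (p := p) (e := e) (g := g)
      (lo := s.weight x_A (s.word w_perm p)) (hi := s.weight x_A (s.word w_perm (e - 1)))
      (S₃.congr fun _ _ _ => rfl)
      (by simp [k₃ w_p (by decide), hp']) (by simp [he]) (by simp [k₃ w_g (by decide), hg])
      (by have := hG.le; omega) (by omega) (fun t ht => ?_) (by simp [lo₃])
      (by simp [WeightExpr.val, A₃, P₃, he]) (fun t t1 t2 => ?_) e5) fun s₄ hs₄ hF₄ h₄ => ?_
    · simp [P₃]; exact hP.lt t (by omega)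
    · simp [A₃, P₃]
      exact hP.mono _ _ (by omega) (by omega)
    rw [State.word_setWeight, State.weight_setWeight_of_ne (by decide),
      State.weight_setWeight_of_ne (by decide), State.weight_setWeight_of_ne (by decide), A₃, B₃, D₃, P₃,
      k₃ w_first (by decide)] at h₄
    have g₄ : s₄.word w_g 0 = g := by
      rw [hF₄.1 _ (by decide)]; simp [k₃ w_g (by decide), hg]
    have e₄ : s₄.word w_e 0 = e := by
      rw [hF₄.1 _ (by decide)]; simp [he]
    have S₄ : s₄.word w_start = s'.word w_start := by
      funext x; rw [hF₄.1 _ (by decide)]; simp [k₃ w_start (by decide)]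
    refine Runs.mono (t₁ := 1002 + (2001 + 1002)) (Q := fun s₅ => s₅.word w_g 0 = g + 1 ∧
      (∀ i, s₅.word w_start i = if i = g + 1 then e else s'.word w_start i) ∧
      s₅.word w_p 0 = e ∧ s₅.word w_first = s₄.word w_first ∧ s₅.weight = s₄.weight) ?_ le_rfl
      fun s₅ _ _ ⟨k1, k2, k3, k4, k5⟩ => ?_
    · refine runs_setVar_seq (by decide) (by simp) (fun h => by
        simp [g₄]; have := hG.le; omega) ?_
      refine runs_setWord_seq (by decide) (by simp) (by simp) (fun h => h.2 _ _) ?_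
      refine runs_setVar (by decide) (by simp) (fun h => h.2 _ _) ?_
      refine ⟨by simp [g₄], fun i => by simp [g₄, e₄, S₄], by simp [e₄], ?_, rfl⟩
      rw [State.word_setWord_of_ne (by decide), State.word_setWord_of_ne (by decide),
        State.word_setWord_of_ne (by decide)]
    · rw [k1, k3, k4, k5]
      refine ⟨⟨hG.step (e := e) (f' := s₄.word w_first) (D' := s₄.weight x_D) (by omega) e2
        (by rw [← hp]; exact e4) k2 (by rw [← hp]; exact h₄), ?_, hD.trans h₄.imp⟩, ?_⟩
      · rw [k2, if_pos rfl]
      · rw [Nat.div_lt_iff_lt_mul hτ0]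
        have h1 := Nat.lt_succ_self ((m - p + τ - 1) / τ)
        have h2 := Nat.div_add_mod (m - p + τ - 1) τ
        have h3 := Nat.mod_lt (m - p + τ - 1) hτ0
        rw [mul_comm] at h2
        rcases e3 with e3 | e3
        · omega
        · have h4 : 1 * τ ≤ (m - p + τ - 1) / τ * τ :=
            Nat.mul_le_mul_right _ ((Nat.one_le_div_iff hτ0).2 (by omega))
          omega
  · have f₂ : ∀ k < n, s₂.word w_first k = 0 := fun k hk => by simp [hs₂, h₁, hk]
    have g₂ : s₂.word w_g 0 = 0 := by simp [hs₂]
    have S₂ : s₂.word w_start 0 = 0 := by simp [hs₂]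
    have p₂ : s₂.word w_p 0 = 0 := by simp [hs₂]
    rw [g₂, S₂, p₂, show s₂.weight = s.weight from W₁]
    exact ⟨⟨S₂, by omega, by omega, fun i hi => absurd hi (by omega),
      fun i hi => absurd hi (by omega), fun i hi => absurd hi (by omega),
      fun k hk hf => absurd (f₂ k hk) hf, fun i hi => absurd hi (by omega)⟩, rfl, .refl _ _ _ _⟩
  · simp [hs₂]
  · obtain ⟨⟨hG, hp, hD⟩, hb⟩ := h
    have m' : s'.word w_fin 0 = m := by rw [hF.1 _ (by decide)]; simp [hs₂, m₁]
    simp [Test.holds, m', hp] at hb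
    exact ⟨⟨_, hG, le_antisymm hG.le_fin hb⟩, hD⟩

/-! ### Exhaustive search in two groups -/

/-- The position `t` of the sorted order has been tried for the output `k`. -/
def Tried (n : ℕ) (A B : ℕ → ℝ≥0∞) (P : ℕ → ℕ) (D : ℕ → ℝ≥0∞) (k t : ℕ) : Prop :=
  t < n → P t ≤ k → D k ≤ A (P t) + B (k - P t)

theorem Tried.mono {n : ℕ} {A B : ℕ → ℝ≥0∞} {P : ℕ → ℕ} {D D' : ℕ → ℝ≥0∞} {k t : ℕ}
    (h : Tried n A B P D k t) (hk : k < n) (hD : Improves n A B D D') : Tried n A B P D' k t :=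
  fun h1 h2 => (hD k hk).1.trans (h h1 h2)

/-- Tries the position that is the value of `x`, for the output in the variable `y`. -/
def tryP (x : WordExpr) : Program :=
  .setVar w_v x ;;
  .ite (.and (.wordLT (var w_v) (var w_n)) (.and (.not (.wordLT (var w_y) (.get w_perm (var w_v))))
      (.weightLE (.add (.get x_A (.get w_perm (var w_v)))
        (.get x_B (var w_y - .get w_perm (var w_v)))) (.get x_D (var w_y)))))
    (.setWeight x_D (var w_y) (.add (.get x_A (.get w_perm (var w_v)))
      (.get x_B (var w_y - .get w_perm (var w_v)))))
    .skip

theorem runs_tryP {n k t : ℕ} {x : WordExpr} (hn : s.word w_n 0 = n) (hk : s.word w_y 0 = k)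
    (hkn : k < n) (hx : x.cost ≤ 1000) (hx' : x.safe s) (ht : x.val s = t) (htX : t < X)
    (hP : ∀ t < n, s.word w_perm t < n) :
    Runs X (tryP x) s 5000 (fun s' =>
      Improves n (s.weight x_A) (s.weight x_B) (s.weight x_D) (s'.weight x_D) ∧
      Tried n (s.weight x_A) (s.weight x_B) (s.word w_perm) (s'.weight x_D) k t) := by
  refine Runs.mono (t₁ := 1002 + (2001 + 1001)) ?_ (by norm_num) (fun _ _ _ h => h)
  refine runs_setVar_seq hx hx' (fun h => by rw [ht]; exact htX) ?_
  refine runs_ite (by decide) (by simp [Test.safe, WeightExpr.safe]) (fun hc => ?_)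
    (fun hc => ?_)
  · refine runs_setWeight (by decide) (by simp) (by simp [WeightExpr.safe]) ?_
    simp [Test.holds, WeightExpr.val, ht, hn, hk] at hc ⊢
    obtain ⟨c1, c2, c3⟩ := hc
    refine ⟨fun k' hk' => ?_, fun _ _ => ?_⟩
    · rcases eq_or_ne k' k with rfl | hne
      · simp
        exact ⟨c3, Or.inr ⟨_, hP t c1, _, by omega, by omega, le_rfl⟩⟩
      · simp [hne]
    · simp
  · refine (runs_skip ?_).mono (by norm_num) fun _ _ _ h => h
    simp [Test.holds, WeightExpr.val, ht, hn, hk] at hc ⊢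
    exact ⟨.refl _ _ _ _, fun h1 h2 => (hc h1 h2).le⟩

/-- For every output, tries the first `τ` members of the first group with a hit, and of the next
group. -/
def bruteP : Program :=
  .forLoop w_y (var w_n)
    (.ite (.wordLT 0 (.get w_first (var w_y)))
      (.forLoop w_i (var w_tau)
        (tryP (.get w_start (.get w_first (var w_y) - 1) + var w_i) ;;
         tryP (.get w_start (.get w_first (var w_y)) + var w_i)))
      .skip)

theorem runs_bruteP {n τ : ℕ} (hn : s.word w_n 0 = n) (hτ : s.word w_tau 0 = τ)
    (hn0 : 0 < n) (hτ0 : 0 < τ)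
    (hX : n + τ < X) (hP : ∀ t < n, s.word w_perm t < n)
    (hf : ∀ k < n, s.word w_first k ≠ 0 →
      s.word w_start (s.word w_first k - 1) ≤ n ∧ s.word w_start (s.word w_first k) ≤ n) :
    Runs X bruteP s (n * τ * 200000) (fun s' =>
      Improves n (s.weight x_A) (s.weight x_B) (s.weight x_D) (s'.weight x_D) ∧
      ∀ k < n, s.word w_first k ≠ 0 → ∀ u < τ,
        Tried n (s.weight x_A) (s.weight x_B) (s.word w_perm) (s'.weight x_D) k
          (s.word w_start (s.word w_first k - 1) + u) ∧
        Tried n (s.weight x_A) (s.weight x_B) (s.word w_perm) (s'.weight x_D) k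
          (s.word w_start (s.word w_first k) + u)) := by
  refine Runs.mono (t₁ := (n + 2) * (((τ + 2) * ((5000 + 5000) + 2003) + 1001) + 2003)) ?_ ?_
    (fun _ _ _ h => h)
  swap
  · calc (n + 2) * (((τ + 2) * ((5000 + 5000) + 2003) + 1001) + 2003)
        ≤ (3 * n) * (τ * 60000) := Nat.mul_le_mul (by omega) (by omega)
      _ = n * τ * 180000 := by ring
      _ ≤ _ := Nat.mul_le_mul_left _ (by norm_num)
  refine (runs_for (n := n) (fun k s' =>
    Improves n (s.weight x_A) (s.weight x_B) (s.weight x_D) (s'.weight x_D) ∧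
      ∀ k' < k, s.word w_first k' ≠ 0 → ∀ u < τ,
        Tried n (s.weight x_A) (s.weight x_B) (s.word w_perm) (s'.weight x_D) k'
          (s.word w_start (s.word w_first k' - 1) + u) ∧
        Tried n (s.weight x_A) (s.weight x_B) (s.word w_perm) (s'.weight x_D) k'
          (s.word w_start (s.word w_first k') + u)) (by decide) (by decide)
    (fun i s' hF _ => ?_) (fun k s' hk hs' hF hI hv => ?_) ?_ ?_)
  · simp [hF.1 w_n (by decide), hn]
  · obtain ⟨i1, i2⟩ := hI
    have k' : ∀ a, a ≠ w_y → a ≠ w_i → a ≠ w_v → s'.word a = s.word a := fun a h1 h2 h3 => by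
      funext x
      exact hF.1 a (by simp [Program.wordWrites, Program.forLoop, Program.setVar, tryP, *]) x
    have W' : ∀ a, a ≠ x_D → s'.weight a = s.weight a := fun a h1 => by
      funext x
      exact hF.2 a (by simp [Program.weightWrites, Program.forLoop, Program.setVar, tryP, *]) x
    refine runs_ite (by decide) (by simp [Test.safe]) (fun hc => ?_) (fun hc => ?_)
    · simp [Test.holds, hv, k'] at hc
      refine (runs_for (n := τ) (t := 5000 + 5000) (fun u s'' =>
        Improves n (s.weight x_A) (s.weight x_B) (s'.weight x_D) (s''.weight x_D) ∧
        ∀ u' < u,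
          Tried n (s.weight x_A) (s.weight x_B) (s.word w_perm) (s''.weight x_D) k
            (s.word w_start (s.word w_first k - 1) + u') ∧
          Tried n (s.weight x_A) (s.weight x_B) (s.word w_perm) (s''.weight x_D) k
            (s.word w_start (s.word w_first k) + u')) (by decide) (by decide)
        (fun i s'' hF' _ => ?_) (fun u s'' hu hs'' hF' hI' hv' => ?_) ?_ ?_).mono le_rfl
        fun s'' _ hF' h => ?_
      · simp [hF'.1 w_tau (by decide), k', hτ]
      · obtain ⟨j1, j2⟩ := hI'
        have k'' : ∀ a, a ≠ w_i → a ≠ w_v → s''.word a = s'.word a := fun a h2 h3 => by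
          funext x
          exact hF'.1 a (by simp [Program.wordWrites, Program.forLoop, Program.setVar, tryP, *]) x
        have W'' : ∀ a, a ≠ x_D → s''.weight a = s.weight a := fun a h1 => by
          rw [← W' a h1]
          funext x
          exact hF'.2 a (by simp [Program.weightWrites, Program.forLoop, Program.setVar, tryP, *]) x
        obtain ⟨f1, f2⟩ := hf k hk hc.ne'
        refine (runs_tryP (n := n) (k := k) (by simp [k'', k', hn]) (by simp [k'', hv]) hk
          (by decide) (by simp) rfl (by simp [k'', k', hv, hv']; omega)
          (by simpa [k'', k'] using hP)).seq fun s₁ hs₁ hF₁ ⟨a1, a2⟩ => ?_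
        have k₁ : ∀ a, a ≠ w_v → s₁.word a = s''.word a := fun a h3 => by
          funext x
          exact hF₁.1 a (by simp [Program.wordWrites, Program.setVar, tryP, *]) x
        have W₁ : ∀ a, a ≠ x_D → s₁.weight a = s''.weight a := fun a h1 => by
          funext x
          exact hF₁.2 a (by simp [Program.weightWrites, Program.setVar, tryP, *]) x
        refine (runs_tryP (n := n) (k := k) (by simp [k₁, k'', k', hn]) (by simp [k₁, k'', hv]) hk
          (by decide) (by simp) rfl (by simp [k₁, k'', k', hv, hv']; omega)
          (by simpa [k₁, k'', k'] using hP)).mono le_rfl fun s₂ _ _ ⟨b1, b2⟩ => ?_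
        simp [W₁, W'', k₁, k'', k', hv, hv'] at a1 a2 b1 b2
        simp only [State.weight_setWord]
        refine ⟨j1.trans (a1.trans b1), fun u' hu' => ?_⟩
        rcases Nat.lt_succ_iff_lt_or_eq.1 hu' with hu' | rfl
        · exact ⟨(j2 u' hu').1.mono hk (a1.trans b1), (j2 u' hu').2.mono hk (a1.trans b1)⟩
        · exact ⟨a2.mono hk b1, b2⟩
      · simp only [State.weight_setWord]
        exact ⟨.refl _ _ _ _, fun u hu => absurd hu (by omega)⟩
      · intro _; omega
      · simp only [State.weight_setWord]
        refine ⟨i1.trans h.1, fun k' hk' hf' u hu => ?_⟩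
        rcases Nat.lt_succ_iff_lt_or_eq.1 hk' with hk' | rfl
        · obtain ⟨a1, a2⟩ := i2 k' hk' hf' u hu
          exact ⟨a1.mono (by omega) h.1, a2.mono (by omega) h.1⟩
        · exact h.2 u hu
    · refine (runs_skip ?_).mono (by omega) fun _ _ _ h => h
      simp [Test.holds, hv, k'] at hc
      simp only [State.weight_setWord]
      refine ⟨i1, fun k' hk' hf' u hu => ?_⟩
      rcases Nat.lt_succ_iff_lt_or_eq.1 hk' with hk' | rfl
      · exact i2 k' hk' hf' u hu
      · exact absurd hc hf'
  · simp only [State.weight_setWord]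
    exact ⟨.refl _ _ _ _, fun u hu => absurd hu (by omega)⟩
  · intro _; omega

/-! ### One pass -/

theorem Groups.mono {n τ E m g : ℕ} {A B : ℕ → ℝ≥0∞} {P S f : ℕ → ℕ} {D : ℕ → ℝ≥0∞}
    (h : Groups n τ E m A B P S f D g) {i j : ℕ} (hij : i ≤ j) (hj : j ≤ g) : S i ≤ S j := by
  induction j, hij using Nat.le_induction with
  | base => exact le_rfl
  | succ j hij ih => exact (ih (by omega)).trans (h.lt j hj).le

/-- The best sum for `k` is found up to a factor of `1 + ε` if its larger term comes from `A`. -/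
theorem Groups.bound {n τ E m g : ℕ} {A B : ℕ → ℝ≥0∞} {P S f : ℕ → ℕ} {D D' : ℕ → ℝ≥0∞} {ε : ℝ≥0∞}
    (h : Groups n τ E m A B P S f D g) (hg : S g = m) (hmn : m ≤ n) (hP : SortedBy n A P)
    (hfin : ∀ t < m, A (P t) ≠ ∞) (hinf : ∀ t, m ≤ t → t < n → A (P t) = ∞)
    (hB : ∀ j < n, 1 ≤ B j) (hE : 0 < E) (hε : n ≤ τ ∨ 2 ≤ ε * E)
    (hD : Improves n A B D D')
    (htry : ∀ k < n, f k ≠ 0 → ∀ u < τ,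
      Tried n A B P D' k (S (f k - 1) + u) ∧ Tried n A B P D' k (S (f k) + u))
    {i j : ℕ} (hij : i + j < n) (hle : B j ≤ A i) (hi : A i ≠ ∞)
    (hopt : ∀ i' j', i' + j' = i + j → A i + B j ≤ A i' + B j') :
    D' (i + j) ≤ (1 + ε) * (A i + B j) := by
  have hE' : (E : ℝ≥0∞) ≠ 0 := by exact_mod_cast hE.ne'
  obtain ⟨t, ht, rfl⟩ := hP.surj i (by omega)
  have htm : t < m := by
    by_contra hc
    exact hi (hinf t (by omega) ht)
  obtain ⟨a, ha, ha1, ha2⟩ : ∃ a < g, S a ≤ t ∧ t < S (a + 1) := by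
    have hex : ∃ a, t < S a := ⟨g, by omega⟩
    classical
    have h1 := Nat.find_spec hex
    have h2 : Nat.find hex ≤ g := Nat.find_min' hex (by omega)
    have h3 : Nat.find hex ≠ 0 := fun h0 => by rw [h0, h.zero] at h1; omega
    refine ⟨Nat.find hex - 1, by omega, ?_, ?_⟩
    · have := Nat.find_min hex (m := Nat.find hex - 1) (by omega)
      omega
    · rwa [Nat.sub_add_cancel (by omega)]
  have hSm : ∀ b ≤ g, S b ≤ m := fun b hb => hg ▸ h.mono hb le_rfl
  have hAle : A (P t) ≤ A (P (S (a + 1) - 1)) :=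
    hP.mono _ _ (by omega) (by have := hSm (a + 1) ha; omega)
  have hhit : Hit n B P (S a) (S (a + 1)) (A (P (S (a + 1) - 1))) (P t + j) :=
    ⟨t, ha1, ha2, j, by omega, hle.trans hAle, rfl⟩
  obtain ⟨f1, f2⟩ := h.hit a ha _ hij hhit
  by_cases hl : τ < S (a + 1) - S a
  · refine (hD _ hij).1.trans ((h.near a ha hl t ha1 ha2 j (by omega) (hle.trans hAle) hij).trans ?_)
    have hε : 2 ≤ ε * E := hε.resolve_left (by have := hSm (a + 1) ha; omega)
    have h1 : A (P (S a)) ≤ A (P t) := hP.mono _ _ ha1 ht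
    have h2 : 2 * A (P (S a)) / E ≤ ε * A (P t) := by
      refine ENNReal.div_le_of_le_mul ?_
      calc 2 * A (P (S a)) ≤ ε * E * A (P t) := by gcongr
        _ = ε * A (P t) * E := by ring
    calc A (P t) + B j + 2 * A (P (S a)) / E ≤ A (P t) + B j + ε * (A (P t) + B j) := by
          gcongr
          exact h2.trans (by gcongr; exact le_self_add)
      _ = _ := by ring
  · -- the group of the optimal sum is the first group with a hit, or the next one
    have hab : a + 1 ≤ f (P t + j) + 1 := by
      by_contra hc
      obtain ⟨g1, t', t1, t2, j', j1, j2, hk⟩ := h.first _ hij f1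
      set b := f (P t + j) with hb
      have e1 : S b < S (b + 1) := h.lt b (by omega)
      have e2 : S (b + 1) ≤ S a := h.mono (by omega) ha.le
      have e3 : A (P t') ≤ A (P (S b - 1)) := hP.mono _ _ (by omega) (by omega)
      have e4 : A (P (S b - 1)) ≤ A (P (S b)) := hP.mono _ _ (by omega) (by omega)
      have e5 : 2 * A (P (S b)) ≤ A (P (S (b + 1))) := h.sep b (by omega) (by omega)
      have e6 : A (P (S (b + 1))) ≤ A (P t) := hP.mono _ _ (by omega) ht
      have e7 : A (P (S b - 1)) ≠ ∞ := hfin _ (by omega)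
      have e8 : 2 * A (P (S b - 1)) + 1 ≤ 2 * A (P (S b - 1)) :=
        calc 2 * A (P (S b - 1)) + 1 ≤ A (P t) + B j :=
              add_le_add (le_trans (by gcongr) (e5.trans e6)) (hB j (by omega))
          _ ≤ A (P t') + B j' := hopt _ _ hk
          _ ≤ A (P (S b - 1)) + A (P (S b - 1)) := add_le_add e3 j2
          _ = 2 * A (P (S b - 1)) := (two_mul _).symm
      exact absurd e8 (not_le.2 (ENNReal.lt_add_right (by finiteness) one_ne_zero))
    have hu : t - S a < τ := by omega
    obtain ⟨h1, h2⟩ := htry _ hij f1 _ hu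
    have key : Tried n A B P D' (P t + j) t := by
      rcases Nat.lt_or_ge a (f (P t + j)) with hlt | hge
      · have : f (P t + j) - 1 = a := by omega
        rw [this] at h1
        rwa [Nat.add_sub_cancel' ha1] at h1
      · have : f (P t + j) = a := by omega
        rw [this] at h2
        rwa [Nat.add_sub_cancel' ha1] at h2
    refine (key ht (by omega)).trans ?_
    rw [Nat.add_sub_cancel_left, add_mul, one_mul]
    exact le_self_add

/-- One pass: finds approximations for all outputs for which the larger term of the best sum comes
from `A`. -/
def passP : Program :=
  sortP ;;
  .setVar w_fin 0 ;;
  .while (.and (.wordLT (var w_fin) (var w_n))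
      (.not (.weightLE .infty (.get x_A (.get w_perm (var w_fin))))))
    (.setVar w_fin (var w_fin + 1)) ;;
  groupsP ;;
  bruteP

theorem passP_writes : (∀ a ∈ passP.wordWrites, 10 ≤ a) ∧
    ∀ a ∈ passP.weightWrites, a = x_D ∨ a = x_lo ∨ a = x_hi := by
  decide

theorem runs_passP {n τ E κ : ℕ} {ε : ℝ≥0∞} (hS : Setup n τ E κ X s)
    (hB : ∀ j < n, 1 ≤ s.weight x_B j) (hε : n ≤ τ ∨ 2 ≤ ε * E) :
    Runs X passP s (n * τ * 2000000 + (n / τ + 3) * (2 ^ κ * κ ^ 3 * (2 * 10 ^ 8))) (fun s' =>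
      Improves n (s.weight x_A) (s.weight x_B) (s.weight x_D) (s'.weight x_D) ∧
      ∀ i j, i + j < n → s.weight x_B j ≤ s.weight x_A i → s.weight x_A i ≠ ∞ →
        (∀ i' j', i' + j' = i + j →
          s.weight x_A i + s.weight x_B j ≤ s.weight x_A i' + s.weight x_B j') →
        s'.weight x_D (i + j) ≤ (1 + ε) * (s.weight x_A i + s.weight x_B j)) := by
  obtain ⟨b1, b2, b3, b4, b5, b6⟩ := hS.bounds
  have hn0 := hS.n_pos
  have hτ0 := hS.tau_pos
  refine Runs.mono (t₁ := n * τ * 10 ^ 6 + (1002 + ((n + 1) * (1002 + 1001) +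
    ((n / τ + 3) * (2 ^ κ * κ ^ 3 * (2 * 10 ^ 8)) + n * τ * 200000)))) ?_ ?_ (fun _ _ _ h => h)
  swap
  · have h1 : n * 1 ≤ n * τ := Nat.mul_le_mul_left _ hτ0
    omega
  have hnτ : n ≤ τ * τ := by
    have h1 : n * 1 ≤ n * E := Nat.mul_le_mul_left _ hS.E_pos
    have h2 := hS.le_sq
    omega
  refine (runs_sortP hS.n_eq hS.tau_eq hτ0 hnτ (by omega) hn0).seq fun s₁ hs₁ hF₁ h₁ => ?_
  have S₁ : Setup n τ E κ X s₁ := hS.congr fun a ha i => hF₁.1 a (fun h => by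
    have := (sortP_writes.1 a h).1; omega) i
  have W₁ : s₁.weight = s.weight := by
    funext a i; exact hF₁.2 a (by rw [sortP_writes.2]; exact List.not_mem_nil) i
  refine runs_setVar_seq (by decide) (by simp) (fun h => by rw [val_ofNat]; omega) ?_
  refine Runs.seq (R := fun s' => s'.word w_fin 0 ≤ n ∧
      (∀ t < s'.word w_fin 0, s.weight x_A (s₁.word w_perm t) ≠ ∞) ∧
      (∀ t, s'.word w_fin 0 ≤ t → t < n → s.weight x_A (s₁.word w_perm t) = ∞))
    ((runs_while (t := 1002) (b := .and (.wordLT (var w_fin) (var w_n))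
      (.not (.weightLE .infty (.get x_A (.get w_perm (var w_fin)))))) (by decide)
    (fun s' => s'.word w_fin 0 ≤ n ∧
      ∀ t < s'.word w_fin 0, s.weight x_A (s₁.word w_perm t) ≠ ∞)
    (fun s' => n - s'.word w_fin 0) (fun s' h => by simp [Test.safe, WeightExpr.safe])
    (fun s' hs' hF hI hb => ?_) ?_).mono (Nat.mul_le_mul_right _ (by omega))
      (fun s' _ hF h => ?_)) fun s₂ hs₂ hF₂ ⟨q1, q2, q3⟩ => ?_
  · have P' : s'.word w_perm = s₁.word w_perm := by
      funext x; rw [hF.1 _ (by decide)]; simp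
    have A' : s'.weight x_A = s.weight x_A := by
      funext x; rw [hF.2 _ (by decide), State.weight_setWord, W₁]
    have n' : s'.word w_n 0 = n := by rw [hF.1 _ (by decide)]; simp [S₁.n_eq]
    simp [Test.holds, WeightExpr.val, P', A', n'] at hb
    refine runs_setVar (by decide) (by simp) (fun h => by simp; omega) ?_
    obtain ⟨i1, i2⟩ := hI
    simp only [val_add, val_var, val_ofNat, State.word_setWord, and_self, if_true]
    refine ⟨⟨by omega, fun t ht => ?_⟩, by omega⟩
    rcases Nat.lt_succ_iff_lt_or_eq.1 ht with ht | rfl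
    · exact i2 t ht
    · exact hb.2
  · simp
  · have P' : s'.word w_perm = s₁.word w_perm := by
      funext x; rw [hF.1 _ (by decide)]; simp
    have A' : s'.weight x_A = s.weight x_A := by
      funext x; rw [hF.2 _ (by decide), State.weight_setWord, W₁]
    have n' : s'.word w_n 0 = n := by rw [hF.1 _ (by decide)]; simp [S₁.n_eq]
    obtain ⟨⟨i1, i2⟩, hb⟩ := h
    simp [Test.holds, WeightExpr.val, P', A', n'] at hb
    refine ⟨i1, i2, fun t h1 h2 => top_le_iff.1 ?_⟩
    rw [← hb (by omega)]
    exact h₁.mono _ _ h1 h2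
  have S₂ : Setup n τ E κ X s₂ := S₁.congr fun a ha i => by
    rw [hF₂.1 a (by revert a; decide)]; simp [show a ≠ 48 by omega]
  have W₂ : s₂.weight = s.weight := by
    funext a i
    rw [hF₂.2 a (by simp [Program.weightWrites, Program.setVar]), State.weight_setWord, W₁]
  have P₂ : s₂.word w_perm = s₁.word w_perm := by funext x; rw [hF₂.1 _ (by decide)]; simp
  refine (runs_groupsP S₂ rfl q1 (by rw [W₂, P₂]; exact h₁)).seq fun s₃ hs₃ hF₃ h₃ => ?_
  obtain ⟨⟨g, hG, hg⟩, hD⟩ := h₃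
  have S₃ : Setup n τ E κ X s₃ := S₂.congr fun a ha i => hF₃.1 a (fun h => by
    have := groupsP_writes.1 a h; omega) i
  have W₃ : ∀ a, a < 3 → s₃.weight a = s.weight a := fun a ha => by
    funext i; rw [hF₃.2 a (fun h => by have := groupsP_writes.2 a h; omega), W₂]
  have P₃ : s₃.word w_perm = s₁.word w_perm := by
    funext x; rw [hF₃.1 _ (by decide), P₂]
  have hSn : ∀ b ≤ g, s₃.word w_start b ≤ n := fun b hb => (hG.mono hb le_rfl).trans (hg.trans_le q1)
  refine (runs_bruteP S₃.n_eq S₃.tau_eq hn0 hτ0 (by omega) (by rw [P₃]; exact h₁.lt)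
    (fun k hk hf => ?_)).mono le_rfl fun s₄ _ _ ⟨h4, h5⟩ => ?_
  · have := (hG.first k hk hf).1
    exact ⟨hSn _ (by omega), hSn _ this⟩
  · rw [W₃ _ (by decide), W₃ _ (by decide)] at h4 h5
    rw [W₂, P₂] at hG
    rw [W₂] at hD
    rw [P₃] at h5
    refine ⟨hD.trans h4, fun i j hij h1 h2 h3 => ?_⟩
    exact hG.bound hg q1 h₁ q2 q3 hB hS.E_pos hε h4 h5 hij h1 h2 h3

/-! ### The parameters -/

/-- Chooses the parameters: `E` is the least resolution that suffices for the precision `ε`, but at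
most `2 n`; then `τ ^ 2 ≥ n E`, and finally the length of the convolutions. -/
def initP : Program :=
  .setVar w_E 1 ;;
  .while (.and (.wordLT (var w_E) (2 * var w_n))
      (.not (.weightLE (.add .one .one) (.mulWord (.get x_eps 0) (var w_E)))))
    (.setVar w_E (var w_E + 1)) ;;
  .setVar w_tau 1 ;;
  .while (.wordLT (var w_tau * var w_tau) (var w_n * var w_E)) (.setVar w_tau (var w_tau + 1)) ;;
  .setVar w_N 2 ;; .setVar w_logN 1 ;; .setWord w_pow 0 1 ;; .setWord w_pow 1 2 ;;
  .while (.wordLT (var w_N) (4 * var w_n * (2 * var w_E + 1)))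
    (.setVar w_N (2 * var w_N) ;; .setVar w_logN (var w_logN + 1) ;;
     .setWord w_pow (var w_logN) (var w_N)) ;;
  .setVar w_M (2 * var w_N + 1) ;;
  .forLoop w_i (var w_n) (.setWeight x_D (var w_i) .infty)

/-- The relations between the parameters that determine the running time and the precision. -/
structure Params (n τ E κ : ℕ) (ε : ℝ≥0∞) : Prop where
  E_le : E ≤ 2 * n
  eps_mul : ε * E ≤ 3
  prec : n ≤ τ ∨ 2 ≤ ε * E
  tau_le : τ ≤ 2 * n
  sq_le : τ * τ ≤ 4 * (n * E)
  N_le : 2 ^ κ ≤ 2 * (4 * n * (2 * E + 1))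

/-- The lengths of the convolutions are polynomial in `n`, so that words of `O(log n)` bits suffice. -/
theorem pow_bound {n E κ : ℕ} (hn : 1 ≤ n) (hE : E ≤ 2 * n)
    (hκ : 2 ^ κ ≤ 2 * (4 * n * (2 * E + 1))) : 8 * κ * 2 ^ κ < (n + 2) ^ 16 := by
  have h1 : 2 ^ κ ≤ 40 * (n + 2) ^ 2 := by
    have : 2 * (4 * n * (2 * E + 1)) ≤ 2 * (4 * n * (2 * (2 * n) + 1)) := by gcongr
    nlinarith
  have h2 : κ ≤ 2 ^ κ := Nat.lt_two_pow_self.le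
  calc 8 * κ * 2 ^ κ ≤ 8 * 2 ^ κ * 2 ^ κ := by gcongr
    _ ≤ 8 * (40 * (n + 2) ^ 2) * (40 * (n + 2) ^ 2) := by gcongr
    _ = 12800 * (n + 2) ^ 4 := by ring
    _ < 3 ^ 12 * (n + 2) ^ 4 := by
        have : 0 < (n + 2) ^ 4 := by positivity
        exact Nat.mul_lt_mul_of_pos_right (by norm_num) this
    _ ≤ (n + 2) ^ 12 * (n + 2) ^ 4 := by gcongr; omega
    _ = (n + 2) ^ 16 := by ring

theorem runs_initP {n : ℕ} {ε : ℝ≥0∞} (hn : s.word w_n 0 = n) (hn0 : 1 ≤ n)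
    (hε : s.weight x_eps 0 = ε) (hε1 : ε ≤ 1) (hX : X = (n + 2) ^ 16) :
    Runs X initP s (n * 10 ^ 6) (fun s' => (∃ τ E κ, Params n τ E κ ε ∧ Setup n τ E κ X s') ∧
      ∀ k < n, s'.weight x_D k = ∞) := by
  have hX' : 4 * n + 8 ≤ X := by
    rw [hX]
    calc 4 * n + 8 = (n + 2) * 4 := by ring
      _ ≤ (n + 2) * (n + 2) ^ 15 := by
        gcongr
        calc 4 ≤ 2 ^ 15 := by norm_num
          _ ≤ (n + 2) ^ 15 := by gcongr; omega
      _ = (n + 2) ^ 16 := by ring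
  refine Runs.mono (t₁ := 1002 + ((2 * n + 1) * (1002 + 1001) + (1002 + ((2 * n + 1) *
    (1002 + 1001) + (1002 + (1002 + (2001 + (2001 + ((8 * n + 1) * ((1002 + (1002 + 2001)) + 1001)
    + (1002 + (n + 2) * (2001 + 2003)))))))))))
    ?_ (by omega) (fun _ _ _ h => h)
  refine runs_setVar_seq (by decide) (by simp) (fun h => by rw [val_ofNat]; omega) ?_
  -- the resolution
  refine Runs.seq (R := fun s' => 1 ≤ s'.word w_E 0 ∧ s'.word w_E 0 ≤ 2 * n ∧
      ε * s'.word w_E 0 ≤ 3 ∧ (2 * n ≤ s'.word w_E 0 ∨ 2 ≤ ε * s'.word w_E 0))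
    ((runs_while (t := 1002) (b := .and (.wordLT (var w_E) (2 * var w_n))
      (.not (.weightLE (.add .one .one) (.mulWord (.get x_eps 0) (var w_E))))) (by decide)
    (fun s' => 1 ≤ s'.word w_E 0 ∧ s'.word w_E 0 ≤ 2 * n ∧ ε * s'.word w_E 0 ≤ 3)
    (fun s' => 2 * n - s'.word w_E 0) (fun s' h => ?_)
    (fun s' hs' hF hI hb => ?_) ?_).mono (Nat.mul_le_mul_right _ (by omega))
      (fun s' _ hF h => ?_)) fun s₁ hs₁ hF₁ h₁ => ?_
  · simp [Test.safe, WeightExpr.safe]; omega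
  · have n' : s'.word w_n 0 = n := by rw [hF.1 _ (by decide)]; simp [hn]
    have ε' : s'.weight x_eps 0 = ε := by
      rw [hF.2 _ (by simp [Program.weightWrites, Program.setVar]), State.weight_setWord, hε]
    simp [Test.holds, WeightExpr.val, n', ε', one_add_one_eq_two] at hb
    refine runs_setVar (by decide) (by simp) (fun h => by simp; omega) ?_
    obtain ⟨i1, i2, i3⟩ := hI
    simp only [val_add, val_var, val_ofNat, State.word_setWord, and_self, if_true]
    refine ⟨⟨by omega, by omega, ?_⟩, by omega⟩
    push_cast
    calc ε * (s'.word w_E 0 + 1) = ε * s'.word w_E 0 + ε := by ring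
      _ ≤ 2 + 1 := add_le_add hb.2.le hε1
      _ = 3 := by norm_num
  · simp
    exact ⟨by omega, hε1.trans (by norm_num)⟩
  · have n' : s'.word w_n 0 = n := by rw [hF.1 _ (by decide)]; simp [hn]
    have ε' : s'.weight x_eps 0 = ε := by
      rw [hF.2 _ (by simp [Program.weightWrites, Program.setVar]), State.weight_setWord, hε]
    obtain ⟨⟨i1, i2, i3⟩, hb⟩ := h
    simp [Test.holds, WeightExpr.val, n', ε', one_add_one_eq_two] at hb
    refine ⟨i1, i2, i3, ?_⟩
    rcases Nat.lt_or_ge (s'.word w_E 0) (2 * n) with h | h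
    · exact Or.inr (hb h)
    · exact Or.inl h
  have n₁ : s₁.word w_n 0 = n := by rw [hF₁.1 _ (by decide)]; simp [hn]
  obtain ⟨e1, e2, e3, e4⟩ := h₁
  set E := s₁.word w_E 0 with hE
  have hnE : n * E ≤ 2 * (n * n) := by
    calc n * E ≤ n * (2 * n) := Nat.mul_le_mul_left _ e2
      _ = 2 * (n * n) := by ring
  have hnE1 : 1 ≤ n * E := Nat.mul_pos hn0 e1
  refine runs_setVar_seq (by decide) (by simp) (fun h => by rw [val_ofNat]; omega) ?_
  -- the size of the groups
  refine Runs.seq (R := fun s' => 1 ≤ s'.word w_tau 0 ∧ s'.word w_tau 0 ≤ 2 * n ∧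
      s'.word w_tau 0 * s'.word w_tau 0 ≤ 4 * (n * E) ∧ s'.word w_tau 0 ≤ n * E ∧
      n * E ≤ s'.word w_tau 0 * s'.word w_tau 0)
    ((runs_while (t := 1002) (b := .wordLT (var w_tau * var w_tau) (var w_n * var w_E)) (by decide)
    (fun s' => 1 ≤ s'.word w_tau 0 ∧ s'.word w_tau 0 ≤ 2 * n ∧
      s'.word w_tau 0 * s'.word w_tau 0 ≤ 4 * (n * E) ∧ s'.word w_tau 0 ≤ n * E)
    (fun s' => 2 * n - s'.word w_tau 0) (fun s' h => by simp [Test.safe])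
    (fun s' hs' hF hI hb => ?_) ?_).mono (Nat.mul_le_mul_right _ (by omega))
      (fun s' _ hF h => ?_)) fun s₂ hs₂ hF₂ h₂ => ?_
  · have n' : s'.word w_n 0 = n := by rw [hF.1 _ (by decide)]; simp [n₁]
    have E' : s'.word w_E 0 = E := by rw [hF.1 _ (by decide)]; simp [hE]
    simp [Test.holds, n', E'] at hb
    obtain ⟨i1, i2, i3, i4⟩ := hI
    have hlt : s'.word w_tau 0 < 2 * n := by
      by_contra hc
      have : (2 * n) * (2 * n) ≤ s'.word w_tau 0 * s'.word w_tau 0 :=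
        Nat.mul_le_mul (by omega) (by omega)
      have h3 : (2 * n) * (2 * n) = 4 * (n * n) := by ring
      omega
    refine runs_setVar (by decide) (by simp) (fun h => by simp; omega) ?_
    simp only [val_add, val_var, val_ofNat, State.word_setWord, and_self, if_true]
    generalize s'.word w_tau 0 = τ at *
    have h1 : 1 * τ ≤ τ * τ := Nat.mul_le_mul_right _ i1
    have h2 : (τ + 1) * (τ + 1) = τ * τ + 2 * τ + 1 := by ring
    exact ⟨⟨by omega, by omega, by omega, by omega⟩, by omega⟩
  · simp
    omega
  · have n' : s'.word w_n 0 = n := by rw [hF.1 _ (by decide)]; simp [n₁]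
    have E' : s'.word w_E 0 = E := by rw [hF.1 _ (by decide)]; simp [hE]
    obtain ⟨⟨i1, i2, i3, i4⟩, hb⟩ := h
    simp [Test.holds, n', E'] at hb
    exact ⟨i1, i2, i3, i4, hb⟩
  have n₂ : s₂.word w_n 0 = n := by rw [hF₂.1 _ (by decide)]; simp [n₁]
  have E₂ : s₂.word w_E 0 = E := by rw [hF₂.1 _ (by decide)]; simp [hE]
  obtain ⟨t1, t2, t3, t4, t5⟩ := h₂
  set τ := s₂.word w_tau 0 with hτ
  refine runs_setVar_seq (by decide) (by simp) (fun h => by rw [val_ofNat]; omega) ?_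
  refine runs_setVar_seq (by decide) (by simp) (fun h => by rw [val_ofNat]; omega) ?_
  refine runs_setWord_seq (by decide) (by simp) (by simp) (fun h => by rw [val_ofNat]; omega) ?_
  refine runs_setWord_seq (by decide) (by simp) (by simp) (fun h => by rw [val_ofNat]; omega) ?_
  simp only [val_ofNat]
  set s₃ := (((s₂.setWord w_N 0 2).setWord w_logN 0 1).setWord w_pow 0 1).setWord w_pow 1 2 with hs₃
  -- the length of the convolutions
  have hH : 4 * n * (2 * E + 1) ≤ 2 ^ (8 * n) := by
    have h1 : n ≤ 2 ^ n := Nat.lt_two_pow_self.le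
    calc 4 * n * (2 * E + 1) = 8 * (n * E) + 4 * n := by ring
      _ ≤ 8 * (2 * (n * n)) + 4 * (n * n) := by
        gcongr
        exact Nat.le_mul_of_pos_right n hn0
      _ = 20 * (n * n) := by ring
      _ ≤ 2 ^ 6 * (2 ^ n * 2 ^ n) := by gcongr; norm_num
      _ ≤ (2 ^ n) ^ 6 * (2 ^ n * 2 ^ n) := by
        gcongr
        exact Nat.le_self_pow (by omega) 2
      _ = 2 ^ (8 * n) := by rw [← pow_two, ← pow_add, ← pow_mul]; congr 1; ring
  refine Runs.seq (R := fun s' => ∃ κ, 1 ≤ κ ∧ s'.word w_N 0 = 2 ^ κ ∧ s'.word w_logN 0 = κ ∧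
      PowTable κ s' ∧ 2 ^ κ ≤ 2 * (4 * n * (2 * E + 1)) ∧ 4 * n * (2 * E + 1) ≤ 2 ^ κ)
    ((runs_while (s := s₃) (t := 1002 + (1002 + 2001))
    (b := .wordLT (var w_N) (4 * var w_n * (2 * var w_E + 1)))
    (by decide)
    (fun s' => 1 ≤ s'.word w_logN 0 ∧ s'.word w_N 0 = 2 ^ s'.word w_logN 0 ∧
      PowTable (s'.word w_logN 0) s' ∧ 2 ^ s'.word w_logN 0 ≤ 2 * (4 * n * (2 * E + 1)))
    -- linear in `n`, as the length is at most `2 ^ (8 n)`; only linear time is available here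
    (fun s' => 8 * n - s'.word w_logN 0) (fun s' h => by simp [Test.safe])
    (fun s' hs' hF hI hb => ?_) ?_).mono (Nat.mul_le_mul_right _ (by omega))
      (fun s' _ hF h => ?_)) fun s₄ hs₄ hF₄ h₄ => ?_
  · have n' : s'.word w_n 0 = n := by rw [hF.1 _ (by decide)]; simp [n₂, hs₃]
    have E' : s'.word w_E 0 = E := by rw [hF.1 _ (by decide)]; simp [E₂, hs₃]
    obtain ⟨i1, i2, i3, i4⟩ := hI
    simp [Test.holds, n', E', i2] at hb
    generalize hκ : s'.word w_logN 0 = κ at *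
    have hlt : κ < 8 * n := (Nat.pow_lt_pow_iff_right (by norm_num)).1 (hb.trans_le hH)
    have hb2 : 2 ^ (κ + 1) ≤ 2 * (4 * n * (2 * E + 1)) := by rw [pow_succ]; omega
    have hpb := pow_bound hn0 e2 hb2
    rw [← hX] at hpb
    have hκX : 8 * 1 * 2 ^ (κ + 1) ≤ 8 * (κ + 1) * 2 ^ (κ + 1) := by gcongr; omega
    have hκ' : κ + 1 < 2 ^ (κ + 1) := Nat.lt_two_pow_self
    have e2N : 2 * 2 ^ κ = 2 ^ (κ + 1) := by rw [pow_succ, mul_comm]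
    refine runs_setVar_seq (by decide) (by simp) (fun h => by simp [i2]; omega) ?_
    refine runs_setVar_seq (by decide) (by simp) (fun h => by simp [hκ]; omega) ?_
    refine runs_setWord (by decide) (by simp) (by simp) (fun h => h.2 _ _) ?_
    simp [hκ, i2, e2N]
    refine ⟨⟨fun i hi => ?_, hb2⟩, by omega⟩
    simp
    split_ifs with h
    · rw [h]
    · exact i3 i (by omega)
  · refine ⟨by simp [hs₃], by simp [hs₃], fun i hi => ?_, ?_⟩
    · simp [hs₃] at hi ⊢
      interval_cases i <;> simp
    · have h1 : 8 * n * 1 ≤ 8 * n * (2 * E + 1) := Nat.mul_le_mul_left _ (by omega)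
      have h2 : 2 * (4 * n * (2 * E + 1)) = 8 * n * (2 * E + 1) := by ring
      simp only [hs₃, State.word_setWord, Nat.reduceEqDiff, false_and, if_false, and_self, if_true]
      omega
  · have n' : s'.word w_n 0 = n := by rw [hF.1 _ (by decide)]; simp [n₂, hs₃]
    have E' : s'.word w_E 0 = E := by rw [hF.1 _ (by decide)]; simp [E₂, hs₃]
    obtain ⟨⟨i1, i2, i3, i4⟩, hb⟩ := h
    simp [Test.holds, n', E', i2] at hb
    exact ⟨_, i1, i2, rfl, i3, i4, hb⟩
  obtain ⟨κ, k1, k2, k3, k4, k5, k6⟩ := h₄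
  have n₄ : s₄.word w_n 0 = n := by rw [hF₄.1 _ (by decide)]; simp [n₂, hs₃]
  have E₄ : s₄.word w_E 0 = E := by rw [hF₄.1 _ (by decide)]; simp [E₂, hs₃]
  have τ₄ : s₄.word w_tau 0 = τ := by rw [hF₄.1 _ (by decide)]; simp [← hτ, hs₃]
  have hpb := pow_bound hn0 e2 k5
  rw [← hX] at hpb
  have hκX : 8 * 1 * 2 ^ κ ≤ 8 * κ * 2 ^ κ := by gcongr
  refine runs_setVar_seq (by decide) (by simp) (fun h => by simp [k2]; omega) ?_
  refine (runs_for (n := n) (fun i s' => ∀ k < i, s'.weight x_D k = ∞) (by decide) (by decide)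
    (fun i s' hF _ => ?_) (fun i s' hi hs' hF hI hv => ?_) ?_ ?_).mono le_rfl
    fun s₅ _ hF₅ h₅ => ⟨⟨τ, E, κ, ⟨e2, e3, ?_, t2, t3, k5⟩, ?_⟩, h₅⟩
  · simp [hF.1 w_n (by decide), n₄]
  · refine runs_setWeight (by decide) (by simp) trivial fun k hk => ?_
    rw [State.weight_setWord, State.weight_setWeight]
    split_ifs with h
    · rfl
    · refine hI k (lt_of_le_of_ne (by omega) fun h' => h ⟨rfl, ?_⟩)
      rw [h', val_var, hv]
  · intro k hk; omega
  · intro _; omega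
  · refine e4.imp_left fun h => ?_
    by_contra hc
    have h1 : τ * τ < n * n := Nat.mul_lt_mul'' (by omega) (by omega)
    have h2 : n * (2 * n) ≤ n * E := Nat.mul_le_mul_left _ h
    have h3 : n * (2 * n) = 2 * (n * n) := by ring
    omega
  · have fr : ∀ a, a < 10 → ∀ i, s₅.word a i =
        if a = w_M ∧ i = 0 then 2 * 2 ^ κ + 1 else s₄.word a i := fun a ha i => by
      rw [hF₅.1 a (by revert a; decide)]; simp [k2]
    exact {
      n_eq := by simp [fr, n₄]
      E_eq := by simp [fr, E₄]
      tau_eq := by simp [fr, τ₄]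
      N_eq := by simp [fr, k2]
      log_eq := by simp [fr, k3]
      M_eq := by simp [fr]
      pow := fun i hi => by simp [fr, k4 i hi]
      n_pos := hn0
      E_pos := e1
      tau_pos := t1
      log_pos := k1
      le_N := k6
      le_sq := t5
      tau_le := t4
      lt_X := hpb }

/-! ### The algorithm -/

/-- Exchanges the two input sequences. -/
def swapP : Program :=
  .forLoop w_i (var w_n)
    (.setWeight x_tmp 0 (.get x_A (var w_i)) ;;
     .setWeight x_A (var w_i) (.get x_B (var w_i)) ;;
     .setWeight x_B (var w_i) (.get x_tmp 0))

theorem runs_swapP {n : ℕ} (hn : s.word w_n 0 = n) (hX : n < X) :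
    Runs X swapP s ((n + 2) * 10000) (fun s' => ∀ k < n,
      s'.weight x_A k = s.weight x_B k ∧ s'.weight x_B k = s.weight x_A k) := by
  refine (runs_for (n := n) (t := 2001 + (2001 + 2001)) (fun i s' => ∀ k,
    s'.weight x_A k = (if k < i then s.weight x_B k else s.weight x_A k) ∧
    s'.weight x_B k = (if k < i then s.weight x_A k else s.weight x_B k)) (by decide) (by decide)
    (fun i s' hF _ => ?_) (fun i s' hi hs' hF hI hv => ?_) ?_ ?_).mono
    (Nat.mul_le_mul_left _ (by norm_num)) fun s' _ _ h k hk => ?_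
  · simp [hF.1 w_n (by decide), hn]
  · refine runs_setWeight_seq (by decide) (by simp) (by simp [WeightExpr.safe]) ?_
    refine runs_setWeight_seq (by decide) (by simp) (by simp [WeightExpr.safe]) ?_
    refine runs_setWeight (by decide) (by simp) (by simp [WeightExpr.safe]) fun k => ?_
    have h1 := hI k
    simp [WeightExpr.val, hv]
    rcases lt_trichotomy k i with h | h | h
    · simpa [h.ne, h, h.le] using h1
    · subst h
      simp [hI]
    · simpa [h.ne', h.not_gt, show ¬ k ≤ i by omega] using h1
  · simp
  · intro _; exact hX
  · simpa [hk] using h k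

/-- The whole algorithm. -/
def convApproxP : Program := initP ;; passP ;; swapP ;; passP

/-- The notion is symmetric in the two sequences. -/
theorem Improves.swap {n : ℕ} {A B A' B' D D' : ℕ → ℝ≥0∞} (h : Improves n A B D D')
    (hA : ∀ k < n, A' k = B k) (hB : ∀ k < n, B' k = A k) : Improves n A' B' D D' := fun k hk => by
  obtain ⟨h1, h2⟩ := h k hk
  refine ⟨h1, h2.imp_right fun ⟨i, hi, j, hj, hij, hle⟩ => ⟨j, hj, i, hi, by omega, ?_⟩⟩
  rw [hA j hj, hB i hi, add_comm]
  exact hle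

/-- The running time in terms of the parameters. -/
theorem Params.time {n τ E κ : ℕ} {ε : ℝ≥0∞} (h : Params n τ E κ ε) (hτ : 0 < τ) (hκ : 0 < κ)
    (hE : 0 < E) (hn : 0 < n) (hsq : n * E ≤ τ * τ) :
    n * 10 ^ 6 + ((n * τ * 2000000 + (n / τ + 3) * (2 ^ κ * κ ^ 3 * (2 * 10 ^ 8))) +
      ((n + 2) * 10000 + (n * τ * 2000000 + (n / τ + 3) * (2 ^ κ * κ ^ 3 * (2 * 10 ^ 8))))) ≤
      10 ^ 12 * (n * τ * κ ^ 3) := by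
  have h1 : 2 ^ κ ≤ 24 * (τ * τ) :=
    calc 2 ^ κ ≤ 2 * (4 * n * (2 * E + 1)) := h.N_le
      _ ≤ 2 * (4 * n * (3 * E)) := by gcongr; omega
      _ = 24 * (n * E) := by ring
      _ ≤ _ := by gcongr
  have h2 : (n / τ + 3) * 2 ^ κ ≤ 168 * (n * τ) :=
    calc (n / τ + 3) * 2 ^ κ ≤ (n / τ + 3) * (24 * (τ * τ)) := by gcongr
      _ = 24 * ((n / τ * τ) * τ + 3 * τ * τ) := by ring
      _ ≤ 24 * (n * τ + 3 * (2 * n) * τ) := by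
        gcongr
        exacts [Nat.div_mul_le_self n τ, h.tau_le]
      _ = 168 * (n * τ) := by ring
  have h3 : 1 ≤ κ ^ 3 := Nat.one_le_pow _ _ hκ
  have h4 : (n / τ + 3) * (2 ^ κ * κ ^ 3 * (2 * 10 ^ 8)) ≤ 168 * (n * τ) * (κ ^ 3 * (2 * 10 ^ 8)) :=
    calc (n / τ + 3) * (2 ^ κ * κ ^ 3 * (2 * 10 ^ 8))
        = (n / τ + 3) * 2 ^ κ * (κ ^ 3 * (2 * 10 ^ 8)) := by ring
      _ ≤ _ := by gcongr
  have h5 : n * 1 ≤ n * τ := by gcongr; exact hτ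
  have h6 : n * τ * 1 ≤ n * τ * κ ^ 3 := by gcongr
  linarith

/-- The number `T` bounds the running time for all parameters that the first part of the program may
choose. -/
theorem runs_convApproxP {n T : ℕ} {ε : ℝ≥0∞} (hn : s.word w_n 0 = n) (hn0 : 1 ≤ n)
    (hε : s.weight x_eps 0 = ε) (hε1 : ε ≤ 1) (hX : X = (n + 2) ^ 16)
    (hA : ∀ i < n, 1 ≤ s.weight x_A i) (hB : ∀ i < n, 1 ≤ s.weight x_B i)
    (hT₀ : n * 10 ^ 6 ≤ T)
    (hT : ∀ τ E κ, Params n τ E κ ε → 0 < κ → 10 ^ 12 * (n * τ * κ ^ 3) ≤ T) :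
    Runs X convApproxP s T (fun s' => ∀ k < n,
      (s'.weight x_D k = ∞ ∨
        ∃ i < n, ∃ j < n, i + j = k ∧ s.weight x_A i + s.weight x_B j ≤ s'.weight x_D k) ∧
      ∀ i j, i + j = k → s.weight x_A i ≠ ∞ → s.weight x_B j ≠ ∞ →
        (∀ i' j', i' + j' = i + j →
          s.weight x_A i + s.weight x_B j ≤ s.weight x_A i' + s.weight x_B j') →
        s'.weight x_D k ≤ (1 + ε) * (s.weight x_A i + s.weight x_B j)) := by
  refine Runs.mono (t₁ := n * 10 ^ 6 + (T - n * 10 ^ 6)) ?_ (Nat.add_sub_cancel' hT₀).le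
    (fun _ _ _ h => h)
  refine (runs_initP hn hn0 hε hε1 hX).seq fun s₁ hs₁ hF₁ ⟨⟨τ, E, κ, hp, S₁⟩, hD₁⟩ => ?_
  have hT := hT τ E κ hp S₁.log_pos
  have ht := hp.time S₁.tau_pos S₁.log_pos S₁.E_pos hn0 S₁.le_sq
  obtain ⟨b1, b2, b3, b4, b5, b6⟩ := S₁.bounds
  refine Runs.mono (t₁ := (n * τ * 2000000 + (n / τ + 3) * (2 ^ κ * κ ^ 3 * (2 * 10 ^ 8))) +
      ((n + 2) * 10000 + (n * τ * 2000000 + (n / τ + 3) * (2 ^ κ * κ ^ 3 * (2 * 10 ^ 8))))) ?_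
      (Nat.le_sub_of_add_le' (ht.trans hT)) (fun _ _ _ h => h)
  have W₁ : ∀ a, a ≠ x_D → s₁.weight a = s.weight a := fun a ha => by
    funext i
    exact hF₁.2 a (by simpa [initP, Program.weightWrites, Program.setVar, Program.forLoop]) i
  refine (runs_passP S₁ (by rw [W₁ _ (by decide)]; exact hB) hp.prec).seq
    fun s₂ hs₂ hF₂ ⟨p1, p2⟩ => ?_
  have S₂ : Setup n τ E κ X s₂ := S₁.congr fun a ha i => hF₂.1 a (fun h => by
    have := passP_writes.1 a h; omega) i
  have W₂ : ∀ a, a < 3 → s₂.weight a = s.weight a := fun a ha => by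
    rw [← W₁ a (by omega)]
    funext i; exact hF₂.2 a (fun h => by have := passP_writes.2 a h; omega) i
  refine (runs_swapP S₂.n_eq (by omega)).seq fun s₃ hs₃ hF₃ h₃ => ?_
  have S₃ : Setup n τ E κ X s₃ := S₂.congr fun a ha i => hF₃.1 a (by revert a; decide) i
  have D₃ : s₃.weight x_D = s₂.weight x_D := by funext i; exact hF₃.2 _ (by decide) i
  rw [W₂ _ (by decide), W₂ _ (by decide)] at h₃
  refine (runs_passP S₃ (fun j hj => by rw [(h₃ j hj).2]; exact hA j hj) hp.prec).mono le_rfl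
    fun s₄ _ _ ⟨q1, q2⟩ k hk => ?_
  rw [W₁ _ (by decide), W₁ _ (by decide)] at p1 p2
  rw [D₃] at q1
  have q1' : Improves n (s.weight x_A) (s.weight x_B) (s₂.weight x_D) (s₄.weight x_D) :=
    q1.swap (fun k hk => (h₃ k hk).2.symm) (fun k hk => (h₃ k hk).1.symm)
  refine ⟨?_, ?_⟩
  · rcases ((p1.trans q1') k hk).2 with h | h
    · exact Or.inl (h.trans (hD₁ k hk))
    · exact Or.inr h
  · rintro i j rfl hi hj hopt
    rcases le_total (s.weight x_B j) (s.weight x_A i) with h | h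
    · exact (q1 _ hk).1.trans (p2 i j hk h hi hopt)
    · have e1 : s₃.weight x_A j = s.weight x_B j := (h₃ j (by omega)).1
      have e2 : s₃.weight x_B i = s.weight x_A i := (h₃ i (by omega)).2
      have := q2 j i (by omega) (by rwa [e1, e2]) (by rwa [e1]) fun j' i' hij => by
        rw [e1, e2, (h₃ j' (by omega)).1, (h₃ i' (by omega)).2, add_comm (s.weight x_B j),
          add_comm (s.weight x_B j')]
        exact hopt i' j' (by omega)
      rwa [e1, e2, add_comm j i, add_comm (s.weight x_B j)] at this

end Group
end RAM

open RAM RAM.Group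

/-- The minimum is attained. -/
theorem exists_minPlusConv_eq {n : ℕ} (A B : Fin n → ℝ≥0∞) (k : Fin n) :
    ∃ i j, i + j = (k : ℕ) ∧ minPlusConv A B k = arrayOf A i + arrayOf B j ∧
      ∀ i' j', i' + j' = (k : ℕ) → arrayOf A i + arrayOf B j ≤ arrayOf A i' + arrayOf B j' := by
  obtain ⟨⟨i, j⟩, hij, hmin⟩ := Finset.exists_min_image (Finset.HasAntidiagonal.antidiagonal (k : ℕ))
    (fun p => arrayOf A p.1 + arrayOf B p.2) ⟨(0, k), by simp⟩
  have key : ∀ i' j', i' + j' = (k : ℕ) →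
      arrayOf A i + arrayOf B j ≤ arrayOf A i' + arrayOf B j' := fun i' j' h =>
    hmin (i', j') (Finset.HasAntidiagonal.mem_antidiagonal.2 h)
  have hij : i + j = k := Finset.HasAntidiagonal.mem_antidiagonal.1 hij
  have hk := k.2
  refine ⟨i, j, hij, le_antisymm ?_ ?_, key⟩
  · refine (iInf_le_of_le ⟨i, by omega⟩ (iInf_le_of_le ⟨j, by omega⟩ (iInf_le_of_le hij ?_)))
    simp [arrayOf, show i < n by omega, show j < n by omega]
  · refine le_iInf fun i' => le_iInf fun j' => le_iInf fun h => (key i' j' h).trans ?_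
    simp [arrayOf]

theorem sq_rpow_div_sqrt (n : ℕ) {ε : ℝ} (hε : 0 < ε) :
    ((n : ℝ) ^ (3 / 2 : ℝ) / Real.sqrt ε) ^ 2 = (n : ℝ) ^ 3 / ε := by
  rw [div_pow, Real.sq_sqrt hε.le, ← Real.rpow_natCast, ← Real.rpow_mul (Nat.cast_nonneg n),
    ← Real.rpow_natCast]
  norm_num

theorem le_rpow_div_sqrt {n : ℕ} {ε : ℝ} (hn : 1 ≤ n) (hε : 0 < ε) (hε1 : ε ≤ 1) :
    (n : ℝ) ≤ (n : ℝ) ^ (3 / 2 : ℝ) / Real.sqrt ε := by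
  have hn' : (1 : ℝ) ≤ n := by exact_mod_cast hn
  refine (pow_le_pow_iff_left₀ (by positivity) (by positivity) two_ne_zero).1 ?_
  rw [sq_rpow_div_sqrt n hε, le_div_iff₀ hε]
  calc (n : ℝ) ^ 2 * ε ≤ (n : ℝ) ^ 2 * (n : ℝ) := by gcongr; linarith
    _ = (n : ℝ) ^ 3 := by ring

/-- Here `τ = O(√(n / ε))`, and the logarithm `κ` of the length of the convolutions is `O(1 + log T)`. -/
theorem RAM.Group.Params.time_le_softO {n τ E κ : ℕ} {ε : ℝ} (hn : 1 ≤ n) (hε : 0 < ε)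
    (hε1 : ε ≤ 1) (h : Params n τ E κ (ENNReal.ofReal ε)) :
    (10 ^ 12 * (n * τ * κ ^ 3) : ℝ) ≤
      softO (10 ^ 16) 3 ((n : ℝ) ^ (3 / 2 : ℝ) / Real.sqrt ε) := by
  have hn' : (1 : ℝ) ≤ n := by exact_mod_cast hn
  have hsq := sq_rpow_div_sqrt n hε
  have hT1 := hn'.trans (le_rpow_div_sqrt hn hε hε1)
  have hTn := le_rpow_div_sqrt hn hε hε1
  set T := (n : ℝ) ^ (3 / 2 : ℝ) / Real.sqrt ε
  rw [eq_div_iff hε.ne'] at hsq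
  have hE : ε * E ≤ 3 := by
    have h1 := h.eps_mul
    rw [← ENNReal.ofReal_natCast, ← ENNReal.ofReal_mul hε.le,
      ← ENNReal.ofReal_ofNat, ENNReal.ofReal_le_ofReal_iff (by norm_num)] at h1
    exact h1
  have hτ : (n * τ : ℝ) ≤ 4 * T := by
    refine (pow_le_pow_iff_left₀ (by positivity) (by positivity) two_ne_zero).1 ?_
    have h1 : (τ * τ : ℝ) ≤ 4 * (n * E) := by exact_mod_cast h.sq_le
    refine le_of_mul_le_mul_right ?_ hε
    calc ((n : ℝ) * τ) ^ 2 * ε = n ^ 2 * (τ * τ) * ε := by ring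
      _ ≤ n ^ 2 * (4 * (n * E)) * ε := by gcongr
      _ = 4 * n ^ 3 * (ε * E) := by ring
      _ ≤ 4 * n ^ 3 * 3 := by gcongr
      _ ≤ 16 * n ^ 3 := by nlinarith [pow_pos (zero_lt_one.trans_le hn') 3]
      _ = (4 * T) ^ 2 * ε := by rw [← hsq]; ring
  have hlog0 : 0 ≤ Real.log T := Real.log_nonneg hT1
  have hκ : (κ : ℝ) ≤ 7 * (1 + Real.log T) := by
    have h1 : (2 : ℝ) ^ κ ≤ 2 ^ 6 * T ^ 2 := by
      have h2 : (2 : ℝ) ^ κ ≤ 2 * (4 * n * (2 * E + 1)) := by exact_mod_cast h.N_le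
      refine le_of_mul_le_mul_right ?_ hε
      calc (2 : ℝ) ^ κ * ε ≤ 2 * (4 * n * (2 * E + 1)) * ε := by gcongr
        _ = 8 * n * (2 * (ε * E) + ε) := by ring
        _ ≤ 8 * n * (2 * 3 + 2) := by gcongr; linarith
        _ = 2 ^ 6 * n := by ring
        _ ≤ 2 ^ 6 * n ^ 3 := by gcongr; exact le_self_pow₀ hn' (by norm_num)
        _ = 2 ^ 6 * T ^ 2 * ε := by rw [← hsq]; ring
    have h2 := Real.log_le_log (by positivity) h1
    rw [Real.log_pow, Real.log_mul (by positivity) (by positivity), Real.log_pow, Real.log_pow] at h2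
    have h3 : (1 / 2 : ℝ) < Real.log 2 := by have := Real.log_two_gt_d9; linarith
    have h4 : (κ : ℝ) * Real.log 2 ≤ (6 + 4 * Real.log T) * Real.log 2 := by
      push_cast at h2
      nlinarith
    have h5 := le_of_mul_le_mul_right h4 (by linarith)
    linarith
  have hκ3 : (κ : ℝ) ^ 3 ≤ (7 * (1 + Real.log T)) ^ 3 := by gcongr
  calc (10 ^ 12 * (n * τ * κ ^ 3) : ℝ) ≤ 10 ^ 12 * (4 * T * (7 * (1 + Real.log T)) ^ 3) := by gcongr
    _ = 1372 * 10 ^ 12 * (T * (1 + Real.log T) ^ 3) := by ring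
    _ ≤ 10 ^ 16 * (T * (1 + Real.log T) ^ 3) := by gcongr; norm_num
    _ = softO (10 ^ 16) 3 T := by rw [softO]; ring

theorem theorem7p4 :
    ∃ (P : RAM.Program) (c d : ℕ) (K : ℝ),
      ∀ (n : ℕ) (ε : ℝ) (A B : Fin n → ℝ≥0∞),
        1 ≤ n → 0 < ε → ε ≤ 1 → (∀ i, 1 ≤ A i) → (∀ i, 1 ≤ B i) →
        ∃ (t : ℕ) (s : RAM.State),
          RAM.Exec ((n + 2) ^ c) P (convInput ε A B) t s ∧
          (t : ℝ) ≤ softO K d ((n : ℝ) ^ (3 / 2 : ℝ) / Real.sqrt ε) ∧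
          IsApproxMinPlusConv ε A B (convOutput n s) := by
  -- words in memory stay below `(n + 2) ^ 16`, intermediate results below the power `1000` of that
  refine ⟨convApproxP, 16 * 1000, 3, 10 ^ 16, fun n ε A B hn hε hε1 hA hB => ?_⟩
  have hone : ∀ A : Fin n → ℝ≥0∞, (∀ i, 1 ≤ A i) → ∀ i < n, 1 ≤ arrayOf A i := fun A hA i hi => by
    simp only [arrayOf, hi, dif_pos]
    exact hA _
  set T := (n : ℝ) ^ (3 / 2 : ℝ) / Real.sqrt ε with hT
  have hnT : (n : ℝ) ≤ T := le_rpow_div_sqrt hn hε hε1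
  have hT1 : 1 ≤ T := le_trans (by exact_mod_cast hn) hnT
  have hlog : 1 ≤ (1 + Real.log T) ^ 3 :=
    one_le_pow₀ (le_add_of_nonneg_right (Real.log_nonneg hT1))
  have hpos : (n * 10 ^ 6 : ℝ) ≤ softO (10 ^ 16) 3 T := by
    rw [softO]
    calc (n * 10 ^ 6 : ℝ) ≤ 10 ^ 16 * T * 1 := by linarith
      _ ≤ _ := by gcongr
  have hsmall : (convInput ε A B).Small ((n + 2) ^ 16) := by
    have h1 : (n + 2) * 2 ^ 15 ≤ (n + 2) ^ 16 :=
      calc (n + 2) * 2 ^ 15 ≤ (n + 2) * (n + 2) ^ 15 := by gcongr; omega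
        _ = (n + 2) ^ 16 := by ring
    refine ⟨by omega, fun a i => ?_⟩
    simp only [convInput]
    split_ifs <;> omega
  obtain ⟨t, s, h1, h2, -, h3⟩ := runs_convApproxP (s := convInput ε A B) (X := (n + 2) ^ 16)
    (n := n) (T := ⌊softO (10 ^ 16) 3 T⌋₊) (ε := ENNReal.ofReal ε) (by simp [convInput]) hn
    (by simp [convInput]) (by simpa using hε1) rfl (hone A hA) (hone B hB)
    (Nat.le_floor (by exact_mod_cast hpos))
    (fun τ E κ hp hκ => Nat.le_floor (by exact_mod_cast hp.time_le_softO hn hε hε1)) hsmall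
  rw [← pow_mul] at h1
  refine ⟨t, s, h1, (Nat.cast_le.2 h2).trans (Nat.floor_le (le_trans (by positivity) hpos)), fun k => ?_⟩
  obtain ⟨h4, h5⟩ := h3 k k.2
  obtain ⟨i, j, hij, hC, hopt⟩ := exists_minPlusConv_eq A B k
  have wA : (convInput ε A B).weight 0 = arrayOf A := rfl
  have wB : (convInput ε A B).weight 1 = arrayOf B := rfl
  rw [wA, wB] at h4 h5
  rw [hC, convOutput]
  constructor
  · rcases h4 with h4 | ⟨i', -, j', -, h6, h7⟩
    · rw [h4]; exact le_top
    · exact (hopt i' j' h6).trans h7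
  · rw [ENNReal.ofReal_add zero_le_one hε.le, ENNReal.ofReal_one]
    by_cases hfin : arrayOf A i + arrayOf B j = ∞
    · rw [hfin, ENNReal.mul_top (by simp)]
      exact le_top
    · rw [ENNReal.add_eq_top, not_or] at hfin
      exact h5 i j hij hfin.1 hfin.2 (by rw [hij]; exact hopt)
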